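/- **Proposition 2.4.** Let $\Bbbk$ be a field, and let $\mathcal R=\Bbbk[t^{-1},t]]$ be the field of Laurent series in $t$. Let $\beta$ be a braid diagram on $b\ge 1$ strands whose $n$ crossings lie in distinct horizontal layers, and assume $n\ge 1$ or $b=1$. Let $G$ be the closed braid graph obtained from $\beta$ by replacing each crossing with a thick edge (with two incoming and two outgoing thin edges) and closing all strands except the outermost one, which is left cut. A strand without thick edges carries one bivalent vertex. Give $G$ the framing $\mathtt s$ in which a thin edge with $k$ thick edges (counted by layers, cyclically along closed strands) between the thick edges at its ends is framed $k+1$ (likewise for the bottom boundary edge with $k$ thick edges below its end), and the total framing on each strand, including the cut one, is $n$. On a strand without thick edges this means framing $n$ on the edge entering the bivalent vertex, and $0$ on the top boundary edge if the strand is the cut one. Designate the component containing the cut edge as special. *The homology $\mathcal B(G^{\mathtt s})$.* Assign to each thin edge $e$ of framing $\ell_e$ variables $x_e$ (first segment) and $y_e$ (second segment). The edge ring is $\mathcal E=\mathcal R[\underline x,\underline y]/(t^{\ell_e}y_e-x_e)_e\cong\mathcal R[\underline x]$. Let $L\subset\mathcal E$ be generated by the elements $x_a+x_b-y_c-y_d$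 for thick edges with outgoing thin edges $a,b$ and incoming thin edges $c,d$. Let $N\subset\mathcal E$ be generated by the elements $t^{w(\Gamma)}x_{\Gamma,\mathrm{out}}-y_{\Gamma,\mathrm{in}}$ for all sets $\Gamma$ of thick edges and bivalent vertices, where $w(\Gamma)$ is the sum of the framings of the thin edges with both ends in $\Gamma$, $x_{\Gamma,\mathrm{out}}$ is the product of the $x_e$ over thin edges leaving $\Gamma$, and $y_{\Gamma,\mathrm{in}}$ is the product of the $y_e$ over thin edges entering $\Gamma$. With $V$ the free $\mathcal E$-module on the non-special connected components of $G$, $$\mathcal B(G^{\mathtt s})=\operatorname{Tor}^{\mathcal E}_*(\mathcal E/L,\mathcal E/N)\otimes_{\mathcal E}\Lambda^*V .$$ *The homology $\mathcal A(G)$.* Form the layered diagram of $G$: each of its $n$ layers consists of one thick edge and one bivalent vertex on every strand not meeting that thick edge. Let $\mathcal A(G)$ be the quotient of the polynomial ring over $\mathcal R$ with one variable $x_e$ for each thin edge $e$ of the layered diagram by the relations - $t(x_a+x_b)=x_c+x_d$ and $t^2x_ax_b=x_cx_d$ for thick edges (outgoing $a,b$, incoming $c,d$); - $tx_a=x_c$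 for bivalent vertices (outgoing $a$, incoming $c$); - $t^{\omega(\Gamma)}x_{\Gamma,\mathrm{out}}=x_{\Gamma,\mathrm{in}}$ for all sets $\Gamma$ of thick edges and bivalent vertices, where $\omega(\Gamma)$ is twice the number of thick edges plus the number of bivalent vertices in $\Gamma$. It is an $\mathcal E$-module by letting $x_e$ act as the variable of the first segment of $e$ in the layered diagram. (The edge leaving the bivalent vertex of a strand without thick edges begins with the segment above the last layer.) Then $\mathcal B(G^{\mathtt s})\cong\mathcal A(G)$ as $\mathcal E$-modules. If $G$ is disconnected, both sides vanish. In all cases $\operatorname{Tor}_i\otimes\Lambda^jV=0$ for $(i,j)\ne(0,0)$, and the part $\operatorname{Tor}_0\otimes\Lambda^0V$ is isomorphic to $\mathcal A(G)$; in particular, for connected $G$, $\mathcal B(G^{\mathtt s})$ is concentrated in degree zero, where it is $\mathcal A(G)$. -/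

import Mathlib

open scoped TensorProduct DirectSum

noncomputable section

universe u

namespace BraidGraph

/-- The combinatorial data of an oriented trivalent graph with boundary whose edges are thin or
thick.  A thick edge is recorded together with its two trivalent end points (two incoming and two
outgoing thin edges); a bivalent vertex has one incoming and one outgoing thin edge.  `src e` and
`tgt e` are the thick edge or bivalent vertex at the beginning and at the end of the thin edge `e`;
the value `none` means that `e` begins (ends) at a boundary vertex. -/
structure ThinGraph where
  Thick : Type
  Bivalent : Type
  Edge : Type
  [fintypeThick : Fintype Thick]
  [fintypeBivalent : Fintype Bivalent]
  [fintypeEdge : Fintype Edge]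
  [decEqThick : DecidableEq Thick]
  [decEqBivalent : DecidableEq Bivalent]
  [decEqEdge : DecidableEq Edge]
  src : Edge → Option (Thick ⊕ Bivalent)
  tgt : Edge → Option (Thick ⊕ Bivalent)

attribute [instance] ThinGraph.fintypeThick ThinGraph.fintypeBivalent ThinGraph.fintypeEdge
  ThinGraph.decEqThick ThinGraph.decEqBivalent ThinGraph.decEqEdge

/-- A framed graph: each thin edge carries an integer marking (the number of half twists compared
with the blackboard framing); thick edges are blackboard framed. -/
structure FramedGraph extends ThinGraph where
  framing : Edge → ℤ

namespace ThinGraph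

variable (G : ThinGraph)

/-- Thick edges and bivalent vertices. -/
abbrev Node : Type := G.Thick ⊕ G.Bivalent

/-- Thin edges leaving a thick edge or bivalent vertex. -/
def outEdges (v : G.Node) : Finset G.Edge := {e | G.src e = some v}

/-- Thin edges entering a thick edge or bivalent vertex. -/
def inEdges (v : G.Node) : Finset G.Edge := {e | G.tgt e = some v}

/-- `e` begins at a member of `γ`. -/
def Starts (γ : Finset G.Node) (e : G.Edge) : Prop := ∃ v ∈ γ, G.src e = some v

/-- `e` ends at a member of `γ`. -/
def Ends (γ : Finset G.Node) (e : G.Edge) : Prop := ∃ v ∈ γ, G.tgt e = some v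

instance (γ : Finset G.Node) (e : G.Edge) : Decidable (G.Starts γ e) :=
  inferInstanceAs (Decidable (∃ v ∈ γ, G.src e = some v))

instance (γ : Finset G.Node) (e : G.Edge) : Decidable (G.Ends γ e) :=
  inferInstanceAs (Decidable (∃ v ∈ γ, G.tgt e = some v))

/-- Thin edges from `γ` to its complement (or to the boundary). -/
def cutOut (γ : Finset G.Node) : Finset G.Edge := {e | G.Starts γ e ∧ ¬ G.Ends γ e}

/-- Thin edges into `γ` from its complement (or from the boundary). -/
def cutIn (γ : Finset G.Node) : Finset G.Edge := {e | ¬ G.Starts γ e ∧ G.Ends γ e}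

/-- Thin edges with both ends in `γ`. -/
def internal (γ : Finset G.Node) : Finset G.Edge := {e | G.Starts γ e ∧ G.Ends γ e}

/-- `e` is incident to `v`. -/
def Incident (e : G.Edge) (v : G.Node) : Prop := G.src e = some v ∨ G.tgt e = some v

/-- Two thin edges are adjacent when they share a thick edge or a bivalent vertex.  The connected
components of this graph are the connected components of `G`. -/
def adjacency : SimpleGraph G.Edge :=
  SimpleGraph.fromRel fun e f => ∃ v, G.Incident e v ∧ G.Incident f v

/-- The connected components of `G`. -/
abbrev Component : Type := G.adjacency.ConnectedComponent

end ThinGraph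

section Homology

variable (𝕜 : Type u) [Field 𝕜]

/-- The power `t ^ ℓ` in the field of Laurent series in `t`. -/
def tPow (ℓ : ℤ) : LaurentSeries 𝕜 := HahnSeries.single ℓ 1

variable (G : FramedGraph)

/-- The polynomial ring in the variables `x_e = X (inl e)` and `y_e = X (inr e)`, which label the
first and the second segment of the thin edge `e`. -/
abbrev SegmentRing : Type u := MvPolynomial (G.Edge ⊕ G.Edge) (LaurentSeries 𝕜)

variable {G} in
/-- The variable `x_e`. -/
def xVar (e : G.Edge) : SegmentRing 𝕜 G := MvPolynomial.X (Sum.inl e)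

variable {G} in
/-- The variable `y_e`. -/
def yVar (e : G.Edge) : SegmentRing 𝕜 G := MvPolynomial.X (Sum.inr e)

/-- The framing ideal `F(G)`. -/
def framingIdeal : Ideal (SegmentRing 𝕜 G) :=
  Ideal.span (Set.range fun e : G.Edge =>
    MvPolynomial.C (tPow 𝕜 (G.framing e)) * yVar 𝕜 e - xVar 𝕜 e)

/-- The linear ideal `L(G)`, generated by `(x_a + x_b) - (y_c + y_d)` for each thick edge with
outgoing thin edges `a, b` and incoming thin edges `c, d`. -/
def linearIdeal : Ideal (SegmentRing 𝕜 G) :=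
  Ideal.span (Set.range fun v : G.Thick =>
    ∑ e ∈ G.outEdges (Sum.inl v), xVar 𝕜 e - ∑ e ∈ G.inEdges (Sum.inl v), yVar 𝕜 e)

/-- The weight of a set of thick edges and bivalent vertices: the sum of the framings on its
internal thin edges. -/
def weight (γ : Finset G.Node) : ℤ := ∑ e ∈ G.internal γ, G.framing e

/-- The non-local ideal `N(G)`, with one generator for each set of thick edges and bivalent
vertices. -/
def nonlocalIdeal : Ideal (SegmentRing 𝕜 G) :=
  Ideal.span (Set.range fun γ : Finset G.Node =>
    MvPolynomial.C (tPow 𝕜 (weight G γ)) * ∏ e ∈ G.cutOut γ, xVar 𝕜 e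
      - ∏ e ∈ G.cutIn γ, yVar 𝕜 e)

/-- The edge ring `E(G)`, which retains one variable `x_e` for each thin edge. -/
abbrev EdgeRing : Type u := MvPolynomial G.Edge (LaurentSeries 𝕜)

/-- The projection to the edge ring, which retains `x_e` and sends `y_e` to `t ^ (-ℓ) x_e` when `e`
has framing `ℓ`. -/
def toEdgeRing : SegmentRing 𝕜 G →ₐ[LaurentSeries 𝕜] EdgeRing 𝕜 G :=
  MvPolynomial.aeval (Sum.elim MvPolynomial.X fun e =>
    MvPolynomial.C (tPow 𝕜 (-G.framing e)) * MvPolynomial.X e)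

lemma tPow_mul_tPow_neg (ℓ : ℤ) : tPow 𝕜 ℓ * tPow 𝕜 (-ℓ) = 1 := by
  simp [tPow]

/-- The projection to the edge ring is surjective. -/
lemma toEdgeRing_surjective : Function.Surjective (toEdgeRing 𝕜 G) := by
  intro p
  refine ⟨MvPolynomial.rename Sum.inl p, ?_⟩
  rw [toEdgeRing, MvPolynomial.aeval_rename]
  exact MvPolynomial.aeval_X_left_apply p

/-- The edge ring is the quotient of the segment ring by the framing ideal. -/
lemma ker_toEdgeRing : RingHom.ker (toEdgeRing 𝕜 G) = framingIdeal 𝕜 G := by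
  apply le_antisymm
  · intro p hp
    have key : ((Ideal.Quotient.mkₐ (LaurentSeries 𝕜) (framingIdeal 𝕜 G)).comp
        ((MvPolynomial.rename Sum.inl).comp (toEdgeRing 𝕜 G))) =
        Ideal.Quotient.mkₐ (LaurentSeries 𝕜) (framingIdeal 𝕜 G) := by
      apply MvPolynomial.algHom_ext
      rintro (e | e)
      · simp [toEdgeRing]
      · simp only [toEdgeRing, AlgHom.comp_apply, MvPolynomial.aeval_X, Sum.elim_inr, map_mul,
          MvPolynomial.rename_X, Ideal.Quotient.mkₐ_eq_mk]
        rw [← map_mul, Ideal.Quotient.eq]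
        have h : MvPolynomial.C (tPow 𝕜 (G.framing e)) * yVar 𝕜 e - xVar 𝕜 e ∈ framingIdeal 𝕜 G :=
          Ideal.subset_span ⟨e, rfl⟩
        have h2 := (framingIdeal 𝕜 G).mul_mem_left
          (-(MvPolynomial.C (tPow 𝕜 (-G.framing e)))) h
        have h3 : (MvPolynomial.C (tPow 𝕜 (-G.framing e)) : SegmentRing 𝕜 G) *
            MvPolynomial.C (tPow 𝕜 (G.framing e)) = 1 := by
          rw [← MvPolynomial.C_mul, mul_comm, tPow_mul_tPow_neg, MvPolynomial.C_1]
        convert h2 using 1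
        simp only [xVar, yVar, MvPolynomial.rename_C] at *
        linear_combination (MvPolynomial.X (Sum.inr e)) * h3
    have h1 := DFunLike.congr_fun key p
    have h0 : toEdgeRing 𝕜 G p = 0 := hp
    rw [AlgHom.comp_apply, AlgHom.comp_apply, h0, map_zero, map_zero] at h1
    exact Ideal.Quotient.eq_zero_iff_mem.1 h1.symm
  · rw [framingIdeal, Ideal.span_le]
    rintro _ ⟨e, rfl⟩
    change toEdgeRing 𝕜 G _ = 0
    simp only [toEdgeRing, xVar, yVar, map_sub, map_mul, MvPolynomial.algHom_C,
      MvPolynomial.aeval_X, Sum.elim_inr, Sum.elim_inl, MvPolynomial.algebraMap_eq]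
    rw [← mul_assoc, ← MvPolynomial.C_mul, tPow_mul_tPow_neg, MvPolynomial.C_1, one_mul, sub_self]

/-- The image of `L(G)` in the edge ring. -/
def edgeLinearIdeal : Ideal (EdgeRing 𝕜 G) := (linearIdeal 𝕜 G).map (toEdgeRing 𝕜 G)

/-- The image of `N(G)` in the edge ring. -/
def edgeNonlocalIdeal : Ideal (EdgeRing 𝕜 G) := (nonlocalIdeal 𝕜 G).map (toEdgeRing 𝕜 G)

/-- `Tor_i (E(G)/L(G), E(G)/N(G))` over the edge ring.  (`Tor'` is the left derived functor of
`⊗` in its first argument.) -/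
abbrev torGroup (i : ℕ) : ModuleCat.{u} (EdgeRing 𝕜 G) :=
  ((CategoryTheory.Tor' (ModuleCat.{u} (EdgeRing 𝕜 G)) i).obj
    (ModuleCat.of _ (EdgeRing 𝕜 G ⧸ edgeLinearIdeal 𝕜 G))).obj
    (ModuleCat.of _ (EdgeRing 𝕜 G ⧸ edgeNonlocalIdeal 𝕜 G))

/-- The free module `V_G` on the connected components of `G` that are not special. -/
abbrev componentModule (special : Set G.Component) : Type u :=
  {K : G.Component // K ∉ special} →₀ EdgeRing 𝕜 G

/-- The summand `Tor_i ⊗ Λ^j V_G` of the graph homology `B(G)`. -/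
abbrev graphHomologyPart (special : Set G.Component) (i j : ℕ) : Type u :=
  torGroup 𝕜 G i ⊗[EdgeRing 𝕜 G] (⋀[EdgeRing 𝕜 G]^j (componentModule 𝕜 G special))

/-- The graph homology `B(G) = Tor_* (E(G)/L(G), E(G)/N(G)) ⊗ Λ^* V_G`. -/
abbrev graphHomology (special : Set G.Component) : Type u :=
  ⨁ d : ℕ × ℕ, graphHomologyPart 𝕜 G special d.1 d.2

end Homology

section Braids

variable {m n : ℕ}

/-- Crossing diagrams of braids on `m + 1` strands with `n` crossings in distinct horizontal
layers are encoded by `c : Fin n → Fin m`: counting layers from the bottom, the crossing in layer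
`j` involves the adjacent strands `c j` and `c j + 1`.  `Touches c p j` says that strand `p` is
involved in the crossing in layer `j`. -/
def Touches (c : Fin n → Fin m) (p : Fin (m + 1)) (j : Fin n) : Prop :=
  p = (c j).castSucc ∨ p = (c j).succ

instance (c : Fin n → Fin m) (p : Fin (m + 1)) (j : Fin n) : Decidable (Touches c p j) :=
  inferInstanceAs (Decidable (_ ∨ _))

/-- The strands that are not involved in any crossing. -/
abbrev Crossingless (c : Fin n → Fin m) : Type := {p : Fin (m + 1) // ∀ j, ¬ Touches c p j}

/-- The layers in position `h` or higher whose crossing involves strand `p`. -/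
def layersFrom (c : Fin n → Fin m) (p : Fin (m + 1)) (h : ℕ) : Finset (Fin n) :=
  {j | Touches c p j ∧ h ≤ j}

/-- The thin edges of the closed braid graph: the bottom boundary edge of the cut strand `0`, the
left and the right thin edge leaving the thick edge in layer `j`, and the thin edge leaving the
bivalent vertex on a strand without thick edges. -/
inductive ClosedEdge (c : Fin n → Fin m) : Type
  | bottom : ClosedEdge c
  | left (j : Fin n) : ClosedEdge c
  | right (j : Fin n) : ClosedEdge c
  | bivalentOut (p : Crossingless c) : ClosedEdge c
deriving DecidableEq, Fintype

/-- Follow strand `p` upwards, starting just below layer `h`, to the next thick edge, where all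
strands but strand `0` are closed up.  The result is the end of this thin edge, and the number of
layers climbed on the way, with the start counted as lying in layer `h - 1`.  For a thin edge
between two thick edges with `k` thick edges between them that number is `k + 1`. -/
def climb (c : Fin n → Fin m) (p : Fin (m + 1)) (h : ℕ) : Option (Fin n ⊕ Crossingless c) × ℤ :=
  if above : (layersFrom c p h).Nonempty then
    (some (Sum.inl ((layersFrom c p h).min' above)),
      ((((layersFrom c p h).min' above : Fin n) : ℕ) : ℤ) + 1 - h)
  else if p = 0 then (none, n - h)
  else if all : (layersFrom c p 0).Nonempty then
    (some (Sum.inl ((layersFrom c p 0).min' all)),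
      n + ((((layersFrom c p 0).min' all : Fin n) : ℕ) : ℤ) + 1 - h)
  else
    (some (Sum.inr ⟨p, fun j hj => all ⟨j, by simp [layersFrom, hj]⟩⟩), n)

/-- The end of a thin edge of the closed braid graph, and its framing.  A strand without thick
edges carries one bivalent vertex, at the top of the strand. -/
def ClosedEdge.tgtAndFraming (c : Fin n → Fin m) :
    ClosedEdge c → Option (Fin n ⊕ Crossingless c) × ℤ
  | .bottom => if h : ∀ j, ¬ Touches c 0 j then (some (Sum.inr ⟨0, h⟩), n) else climb c 0 0
  | .left j => climb c (c j).castSucc (j + 1)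
  | .right j => climb c (c j).succ (j + 1)
  | .bivalentOut p => climb c p.1 n

/-- The beginning of a thin edge of the closed braid graph. -/
def ClosedEdge.source (c : Fin n → Fin m) : ClosedEdge c → Option (Fin n ⊕ Crossingless c)
  | .bottom => none
  | .left j => some (Sum.inl j)
  | .right j => some (Sum.inl j)
  | .bivalentOut p => some (Sum.inr p)

/-- The closed braid graph obtained from a layered braid diagram by replacing its crossings with
thick edges and closing all strands but the outermost strand `0`, which is cut, with the layered
framing: a thin edge with `k` thick edges between its end points is framed `k + 1`, and the total
framing on each strand is the number `n` of thick edges. -/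
def closedBraidGraph (c : Fin n → Fin m) : FramedGraph where
  Thick := Fin n
  Bivalent := Crossingless c
  Edge := ClosedEdge c
  src := ClosedEdge.source c
  tgt e := (e.tgtAndFraming c).1
  framing e := (e.tgtAndFraming c).2

/-- The connected component of the cut edge. -/
def cutComponent (c : Fin n → Fin m) : (closedBraidGraph c).Component :=
  (closedBraidGraph c).adjacency.connectedComponentMk ClosedEdge.bottom

/-- The thick edge or bivalent vertex of the layered diagram in layer `j` on strand `p`. -/
def layeredNode (c : Fin n → Fin m) (j : Fin n) (p : Fin (m + 1)) :
    Fin n ⊕ {q : Fin n × Fin (m + 1) // ¬ Touches c q.2 q.1} :=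
  if h : Touches c p j then Sum.inl j else Sum.inr ⟨(j, p), h⟩

/-- The layered diagram: layer `j` consists of one thick edge and of a bivalent vertex on each
strand that does not meet this thick edge.  The edge `none` is the bottom edge of the cut strand
`0`, and `some (j, p)` leaves layer `j` on strand `p`; above the last layer all strands but strand
`0` return to layer `0`. -/
def layeredGraph (c : Fin n → Fin m) : ThinGraph where
  Thick := Fin n
  Bivalent := {q : Fin n × Fin (m + 1) // ¬ Touches c q.2 q.1}
  Edge := Option (Fin n × Fin (m + 1))
  src
    | none => none
    | some (j, p) => some (layeredNode c j p)
  tgt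
    | none => if h : 0 < n then some (layeredNode c ⟨0, h⟩ 0) else none
    | some (j, p) =>
      if h : (j : ℕ) + 1 < n then some (layeredNode c ⟨j + 1, h⟩ p)
      else if p = 0 then none
      else some (layeredNode c ⟨0, j.pos⟩ p)

end Braids

section Alternative

variable (𝕜 : Type u) [Field 𝕜] (G : ThinGraph)

/-- The polynomial ring with one variable for each thin edge of a graph. -/
abbrev ThinRing : Type u := MvPolynomial G.Edge (LaurentSeries 𝕜)

variable {G} in
/-- The variable of a thin edge. -/
def thinVar (e : G.Edge) : ThinRing 𝕜 G := MvPolynomial.X e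

/-- The linear relations `t (x_a + x_b) = x_c + x_d` at thick edges. -/
def twistedLinearIdeal : Ideal (ThinRing 𝕜 G) :=
  Ideal.span (Set.range fun v : G.Thick =>
    MvPolynomial.C (tPow 𝕜 1) * ∑ e ∈ G.outEdges (Sum.inl v), thinVar 𝕜 e
      - ∑ e ∈ G.inEdges (Sum.inl v), thinVar 𝕜 e)

/-- The relations `t ^ 2 x_a x_b = x_c x_d` at thick edges and `t x_a = x_c` at bivalent
vertices. -/
def twistedQuadraticIdeal : Ideal (ThinRing 𝕜 G) :=
  Ideal.span (Set.range fun v : G.Thick =>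
    MvPolynomial.C (tPow 𝕜 2) * ∏ e ∈ G.outEdges (Sum.inl v), thinVar 𝕜 e
      - ∏ e ∈ G.inEdges (Sum.inl v), thinVar 𝕜 e) ⊔
  Ideal.span (Set.range fun v : G.Bivalent =>
    MvPolynomial.C (tPow 𝕜 1) * ∏ e ∈ G.outEdges (Sum.inr v), thinVar 𝕜 e
      - ∏ e ∈ G.inEdges (Sum.inr v), thinVar 𝕜 e)

/-- Twice the number of thick edges plus the number of bivalent vertices. -/
def vertexWeight (γ : Finset G.Node) : ℤ := ∑ v ∈ γ, Sum.elim (fun _ => 2) (fun _ => 1) v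

/-- The non-local relations `t ^ w(γ) x_{γ,out} = x_{γ,in}`. -/
def twistedNonlocalIdeal : Ideal (ThinRing 𝕜 G) :=
  Ideal.span (Set.range fun γ : Finset G.Node =>
    MvPolynomial.C (tPow 𝕜 (vertexWeight G γ)) * ∏ e ∈ G.cutOut γ, thinVar 𝕜 e
      - ∏ e ∈ G.cutIn γ, thinVar 𝕜 e)

variable {m n : ℕ} (c : Fin n → Fin m)

/-- The alternative knot Floer graph homology `A(G)` of the closed braid graph `G`: the quotient of
the polynomial ring of the layered diagram by the linear, quadratic and non-local relations. -/
def altGraphHomology : Type u :=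
  ThinRing 𝕜 (layeredGraph c) ⧸ (twistedLinearIdeal 𝕜 (layeredGraph c) ⊔
    twistedQuadraticIdeal 𝕜 (layeredGraph c) ⊔ twistedNonlocalIdeal 𝕜 (layeredGraph c))

instance : CommRing (altGraphHomology 𝕜 c) :=
  inferInstanceAs (CommRing (ThinRing 𝕜 (layeredGraph c) ⧸ _))

/-- The edge of the layered diagram with which a thin edge of the closed braid graph begins. -/
def firstSegment : ClosedEdge c → (layeredGraph c).Edge
  | .bottom => none
  | .left j => some (j, (c j).castSucc)
  | .right j => some (j, (c j).succ)
  | .bivalentOut p => if h : 0 < n then some (⟨n - 1, Nat.sub_lt h one_pos⟩, p.1) else none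

/-- The ring map from the edge ring of the closed braid graph to `A(G)` that sends the variable
`x_e` to the class of the variable of the first segment of `e` in the layered diagram. -/
def edgeRingToAlt : EdgeRing 𝕜 (closedBraidGraph c) →+* altGraphHomology 𝕜 c :=
  (Ideal.Quotient.mk _).comp
    (MvPolynomial.rename (firstSegment c) : MvPolynomial (ClosedEdge c) (LaurentSeries 𝕜) →ₐ[_]
      MvPolynomial (layeredGraph c).Edge (LaurentSeries 𝕜)).toRingHom

/-- `A(G)` as a module over the edge ring of `G`. -/
instance : Module (EdgeRing 𝕜 (closedBraidGraph c)) (altGraphHomology 𝕜 c) :=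
  Module.compHom _ (edgeRingToAlt 𝕜 c)

end Alternative

end BraidGraph

end

/-! Write `E` for the edge ring, `K` for the field of Laurent series, and `L`, `N` for the images of
the two ideals in `E`. Three facts suffice: `E/(L + N)` is `A(G)`; for connected `G` the higher Tor
of `E/L` and `E/N` vanishes; for disconnected `G` both sides are zero. If `m > 0`, connectedness
means that every column of the braid contains a crossing, that is, `c` is surjective.

Vanishing of Tor. In the connected case with `m > 0` there are `n` vertices and `2n + 1` variables.
The `n` linear generators of `L` and the variable `x` of the cut edge are linearly independent, so
`n` further linear coordinates complete them to a basis. Two properties of `N` are used. (1) `E/N`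
has flat dimension at most `n` (`CutIdeal.hasFlatDimensionLT_quotient`). Every nonempty set of
vertices is entered by some edge. Choose an edge `e` that enters the whole vertex set, at `v`. Let
`I` be the ideal without `e` and `v`, and `I'` the ideal without `e` in which the parameter of `v`
is zero. The module `I'/I` is the kernel of `R/I → R/I'`. It also embeds in `R/I` by the difference
of `X e` and a map `φ` that pushes monomials through sets containing `v`; the cokernel of this
embedding is the quotient by the larger ideal. Induction applies to `I` and `I'`. (2) `E/(L + N)` is
integral over `K[x]` (`isIntegralElem_edge`). By the local relations, the polynomial with roots `t^h
x_{p,h}`, where `p` runs over the strands, does not depend on the layer `h`. Comparing bottom and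
top gives a `q`-difference equation with `q = t^n`, which determines the coefficients as polynomials
in `x`. By (2), `L + N` contains `n` elements, each monic in one of the `n` further coordinates, and
these form a regular sequence on `E/L`. On Ext into the character module of `E/N` they act as zero,
while long exact sequences make them act surjectively in the relevant degrees. Going through the
sequence uses up the flat dimension from (1) and leaves only degree zero
(`isZero_tor_of_regular_sequence`).

Comparison with `A(G)`. The relations at bivalent vertices move each variable of the layered diagram
down to the first segment of its thin edge, at the cost of a power of `t` recorded by `offset`.
Under this substitution the layered relations become relations of `G`; conversely, every cut of `G`
is refined to a cut of the layered diagram.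

Disconnected case. The vertices to the right of an empty column have no cut edges and positive
weight `w`, so the unit `t^w - 1` is among the relations on both sides. -/

noncomputable section

set_option linter.unusedSectionVars false
set_option linter.unnecessarySeqFocus false

/-! ### Flat dimension through character modules, and vanishing of Tor -/

section FlatDimension

open CategoryTheory Abelian

variable {A : Type u} [CommRing A]

/-- The flat dimension of `Y` is less than `n`, expressed as a bound on the injective dimension of
the character module of `Y`. -/
def HasFlatDimensionLT (A : Type u) [CommRing A] (Y : Type u) [AddCommGroup Y] [Module A Y]
    (n : ℕ) : Prop :=
  HasInjectiveDimensionLT (ModuleCat.of A (CharacterModule Y)) n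

namespace HasFlatDimensionLT

variable {X Y Z : Type u} [AddCommGroup X] [Module A X] [AddCommGroup Y] [Module A Y]
  [AddCommGroup Z] [Module A Z]

lemma of_flat [Module.Flat A Y] : HasFlatDimensionLT A Y 1 := by
  have h : Module.Injective A (CharacterModule Y) :=
    Module.Flat.iff_characterModule_injective.1 inferInstance
  have : Injective (ModuleCat.of A (CharacterModule Y)) :=
    Module.injective_object_of_injective_module A _
  exact injective_iff_hasInjectiveDimensionLT_one.1 this

lemma of_subsingleton [Subsingleton Y] : HasFlatDimensionLT A Y 0 := by
  have : Subsingleton (CharacterModule Y) := ⟨fun a b => by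
    ext x; rw [Subsingleton.elim x 0, map_zero, map_zero]⟩
  exact (ModuleCat.isZero_of_subsingleton _).hasInjectiveDimensionLT_zero

lemma mono {m n : ℕ} (h : HasFlatDimensionLT A Y m) (hmn : m ≤ n) : HasFlatDimensionLT A Y n := by
  unfold HasFlatDimensionLT at *
  exact hasInjectiveDimensionLT_of_ge _ m n hmn

lemma of_equiv {n : ℕ} (e : X ≃ₗ[A] Y) (h : HasFlatDimensionLT A X n) :
    HasFlatDimensionLT A Y n := by
  unfold HasFlatDimensionLT at *
  exact hasInjectiveDimensionLT_of_iso (CharacterModule.congr e).toModuleIso n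

/-- The short exact sequence of character modules. -/
lemma shortExact_character (f : X →ₗ[A] Y) (g : Y →ₗ[A] Z) (hf : Function.Injective f)
    (hg : Function.Surjective g) (hfg : Function.Exact f g) :
    (ShortComplex.mk (ModuleCat.ofHom (CharacterModule.dual g))
      (ModuleCat.ofHom (CharacterModule.dual f)) (by
        rw [← ModuleCat.ofHom_comp, ← CharacterModule.dual_comp, hfg.linearMap_comp_eq_zero,
          CharacterModule.dual_zero]; rfl)).ShortExact := by
  refine ShortComplex.ShortExact.mk' ?_ ?_ ?_
  · rw [ShortComplex.moduleCat_exact_iff]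
    intro c hc
    have hc' : ∀ x, c (f x) = 0 := fun x => DFunLike.congr_fun hc x
    have hker : LinearMap.ker (g.toAddMonoidHom.toIntLinearMap) ≤
        LinearMap.ker (c : Y →+ AddCircle (1 : ℚ)).toIntLinearMap := by
      intro y hy
      obtain ⟨x, rfl⟩ := (hfg y).1 hy
      exact hc' x
    let q := LinearMap.quotKerEquivOfSurjective g.toAddMonoidHom.toIntLinearMap hg
    refine ⟨(((LinearMap.ker g.toAddMonoidHom.toIntLinearMap).liftQ _ hker).comp
      q.symm.toLinearMap).toAddMonoidHom, ?_⟩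
    apply CharacterModule.ext
    intro y
    have hq : q.symm (g y) = Submodule.Quotient.mk y := by
      rw [LinearEquiv.symm_apply_eq]; rfl
    change ((LinearMap.ker g.toAddMonoidHom.toIntLinearMap).liftQ _ hker) (q.symm (g y)) = c y
    rw [hq]; rfl
  · rw [ModuleCat.mono_iff_injective]
    exact CharacterModule.dual_injective_of_surjective g hg
  · rw [ModuleCat.epi_iff_surjective]
    exact CharacterModule.dual_surjective_of_injective f hf

/-- The character functor is exact and reverses arrows, so this and the next lemma are dimension
shifting for injective dimension in the dual sequence. -/
lemma of_exact_right {n : ℕ} (f : X →ₗ[A] Y) (g : Y →ₗ[A] Z) (hf : Function.Injective f)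
    (hg : Function.Surjective g) (hfg : Function.Exact f g) (hX : HasFlatDimensionLT A X n)
    (hY : HasFlatDimensionLT A Y (n + 1)) : HasFlatDimensionLT A Z (n + 1) :=
  (shortExact_character f g hf hg hfg).hasInjectiveDimensionLT_X₁ n hX hY

lemma of_exact_left {n : ℕ} (f : X →ₗ[A] Y) (g : Y →ₗ[A] Z) (hf : Function.Injective f)
    (hg : Function.Surjective g) (hfg : Function.Exact f g) (hY : HasFlatDimensionLT A Y n)
    (hZ : HasFlatDimensionLT A Z (n + 1)) : HasFlatDimensionLT A X n :=
  (shortExact_character f g hf hg hfg).hasInjectiveDimensionLT_X₃ n hY hZ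

end HasFlatDimensionLT

/-- Vanishing of `Ext` into the character module of `Y` implies vanishing of `Tor` with `Y`. -/
lemma isZero_tor_of_subsingleton_ext (X Y : ModuleCat.{u} A) (i : ℕ)
    (h : Subsingleton (Ext X (ModuleCat.of A (CharacterModule Y)) (i + 1))) :
    Limits.IsZero (((Tor' (ModuleCat.{u} A) (i + 1)).obj X).obj Y) := by
  let P := projectiveResolution X
  refine Limits.IsZero.of_iso ?_
    (P.isoLeftDerivedObj ((MonoidalCategory.tensoringRight (ModuleCat.{u} A)).obj Y) (i + 1))
  rw [show HomologicalComplex.homologyFunctor _ _ (i + 1) = _ from rfl]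
  change Limits.IsZero (HomologicalComplex.homology _ (i + 1))
  rw [← HomologicalComplex.exactAt_iff_isZero_homology,
    HomologicalComplex.exactAt_iff' _ (i + 2) (i + 1) i (by simp) (by simp),
    ShortComplex.moduleCat_exact_iff]
  let d₁ : P.complex.X (i + 2) →ₗ[A] P.complex.X (i + 1) := (P.complex.d (i + 2) (i + 1)).hom
  let d₀ : P.complex.X (i + 1) →ₗ[A] P.complex.X i := (P.complex.d (i + 1) i).hom
  have main : ∀ z : P.complex.X (i + 1) ⊗[A] Y, d₀.rTensor Y z = 0 →
      z ∈ LinearMap.range (d₁.rTensor Y) := by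
    intro z hz
    -- A cycle that is not a boundary is detected by a character of the cokernel. Curried, this
    -- character is a cocycle on the projective resolution with values in the character module of
    -- `Y`.
    by_contra hmem
    obtain ⟨χ, hχ⟩ := CharacterModule.exists_character_apply_ne_zero_of_ne_zero
      (a := Submodule.Quotient.mk (p := LinearMap.range (d₁.rTensor Y)) z)
      (by rwa [Ne, Submodule.Quotient.mk_eq_zero])
    let c : CharacterModule (P.complex.X (i + 1) ⊗[A] Y) :=
      CharacterModule.dual (LinearMap.range (d₁.rTensor Y)).mkQ χ
    have hc : ∀ x y, c (d₁ x ⊗ₜ y) = 0 := fun x y => by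
      have : (LinearMap.range (d₁.rTensor Y)).mkQ (d₁ x ⊗ₜ y) = 0 := by
        rw [Submodule.mkQ_apply, Submodule.Quotient.mk_eq_zero]
        exact ⟨x ⊗ₜ y, rfl⟩
      exact (congrArg χ this).trans (map_zero χ)
    let φ : P.complex.X (i + 1) ⟶ ModuleCat.of A (CharacterModule Y) :=
      ModuleCat.ofHom (CharacterModule.curry c)
    have hφ : P.complex.d (i + 2) (i + 1) ≫ φ = 0 := by
      apply ModuleCat.hom_ext
      apply LinearMap.ext
      intro x
      apply CharacterModule.ext
      intro y
      exact hc x y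
    -- Since Ext vanishes, the cocycle is a coboundary. The character therefore factors through `d₀`
    -- and kills the cycle `z`.
    obtain ⟨ψ, hψ⟩ := (P.extMk_eq_zero_iff φ (i + 2) rfl hφ i rfl).1 (Subsingleton.elim _ _)
    have key : c = CharacterModule.dual (d₀.rTensor Y) (CharacterModule.uncurry ψ.hom) := by
      apply CharacterModule.ext
      intro t
      induction t with
      | zero => simp only [map_zero]
      | add a b ha hb => simp only [map_add, ha, hb]
      | tmul x y =>
        have := DFunLike.congr_fun (LinearMap.congr_fun (congrArg ModuleCat.Hom.hom hψ) x) y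
        exact this.symm
    apply hχ
    change c z = 0
    rw [key]
    change (CharacterModule.uncurry ψ.hom) ((d₀.rTensor Y) z) = 0
    rw [hz, map_zero]
  exact fun z hz => main z hz

/-- Let `J 0 ≤ J 1 ≤ …` be obtained by adjoining elements `w 0, w 1, …` that form a weakly regular
sequence on `A ⧸ J 0` and lie in `J 0 + Ann Y`.  If the length of the sequence bounds the flat
dimension of `Y`, then the higher `Tor` of `A ⧸ J 0` and `Y` vanishes. -/
lemma isZero_tor_of_regular_sequence (Y : Type u) [AddCommGroup Y] [Module A Y] (s : ℕ)
    (J : ℕ → Ideal A) (w : ℕ → A) (hJ : ∀ r < s, J (r + 1) = J r ⊔ Ideal.span {w r})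
    (hreg : ∀ r < s, ∀ a, w r * a ∈ J r → a ∈ J r)
    (hw : ∀ r < s, w r ∈ J 0 ⊔ Module.annihilator A Y)
    (hY : HasFlatDimensionLT A Y (s + 1)) (i : ℕ) :
    Limits.IsZero (((Tor' (ModuleCat.{u} A) (i + 1)).obj (ModuleCat.of A (A ⧸ J 0))).obj
      (ModuleCat.of A Y)) := by
  apply isZero_tor_of_subsingleton_ext
  have hmono : ∀ r ≤ s, J 0 ≤ J r := by
    intro r
    induction r with
    | zero => intro _; exact le_rfl
    | succ r ih => intro hr; rw [hJ r hr]; exact (ih (by omega)).trans le_sup_left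
  -- Downward induction on `r`: Ext from `A ⧸ J r` vanishes in all degrees above `r`. At `r = s`
  -- this is the bound on the flat dimension; at `r = 0` it is the claim.
  suffices H : ∀ k r, r + k = s → ∀ j, r + 1 ≤ j →
      Subsingleton (Ext (ModuleCat.of A (A ⧸ J r)) (ModuleCat.of A (CharacterModule Y)) j) from
    H s 0 (by omega) (i + 1) (by omega)
  intro k
  induction k with
  | zero =>
    intro r hr j hj
    have : HasInjectiveDimensionLT (ModuleCat.of A (CharacterModule Y)) (s + 1) := hY
    exact HasInjectiveDimensionLT.subsingleton _ (s + 1) j (by omega) _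
  | succ k ih =>
    intro r hr j hj
    have hrs : r < s := by omega
    let X := ModuleCat.of A (A ⧸ J r)
    let f : X ⟶ X := w r • 𝟙 X
    have hle : J r ≤ J (r + 1) := by rw [hJ r hrs]; exact le_sup_left
    let g : X ⟶ ModuleCat.of A (A ⧸ J (r + 1)) :=
      ModuleCat.ofHom (Submodule.factor hle)
    have hfg : f ≫ g = 0 := by
      apply ModuleCat.hom_ext
      apply LinearMap.ext
      intro x
      obtain ⟨a, rfl⟩ := Ideal.Quotient.mk_surjective x
      change Ideal.Quotient.mk (J (r + 1)) (w r * a) = 0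
      rw [Ideal.Quotient.eq_zero_iff_mem, hJ r hrs]
      exact Ideal.mul_mem_right _ _
        (Ideal.mem_sup_right (Ideal.mem_span_singleton_self (w r)))
    have hS : (ShortComplex.mk f g hfg).ShortExact := by
      refine ShortComplex.ShortExact.mk' ?_ ?_ ?_
      · rw [ShortComplex.moduleCat_exact_iff]
        intro x hx
        obtain ⟨a, rfl⟩ := Ideal.Quotient.mk_surjective x
        have ha : a ∈ J r ⊔ Ideal.span {w r} := by
          rw [← hJ r hrs]; exact Ideal.Quotient.eq_zero_iff_mem.1 hx
        obtain ⟨b, hb, c, hc, rfl⟩ := Submodule.mem_sup.1 ha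
        obtain ⟨d, rfl⟩ := Ideal.mem_span_singleton.1 hc
        refine ⟨Ideal.Quotient.mk _ d, ?_⟩
        change Ideal.Quotient.mk (J r) (w r * d) = Ideal.Quotient.mk (J r) (b + w r * d)
        rw [map_add, Ideal.Quotient.eq_zero_iff_mem.2 hb, zero_add]
      · rw [ModuleCat.mono_iff_injective, injective_iff_map_eq_zero]
        intro x hx
        obtain ⟨a, rfl⟩ := Ideal.Quotient.mk_surjective x
        exact Ideal.Quotient.eq_zero_iff_mem.2
          (hreg r hrs a (Ideal.Quotient.eq_zero_iff_mem.1 hx))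
      · rw [ModuleCat.epi_iff_surjective]
        exact Submodule.factor_surjective hle
    refine ⟨fun x y => ?_⟩
    suffices h0 : ∀ x : Ext X (ModuleCat.of A (CharacterModule Y)) j, x = 0 from
      (h0 x).trans (h0 y).symm
    intro x
    -- The next term of the long exact sequence, Ext from `A ⧸ J (r + 1)` in degree `j + 1`,
    -- vanishes. Hence `w r` acts surjectively in degree `j`.
    have := ih (r + 1) (by omega) (j + 1) (by omega)
    obtain ⟨x', hx'⟩ := Ext.contravariant_sequence_exact₁ hS _ x (add_comm 1 j)
      (Subsingleton.elim (α := Ext (ModuleCat.of A (A ⧸ J (r + 1)))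
        (ModuleCat.of A (CharacterModule Y)) (j + 1)) _ _)
    rw [← hx']
    change (Ext.mk₀ (w r • 𝟙 X)).comp x' _ = 0
    rw [Ext.mk₀_smul, Ext.smul_comp, Ext.mk₀_id_comp]
    -- It also acts as zero: one summand of `w r` kills the first argument of Ext and the other
    -- kills the second.
    obtain ⟨l, hl, a, ha, hla⟩ := Submodule.mem_sup.1 (hw r hrs)
    have h1 : l • 𝟙 X = 0 := by
      apply ModuleCat.hom_ext
      apply LinearMap.ext
      intro x
      obtain ⟨b, rfl⟩ := Ideal.Quotient.mk_surjective x
      exact Ideal.Quotient.eq_zero_iff_mem.2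
        (Ideal.mul_mem_right _ _ (hmono r hrs.le hl))
    have h2 : a • 𝟙 (ModuleCat.of A (CharacterModule Y)) = 0 := by
      apply ModuleCat.hom_ext
      apply LinearMap.ext
      intro x
      apply CharacterModule.ext
      intro y
      change x (a • y) = 0
      rw [Module.mem_annihilator.1 ha y, map_zero]
    rw [← hla, add_smul]
    have e1 : l • x' = (Ext.mk₀ (l • 𝟙 X)).comp x' (zero_add j) := by
      rw [Ext.mk₀_smul, Ext.smul_comp, Ext.mk₀_id_comp]
    rw [e1, h1, Ext.smul_eq_comp_mk₀ x' a, h2]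
    simp

end FlatDimension

/-! ### Cut binomials: pushing monomials through sets of vertices -/

namespace CutIdeal

open MvPolynomial

variable {K : Type u} [CommRing K] {σ V : Type} [Fintype σ] [DecidableEq σ] [DecidableEq V]
  (src tgt : σ → Option V)

/-- `f e` is a member of `γ`. -/
def Hits (f : σ → Option V) (γ : Finset V) (e : σ) : Prop := ∃ v ∈ γ, f e = some v

instance (f : σ → Option V) (γ : Finset V) (e : σ) : Decidable (Hits f γ e) :=
  inferInstanceAs (Decidable (∃ v ∈ γ, f e = some v))

lemma hits_union (f : σ → Option V) (γ δ : Finset V) (e : σ) :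
    Hits f (γ ∪ δ) e ↔ Hits f γ e ∨ Hits f δ e := by
  simp only [Hits, Finset.mem_union, or_and_right, exists_or]

lemma hits_sdiff (f : σ → Option V) (γ δ : Finset V) (e : σ) :
    Hits f (γ \ δ) e ↔ Hits f γ e ∧ ¬ Hits f δ e := by
  constructor
  · rintro ⟨v, hv, he⟩
    rw [Finset.mem_sdiff] at hv
    refine ⟨⟨v, hv.1, he⟩, ?_⟩
    rintro ⟨w, hw, hw'⟩
    rw [he] at hw'
    exact hv.2 (Option.some.inj hw' ▸ hw)
  · rintro ⟨⟨v, hv, he⟩, h⟩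
    exact ⟨v, Finset.mem_sdiff.2 ⟨hv, fun hv' => h ⟨v, hv', he⟩⟩, he⟩

lemma Hits.mono {f : σ → Option V} {γ δ : Finset V} {e : σ} (h : Hits f γ e) (hγ : γ ⊆ δ) :
    Hits f δ e := by
  obtain ⟨v, hv, he⟩ := h
  exact ⟨v, hγ hv, he⟩

/-- The exponent of the product of the variables of the edges in `D` that enter `γ`. -/
def into (D : Finset σ) (γ : Finset V) : σ →₀ ℕ :=
  Finsupp.equivFunOnFinite.symm fun e => if e ∈ D ∧ ¬ Hits src γ e ∧ Hits tgt γ e then 1 else 0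

/-- The exponent of the product of the variables of the edges in `D` that leave `γ`. -/
def outOf (D : Finset σ) (γ : Finset V) : σ →₀ ℕ :=
  Finsupp.equivFunOnFinite.symm fun e => if e ∈ D ∧ Hits src γ e ∧ ¬ Hits tgt γ e then 1 else 0

lemma into_apply (D : Finset σ) (γ : Finset V) (e : σ) : into src tgt D γ e =
    if e ∈ D ∧ ¬ Hits src γ e ∧ Hits tgt γ e then 1 else 0 := rfl

lemma outOf_apply (D : Finset σ) (γ : Finset V) (e : σ) : outOf src tgt D γ e =
    if e ∈ D ∧ Hits src γ e ∧ ¬ Hits tgt γ e then 1 else 0 := rfl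

lemma into_of_notMem {D : Finset σ} {e : σ} (he : e ∉ D) (γ : Finset V) :
    into src tgt D γ e = 0 := by
  rw [into_apply, if_neg fun h => he h.1]

lemma outOf_of_notMem {D : Finset σ} {e : σ} (he : e ∉ D) (γ : Finset V) :
    outOf src tgt D γ e = 0 := by
  rw [outOf_apply, if_neg fun h => he h.1]

lemma prod_X_eq_monomial (f : σ → Prop) [DecidablePred f] :
    (∏ e ∈ Finset.univ.filter f, X e : MvPolynomial σ K) =
      monomial (Finsupp.equivFunOnFinite.symm fun e => if f e then 1 else 0) 1 := by
  rw [monomial_eq, C_1, one_mul, Finsupp.prod_fintype _ _ (fun _ => pow_zero _),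
    Finset.prod_filter]
  refine Finset.prod_congr rfl fun e _ => ?_
  by_cases h : f e <;> simp [h]

/-- The binomial attached to a set `γ` of vertices with parameters `κ`. -/
def relation (κ : V → K) (D : Finset σ) (γ : Finset V) : MvPolynomial σ K :=
  monomial (into src tgt D γ) 1 - monomial (outOf src tgt D γ) (∏ v ∈ γ, κ v)

/-- The ideal generated by the binomials attached to all subsets of `W`. -/
def ideal (κ : V → K) (D : Finset σ) (W : Finset V) : Ideal (MvPolynomial σ K) :=
  Ideal.span (Set.range fun γ : {γ : Finset V // γ ⊆ W} => relation src tgt κ D γ.1)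

variable {src tgt}

lemma relation_mem_ideal {κ : V → K} {D : Finset σ} {W γ : Finset V} (h : γ ⊆ W) :
    relation src tgt κ D γ ∈ ideal src tgt κ D W :=
  Ideal.subset_span ⟨⟨γ, h⟩, rfl⟩

lemma ideal_le {κ : V → K} {D : Finset σ} {W : Finset V} {I : Ideal (MvPolynomial σ K)}
    (h : ∀ γ ⊆ W, relation src tgt κ D γ ∈ I) : ideal src tgt κ D W ≤ I := by
  rw [ideal, Ideal.span_le]
  rintro _ ⟨γ, rfl⟩
  exact h γ.1 γ.2

section Step

variable (κ : V → K) (D : Finset σ) (W : Finset V) (v : V) (e : σ)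

variable (src tgt) in
/-- The exponents divisible by the entering edges of some set containing the new vertex `v`. -/
def Divisible (p : σ →₀ ℕ) : Prop := ∃ γ ⊆ W, into src tgt D (insert v γ) ≤ p

variable (src tgt) in
/-- The exponent obtained by pushing through `γ`. -/
def push (γ : Finset V) (p : σ →₀ ℕ) : σ →₀ ℕ := p - into src tgt D γ + outOf src tgt D γ

open Classical in
variable (src tgt) in
/-- Multiplication by the edge into `v`, where defined, on monomials. -/
def edgeMulMonomial (p : σ →₀ ℕ) : MvPolynomial σ K ⧸ ideal src tgt κ D W :=
  if h : Divisible src tgt D W v p then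
    Ideal.Quotient.mk _ (monomial (push src tgt D (insert v h.choose) p)
      (∏ u ∈ insert v h.choose, κ u))
  else 0

variable {κ D W v e}

/-- Pushing through the larger set amounts to pushing through `insert v γ` and then through `δ \ γ`.
The latter is a subset of `W`, so the second push is a relation of the ideal; divisibility by both
entering monomials makes it possible. -/
lemma mk_push_union (hv : v ∉ W) {γ δ : Finset V} (hδ : δ ⊆ W) {p : σ →₀ ℕ}
    (hp : into src tgt D (insert v γ) ≤ p) (hp' : into src tgt D (insert v δ) ≤ p) :
    Ideal.Quotient.mk (ideal src tgt κ D W) (monomial (push src tgt D (insert v γ) p)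
      (∏ u ∈ insert v γ, κ u)) =
    Ideal.Quotient.mk (ideal src tgt κ D W) (monomial (push src tgt D (insert v (γ ∪ δ)) p)
      (∏ u ∈ insert v (γ ∪ δ), κ u)) := by
  rw [Ideal.Quotient.eq]
  have hmem := relation_mem_ideal (κ := κ) (D := D) (src := src) (tgt := tgt)
    (Finset.sdiff_subset.trans hδ : δ \ γ ⊆ W)
  have hset : insert v (γ ∪ δ) = insert v γ ∪ (δ \ γ) := by
    ext u; simp only [Finset.mem_insert, Finset.mem_union, Finset.mem_sdiff]; tauto
  have hset' : δ \ γ = insert v δ \ insert v γ := by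
    ext u
    simp only [Finset.mem_insert, Finset.mem_sdiff]
    have : u ∈ δ → u ≠ v := fun h h' => hv (h' ▸ hδ h)
    tauto
  have hdisj : Disjoint (insert v γ) (δ \ γ) := by
    rw [hset']; exact Finset.disjoint_sdiff
  have h := (ideal src tgt κ D W).mul_mem_left
    (monomial (push src tgt D (insert v γ) p - into src tgt D (δ \ γ)) (∏ u ∈ insert v γ, κ u)) hmem
  convert h using 1
  rw [relation, mul_sub, monomial_mul, monomial_mul, mul_one, hset, Finset.prod_union hdisj]
  have hle : ∀ e, into src tgt D (insert v γ) e ≤ p e := hp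
  have hle' : ∀ e, into src tgt D (insert v δ) e ≤ p e := hp'
  rw [hset']
  congr 2
  · congr 1
    ext e
    have h1 := hle e
    have h2 := hle' e
    simp only [push, Finsupp.add_apply, Finsupp.tsub_apply, into_apply, outOf_apply,
      hits_sdiff] at *
    -- Exponents are compared edge by edge. Only the membership of the two ends in the two sets, and
    -- of the edge in `D`, matters.
    by_cases a : Hits src (insert v γ) e <;> by_cases b : Hits tgt (insert v γ) e <;>
    by_cases c : Hits src (insert v δ) e <;> by_cases d : Hits tgt (insert v δ) e <;>
    by_cases f : e ∈ D <;> simp [a, b, c, d, f] at h1 h2 ⊢ <;> omega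
  · congr 1
    ext e
    have h1 := hle e
    have h2 := hle' e
    simp only [push, Finsupp.add_apply, Finsupp.tsub_apply, into_apply, outOf_apply,
      hits_sdiff, hits_union] at *
    by_cases a : Hits src (insert v γ) e <;> by_cases b : Hits tgt (insert v γ) e <;>
    by_cases c : Hits src (insert v δ) e <;> by_cases d : Hits tgt (insert v δ) e <;>
    by_cases f : e ∈ D <;> simp [a, b, c, d, f] at h1 h2 ⊢ <;> omega

/-- The set picked in the definition and any other admissible set can both be enlarged to their
union, so the choice is immaterial. -/
lemma edgeMulMonomial_eq (hv : v ∉ W) {γ : Finset V} (hγ : γ ⊆ W) {p : σ →₀ ℕ}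
    (hp : into src tgt D (insert v γ) ≤ p) :
    edgeMulMonomial src tgt κ D W v p =
      Ideal.Quotient.mk _ (monomial (push src tgt D (insert v γ) p) (∏ u ∈ insert v γ, κ u)) := by
  have h : Divisible src tgt D W v p := ⟨γ, hγ, hp⟩
  rw [edgeMulMonomial, dif_pos h,
    mk_push_union hv hγ h.choose_spec.2 hp,
    mk_push_union hv h.choose_spec.1 hp h.choose_spec.2, Finset.union_comm]

variable (src tgt κ D W v) in
/-- Multiplication by the edge into `v`, where defined, extended linearly. -/
def edgeMul : MvPolynomial σ K →ₗ[K] MvPolynomial σ K ⧸ ideal src tgt κ D W :=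
  (basisMonomials σ K).constr K (edgeMulMonomial src tgt κ D W v)

lemma edgeMul_monomial (p : σ →₀ ℕ) (a : K) : edgeMul src tgt κ D W v (monomial p a) =
    a • edgeMulMonomial src tgt κ D W v p := by
  have : (monomial p a : MvPolynomial σ K) = a • basisMonomials σ K p := by
    rw [coe_basisMonomials, smul_monomial, smul_eq_mul, mul_one]
  rw [this, map_smul, edgeMul, Module.Basis.constr_basis]

lemma edgeMulMonomial_of_not {p : σ →₀ ℕ} (h : ¬ Divisible src tgt D W v p) :
    edgeMulMonomial src tgt κ D W v p = 0 := by
  rw [edgeMulMonomial, dif_neg h]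

lemma smul_mk_monomial (I : Ideal (MvPolynomial σ K)) (a : K) (p : σ →₀ ℕ) (b : K) :
    a • Ideal.Quotient.mk I (monomial p b) = Ideal.Quotient.mk I (monomial p (a * b)) := by
  rw [← smul_eq_mul a b, ← smul_monomial]
  rfl

/-- The two terms of a multiple of a relation are related by a push through `γ`. Either both can be
pushed further through a set containing `v`, with the same result, or neither can. -/
lemma edgeMul_relation (hv : v ∉ W) {γ : Finset V} (hγ : γ ⊆ W) (y : MvPolynomial σ K) :
    edgeMul src tgt κ D W v (y * relation src tgt κ D γ) = 0 := by
  induction y using MvPolynomial.induction_on' with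
  | add p q hp hq => rw [add_mul, map_add, hp, hq, add_zero]
  | monomial q a =>
    rw [relation, mul_sub, monomial_mul, monomial_mul, map_sub, edgeMul_monomial,
      edgeMul_monomial, mul_one, sub_eq_zero]
    -- If such a `δ` exists, pushing the second monomial through `insert v δ` and the first one
    -- through `insert v (γ ∪ δ)` ends at the same monomial.
    by_cases h : ∃ δ ⊆ W, Disjoint γ δ ∧
      into src tgt D (insert v δ) ≤ q + outOf src tgt D γ
    · obtain ⟨δ, hδ, hdisj, hle⟩ := h
      have hv' : ∀ e, ¬ (Hits src γ e ∧ Hits src (insert v δ) e) ∧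
          ¬ (Hits tgt γ e ∧ Hits tgt (insert v δ) e) := by
        have hd : Disjoint γ (insert v δ) :=
          Finset.disjoint_insert_right.2 ⟨fun h => hv (hγ h), hdisj⟩
        intro e
        constructor <;>
        · rintro ⟨⟨a, ha, ha'⟩, b, hb, hb'⟩
          rw [ha'] at hb'
          exact Finset.disjoint_left.1 hd ha (Option.some.inj hb' ▸ hb)
      have hset : insert v (γ ∪ δ) = γ ∪ insert v δ := by
        ext u; simp only [Finset.mem_insert, Finset.mem_union]; tauto
      have hle' : ∀ e, into src tgt D (insert v δ) e ≤ (q + outOf src tgt D γ) e := hle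
      have hle2 : into src tgt D (insert v (γ ∪ δ)) ≤ q + into src tgt D γ := by
        intro e
        have h1 := hle' e
        have h2 := hv' e
        rw [hset]
        simp only [Finsupp.add_apply, into_apply, outOf_apply, hits_union] at *
        by_cases a : Hits src γ e <;> by_cases b : Hits tgt γ e <;>
        by_cases c : Hits src (insert v δ) e <;> by_cases d : Hits tgt (insert v δ) e <;>
        by_cases f : e ∈ D <;> simp [a, b, c, d, f] at h1 h2 ⊢ <;> omega
      rw [edgeMulMonomial_eq hv hδ hle, edgeMulMonomial_eq hv (Finset.union_subset hγ hδ) hle2,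
        smul_mk_monomial, smul_mk_monomial, hset, Finset.prod_union
          (Finset.disjoint_insert_right.2 ⟨fun h => hv (hγ h), hdisj⟩), ← mul_assoc]
      congr 3
      ext e
      have h1 := hle' e
      have h2 := hv' e
      have h3 : into src tgt D (insert v (γ ∪ δ)) e ≤ (q + into src tgt D γ) e := hle2 e
      rw [hset] at h3
      simp only [push, Finsupp.add_apply, Finsupp.tsub_apply, into_apply, outOf_apply,
        hits_union] at *
      by_cases a : Hits src γ e <;> by_cases b : Hits tgt γ e <;>
      by_cases c : Hits src (insert v δ) e <;> by_cases d : Hits tgt (insert v δ) e <;>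
      by_cases f : e ∈ D <;> simp [a, b, c, d, f] at h1 h2 h3 ⊢
    -- Otherwise both values are zero: a set `δ` admissible for either monomial could be replaced by
    -- `δ \ γ`, which would satisfy the excluded condition.
    · have hset : ∀ δ : Finset V, insert v (δ \ γ) = insert v δ \ γ := by
        intro δ
        have : v ∉ γ := fun h => hv (hγ h)
        ext u
        simp only [Finset.mem_insert, Finset.mem_sdiff]
        constructor
        · rintro (rfl | ⟨h1, h2⟩)
          · exact ⟨Or.inl rfl, this⟩
          · exact ⟨Or.inr h1, h2⟩
        · tauto
      have h1 : ¬ Divisible src tgt D W v (q + into src tgt D γ) := by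
        rintro ⟨δ, hδ, hle⟩
        refine h ⟨δ \ γ, Finset.sdiff_subset.trans hδ, Finset.disjoint_sdiff, ?_⟩
        intro e
        have h1 : into src tgt D (insert v δ) e ≤ (q + into src tgt D γ) e := hle e
        rw [hset]
        simp only [Finsupp.add_apply, into_apply, outOf_apply, hits_sdiff] at *
        by_cases a : Hits src γ e <;> by_cases b : Hits tgt γ e <;>
        by_cases c : Hits src (insert v δ) e <;> by_cases d : Hits tgt (insert v δ) e <;>
        by_cases f : e ∈ D <;> simp [a, b, c, d, f] at h1 ⊢ <;> omega
      have h2 : ¬ Divisible src tgt D W v (q + outOf src tgt D γ) := by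
        rintro ⟨δ, hδ, hle⟩
        refine h ⟨δ \ γ, Finset.sdiff_subset.trans hδ, Finset.disjoint_sdiff, ?_⟩
        intro e
        have h1 : into src tgt D (insert v δ) e ≤ (q + outOf src tgt D γ) e := hle e
        rw [hset]
        simp only [Finsupp.add_apply, into_apply, outOf_apply, hits_sdiff] at *
        by_cases a : Hits src γ e <;> by_cases b : Hits tgt γ e <;>
        by_cases c : Hits src (insert v δ) e <;> by_cases d : Hits tgt (insert v δ) e <;>
        by_cases f : e ∈ D <;> simp [a, b, c, d, f] at h1 ⊢ <;> omega
      rw [edgeMulMonomial_of_not h1, edgeMulMonomial_of_not h2, smul_zero, smul_zero]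

/-- This value is forced: once `e` is an edge into `v`, the product of `X e` with the entering
monomial equals the leaving monomial times its parameters, by the relation of `insert v γ`. -/
lemma edgeMul_mul_into (hv : v ∉ W) {γ : Finset V} (hγ : γ ⊆ W) (y : MvPolynomial σ K) :
    edgeMul src tgt κ D W v (y * monomial (into src tgt D (insert v γ)) 1) =
      Ideal.Quotient.mk _
        (y * monomial (outOf src tgt D (insert v γ)) (∏ u ∈ insert v γ, κ u)) := by
  induction y using MvPolynomial.induction_on' with
  | add p q hp hq => rw [add_mul, map_add, hp, hq, add_mul, map_add]
  | monomial q a =>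
    rw [monomial_mul, monomial_mul, edgeMul_monomial, mul_one,
      edgeMulMonomial_eq hv hγ le_add_self, smul_mk_monomial, push, add_tsub_cancel_right]

end Step

end CutIdeal

/-! ### Flat dimension of the quotient by the cut binomials -/

namespace CutIdeal

open MvPolynomial

variable {K : Type u} [CommRing K] {σ V : Type} [Fintype σ] [DecidableEq σ] [DecidableEq V]
  {src tgt : σ → Option V}

section Step

variable {κ : V → K} {D : Finset σ} {W : Finset V} {v : V} {e : σ}

lemma prod_update_of_subset (hv : v ∉ W) {γ : Finset V} (hγ : γ ⊆ W) :
    ∏ u ∈ γ, Function.update κ v 0 u = ∏ u ∈ γ, κ u :=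
  Finset.prod_congr rfl fun _ hu =>
    Function.update_of_ne (ne_of_mem_of_not_mem (hγ hu) hv) _ _

lemma relation_update (hv : v ∉ W) {γ : Finset V} (hγ : γ ⊆ W) :
    relation src tgt (Function.update κ v 0) D γ = relation src tgt κ D γ := by
  rw [relation, relation, prod_update_of_subset hv hγ]

/-- With `κ v = 0` the binomials of sets containing `v` become their entering monomials. The ideal
thus consists of the old one together with the multiples of the monomials that `edgeMul` pushes. -/
lemma relation_update_insert {γ : Finset V} :
    relation src tgt (Function.update κ v 0) D (insert v γ) =
      monomial (into src tgt D (insert v γ)) 1 := by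
  rw [relation, Finset.prod_eq_zero (Finset.mem_insert_self v γ) (Function.update_self _ _ _),
    monomial_zero, sub_zero]

/-- Neither end of `e` lies in `W`, so `e` crosses no cut of a subset of `W`. Its variable affects
only the binomials of sets containing `v`, where it multiplies the entering monomial. -/
lemma relation_insert_edge (hv : v ∉ W) (htgt : tgt e = some v) (hsrc : ¬ Hits src (insert v W) e)
    {γ : Finset V} (hγ : γ ⊆ W) :
    relation src tgt κ (insert e D) γ = relation src tgt κ D γ := by
  have h1 : ¬ Hits src γ e := fun h => hsrc (h.mono (hγ.trans (Finset.subset_insert _ _)))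
  have h2 : ¬ Hits tgt γ e := by
    rintro ⟨w, hw, hw'⟩
    rw [htgt] at hw'
    exact hv (Option.some.inj hw' ▸ hγ hw)
  have e1 : into src tgt (insert e D) γ = into src tgt D γ := by
    ext f
    by_cases hf : f = e
    · subst hf; simp [into_apply, h1, h2]
    · simp [into_apply, hf]
  have e2 : outOf src tgt (insert e D) γ = outOf src tgt D γ := by
    ext f
    by_cases hf : f = e
    · subst hf; simp [outOf_apply, h1, h2]
    · simp [outOf_apply, hf]
  rw [relation, relation, e1, e2]

lemma relation_insert_edge_insert (he : e ∉ D) (htgt : tgt e = some v)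
    (hsrc : ¬ Hits src (insert v W) e) {γ : Finset V} (hγ : γ ⊆ W) :
    relation src tgt κ (insert e D) (insert v γ) =
      X e * monomial (into src tgt D (insert v γ)) 1 -
        monomial (outOf src tgt D (insert v γ)) (∏ u ∈ insert v γ, κ u) := by
  have h1 : ¬ Hits src (insert v γ) e := fun h => hsrc (h.mono (Finset.insert_subset_insert _ hγ))
  have h2 : Hits tgt (insert v γ) e := ⟨v, Finset.mem_insert_self _ _, htgt⟩
  have e1 : into src tgt (insert e D) (insert v γ) =
      Finsupp.single e 1 + into src tgt D (insert v γ) := by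
    ext f
    by_cases hf : f = e
    · subst hf; simp [into_apply, h1, h2, he]
    · simp [into_apply, hf]
  have e2 : outOf src tgt (insert e D) (insert v γ) = outOf src tgt D (insert v γ) := by
    ext f
    by_cases hf : f = e
    · subst hf; simp [outOf_apply, h1]
    · simp [outOf_apply, hf]
  rw [relation, e1, e2, X, monomial_mul, one_mul]

lemma subset_insert_cases {γ : Finset V} (h : γ ⊆ insert v W) :
    γ ⊆ W ∨ ∃ δ ⊆ W, γ = insert v δ := by
  by_cases hv : v ∈ γ
  · refine Or.inr ⟨γ.erase v, ?_, (Finset.insert_erase hv).symm⟩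
    intro u hu
    rw [Finset.mem_erase] at hu
    exact (Finset.mem_insert.1 (h hu.2)).resolve_left hu.1
  · exact Or.inl fun u hu => (Finset.mem_insert.1 (h hu)).resolve_left fun h' => hv (h' ▸ hu)

lemma edgeMul_mem (hv : v ∉ W) {x : MvPolynomial σ K} (hx : x ∈ ideal src tgt κ D W) :
    edgeMul src tgt κ D W v x = 0 := by
  suffices H : ∀ y, edgeMul src tgt κ D W v (y * x) = 0 by simpa using H 1
  refine Submodule.span_induction ?_ ?_ ?_ ?_ hx
  · rintro _ ⟨γ, rfl⟩ y
    exact edgeMul_relation hv γ.2 y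
  · intro y; rw [mul_zero, map_zero]
  · intro a b _ _ ha hb y; rw [mul_add, map_add, ha, hb, add_zero]
  · intro a b _ hb y; rw [smul_eq_mul, ← mul_assoc]; exact hb _

/-- Multiples of a generator are either killed or pushed by one fixed rule, so on this ideal the map
is linear over the polynomial ring. The extension by zero to all polynomials is only `K`-linear. -/
lemma edgeMul_mul (hv : v ∉ W) {x : MvPolynomial σ K}
    (hx : x ∈ ideal src tgt (Function.update κ v 0) D (insert v W)) (y : MvPolynomial σ K) :
    edgeMul src tgt κ D W v (y * x) = y • edgeMul src tgt κ D W v x := by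
  revert y
  refine Submodule.span_induction ?_ ?_ ?_ ?_ hx
  · rintro _ ⟨⟨γ, hγ⟩, rfl⟩ y
    obtain hγ | ⟨δ, hδ, rfl⟩ := subset_insert_cases hγ
    · change edgeMul src tgt κ D W v (y * relation src tgt (Function.update κ v 0) D γ) =
        y • edgeMul src tgt κ D W v (relation src tgt (Function.update κ v 0) D γ)
      rw [relation_update hv hγ, edgeMul_relation hv hγ, edgeMul_mem hv (relation_mem_ideal hγ),
        smul_zero]
    · change edgeMul src tgt κ D W v (y * relation src tgt (Function.update κ v 0) D _) =
        y • edgeMul src tgt κ D W v (relation src tgt (Function.update κ v 0) D _)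
      rw [relation_update_insert, edgeMul_mul_into hv hδ]
      have := edgeMul_mul_into (κ := κ) (src := src) (tgt := tgt) (D := D) hv hδ 1
      rw [one_mul, one_mul] at this
      rw [this, ← smul_eq_mul]
      rfl
  · intro y; rw [mul_zero, map_zero, smul_zero]
  · intro a b _ _ ha hb y; rw [mul_add, map_add, ha, hb, map_add, smul_add]
  · intro a b _ hb y
    rw [smul_eq_mul, ← mul_assoc, hb, hb, mul_smul]

variable (src tgt κ D W v) in
/-- The inclusion of the class of ideals on which multiplication by the edge is defined. -/
def edgeIdeal : Submodule (MvPolynomial σ K) (MvPolynomial σ K ⧸ ideal src tgt κ D W) :=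
  Submodule.map (ideal src tgt κ D W).mkQ
    (ideal src tgt (Function.update κ v 0) D (insert v W))

/-- The linear map induced by `edgeMul` on the quotient. -/
def edgeMulQuot (hv : v ∉ W) : (MvPolynomial σ K ⧸ ideal src tgt κ D W) →ₗ[K]
    (MvPolynomial σ K ⧸ ideal src tgt κ D W) :=
  ((ideal src tgt κ D W).restrictScalars K).liftQ (edgeMul src tgt κ D W v)
    fun _ hx => edgeMul_mem hv hx

/-- Division by the variable `e`, discarding the monomials that do not contain it. -/
def divEdge (e : σ) : MvPolynomial σ K →ₗ[K] MvPolynomial σ K where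
  toFun x := x.divMonomial (Finsupp.single e 1)
  map_add' x y := add_divMonomial x y _
  map_smul' a x := by
    ext p
    simp [coeff_divMonomial]

lemma divEdge_monomial_of_eq_zero {p : σ →₀ ℕ} (hp : p e = 0) (a : K) :
    divEdge e (monomial p a) = 0 := by
  classical
  ext q
  change coeff q ((monomial p a).divMonomial (Finsupp.single e 1)) = _
  rw [coeff_divMonomial, coeff_monomial, if_neg, coeff_zero]
  intro h
  rw [h] at hp
  simp at hp

lemma divEdge_monomial (p : σ →₀ ℕ) (a : K) :
    divEdge e (monomial (p + Finsupp.single e 1) a) = monomial p a := by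
  classical
  ext q
  change coeff q ((monomial _ a).divMonomial (Finsupp.single e 1)) = _
  rw [coeff_divMonomial, coeff_monomial, coeff_monomial, add_comm p]
  simp

lemma exponent_cases (e : σ) (p : σ →₀ ℕ) : p e = 0 ∨ ∃ q, p = q + Finsupp.single e 1 := by
  by_cases h : p e = 0
  · exact Or.inl h
  · refine Or.inr ⟨p - Finsupp.single e 1, (tsub_add_cancel_of_le ?_).symm⟩
    rw [Finsupp.single_le_iff]
    exact Nat.one_le_iff_ne_zero.2 h

lemma divEdge_mul_monomial {q : σ →₀ ℕ} (hq : q e = 0) (a : K) (y : MvPolynomial σ K) :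
    divEdge e (y * monomial q a) = divEdge e y * monomial q a := by
  induction y using MvPolynomial.induction_on' with
  | add p q hp hq => rw [add_mul, map_add, hp, hq, map_add, add_mul]
  | monomial p b =>
    rw [monomial_mul]
    obtain hp | ⟨p, rfl⟩ := exponent_cases e p
    · rw [divEdge_monomial_of_eq_zero hp, divEdge_monomial_of_eq_zero (by simp [hp, hq]), zero_mul]
    · rw [add_right_comm, divEdge_monomial, divEdge_monomial, monomial_mul]

/-- No relation involves `X e`, because `e ∉ D`; division by `X e` therefore acts only on the
cofactors. -/
lemma divEdge_mem (he : e ∉ D) {x : MvPolynomial σ K} (hx : x ∈ ideal src tgt κ D W) :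
    divEdge e x ∈ ideal src tgt κ D W := by
  suffices H : ∀ y, divEdge e (y * x) ∈ ideal src tgt κ D W by simpa using H 1
  refine Submodule.span_induction ?_ ?_ ?_ ?_ hx
  · rintro _ ⟨γ, rfl⟩ y
    have := (ideal src tgt κ D W).mul_mem_left (divEdge e y)
      (relation_mem_ideal (src := src) (tgt := tgt) (κ := κ) (D := D) γ.2)
    convert this using 1
    change divEdge e (y * relation src tgt κ D γ.1) = _
    rw [relation, mul_sub, mul_sub, map_sub, divEdge_mul_monomial (into_of_notMem _ _ he _),
      divEdge_mul_monomial (outOf_of_notMem _ _ he _)]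
  · intro y; rw [mul_zero, map_zero]; exact zero_mem _
  · intro a b _ _ ha hb y; rw [mul_add, map_add]; exact add_mem (ha y) (hb y)
  · intro a b _ hb y; rw [smul_eq_mul, ← mul_assoc]; exact hb _

/-- The linear map induced by `divEdge` on the quotient. -/
def divEdgeQuot (he : e ∉ D) : (MvPolynomial σ K ⧸ ideal src tgt κ D W) →ₗ[K]
    (MvPolynomial σ K ⧸ ideal src tgt κ D W) :=
  ((ideal src tgt κ D W).restrictScalars K).mapQ ((ideal src tgt κ D W).restrictScalars K)
    (divEdge e) fun _ hx => divEdge_mem he hx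

lemma divEdgeQuot_mk (he : e ∉ D) (x : MvPolynomial σ K) :
    divEdgeQuot (src := src) (tgt := tgt) (κ := κ) (W := W) he (Ideal.Quotient.mk _ x) =
      Ideal.Quotient.mk _ (divEdge e x) := rfl

/-- Pushing neither reads nor changes the exponent of an edge outside `D`. -/
lemma divEdgeQuot_edgeMul (hv : v ∉ W) (he : e ∉ D) (x : MvPolynomial σ K) :
    divEdgeQuot he (edgeMul src tgt κ D W v x) = edgeMul src tgt κ D W v (divEdge e x) := by
  induction x using MvPolynomial.induction_on' with
  | add p q hp hq => simp only [map_add, hp, hq]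
  | monomial p a =>
    rw [edgeMul_monomial, map_smul]
    have h0 : ∀ γ, into src tgt D γ e = 0 := into_of_notMem _ _ he
    have h0' : ∀ γ, outOf src tgt D γ e = 0 := outOf_of_notMem _ _ he
    obtain hp | ⟨p, rfl⟩ := exponent_cases e p
    · rw [divEdge_monomial_of_eq_zero hp, map_zero]
      by_cases h : Divisible src tgt D W v p
      · obtain ⟨γ, hγ, hle⟩ := h
        rw [edgeMulMonomial_eq hv hγ hle, divEdgeQuot_mk, divEdge_monomial_of_eq_zero, map_zero,
          smul_zero]
        simp [push, hp, h0, h0']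
      · rw [edgeMulMonomial_of_not h, map_zero, smul_zero]
    · rw [divEdge_monomial, edgeMul_monomial]
      congr 1
      by_cases h : Divisible src tgt D W v p
      · obtain ⟨γ, hγ, hle⟩ := h
        rw [edgeMulMonomial_eq hv hγ hle, edgeMulMonomial_eq hv hγ (hle.trans le_self_add),
          divEdgeQuot_mk, push, tsub_add_eq_add_tsub hle |>.symm, add_right_comm,
          divEdge_monomial, push]
      · have h' : ¬ Divisible src tgt D W v (p + Finsupp.single e 1) := by
          rintro ⟨γ, hγ, hle⟩
          refine h ⟨γ, hγ, fun f => ?_⟩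
          have := hle f
          by_cases hf : f = e
          · subst hf; rw [h0]; exact Nat.zero_le _
          · simpa [Finsupp.single_apply, Ne.symm hf] using this
        rw [edgeMulMonomial_of_not h, edgeMulMonomial_of_not h', map_zero]

lemma divEdge_iterate_eq_zero (e : σ) (x : MvPolynomial σ K) :
    ∃ k, (divEdge e ^ k : Module.End K (MvPolynomial σ K)) x = 0 := by
  have hz : ∀ {k l : ℕ} {x : MvPolynomial σ K}, k ≤ l →
      (divEdge e ^ k : Module.End K (MvPolynomial σ K)) x = 0 →
      (divEdge e ^ l : Module.End K (MvPolynomial σ K)) x = 0 := by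
    intro k l x hkl h
    obtain ⟨m, rfl⟩ := Nat.exists_eq_add_of_le hkl
    rw [add_comm, pow_add, Module.End.mul_apply, h, map_zero]
  induction x using MvPolynomial.induction_on' with
  | add p q hp hq =>
    obtain ⟨k, hk⟩ := hp
    obtain ⟨l, hl⟩ := hq
    exact ⟨max k l, by rw [map_add, hz (le_max_left _ _) hk, hz (le_max_right _ _) hl, add_zero]⟩
  | monomial p a =>
    induction h : p e generalizing p with
    | zero => exact ⟨1, by rw [pow_one, divEdge_monomial_of_eq_zero h]⟩
    | succ m ih =>
      obtain hp | ⟨q, rfl⟩ := exponent_cases e p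
      · omega
      · obtain ⟨k, hk⟩ := ih q (by simpa using h)
        exact ⟨k + 1, by rw [pow_succ, Module.End.mul_apply, divEdge_monomial, hk]⟩

/-- Let `φ` be the push and `τ` the division by `X e`. Applying `τ` to the hypothesis gives `x = φ τ
x`. The two maps commute, so `x = φ^k τ^k x` for all `k`, and `τ^k x = 0` for large `k`. The
extension of `φ` by zero is needed here, because `τ x` may leave the ideal on which `φ` is linear.
-/
lemma eq_zero_of_smul_eq_edgeMul (hv : v ∉ W) (he : e ∉ D) (x : MvPolynomial σ K)
    (h : Ideal.Quotient.mk (ideal src tgt κ D W) (X e * x) = edgeMul src tgt κ D W v x) :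
    Ideal.Quotient.mk (ideal src tgt κ D W) x = 0 := by
  have key : Ideal.Quotient.mk (ideal src tgt κ D W) x =
      edgeMul src tgt κ D W v (divEdge e x) := by
    rw [← divEdgeQuot_edgeMul hv he, ← h, divEdgeQuot_mk]
    congr 1
    exact (X_mul_divMonomial e x).symm
  let φ : Module.End K (MvPolynomial σ K ⧸ ideal src tgt κ D W) := edgeMulQuot hv
  let τ : Module.End K (MvPolynomial σ K ⧸ ideal src tgt κ D W) := divEdgeQuot he
  have hcomm : Commute φ τ := by
    apply LinearMap.ext
    intro y
    obtain ⟨y, rfl⟩ := Ideal.Quotient.mk_surjective y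
    exact (divEdgeQuot_edgeMul hv he y).symm
  have hfix : (φ * τ) (Ideal.Quotient.mk _ x) = Ideal.Quotient.mk _ x := key.symm
  obtain ⟨k, hk⟩ := divEdge_iterate_eq_zero e x
  have hτ : ∀ (k : ℕ) (y : MvPolynomial σ K), (τ ^ k) (Ideal.Quotient.mk _ y) =
      Ideal.Quotient.mk _ ((divEdge e ^ k : Module.End K (MvPolynomial σ K)) y) := by
    intro k
    induction k with
    | zero => intro y; rfl
    | succ k ih =>
      intro y
      rw [pow_succ, pow_succ, Module.End.mul_apply, Module.End.mul_apply]
      exact ih _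
  have hfix' : ∀ k : ℕ, ((φ * τ) ^ k) (Ideal.Quotient.mk _ x) = Ideal.Quotient.mk _ x := by
    intro k
    induction k with
    | zero => rfl
    | succ k ih => rw [pow_succ, Module.End.mul_apply, hfix, ih]
  rw [← hfix' k, hcomm.mul_pow, Module.End.mul_apply, hτ, hk, map_zero, map_zero]

lemma ideal_le_ideal_update (hv : v ∉ W) : ideal src tgt κ D W ≤
    ideal src tgt (Function.update κ v 0) D (insert v W) :=
  ideal_le fun γ hγ => by
    rw [← relation_update hv hγ]
    exact relation_mem_ideal (hγ.trans (Finset.subset_insert _ _))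

lemma ideal_le_ideal_insert (hv : v ∉ W) (htgt : tgt e = some v)
    (hsrc : ¬ Hits src (insert v W) e) : ideal src tgt κ D W ≤
    ideal src tgt κ (insert e D) (insert v W) :=
  ideal_le fun γ hγ => by
    rw [← relation_insert_edge hv htgt hsrc hγ]
    exact relation_mem_ideal (hγ.trans (Finset.subset_insert _ _))

/-- Multiplication by the difference of the variable `e` and `edgeMul`. -/
def edgeSub (hv : v ∉ W) (e : σ) : edgeIdeal src tgt κ D W v →ₗ[MvPolynomial σ K]
    MvPolynomial σ K ⧸ ideal src tgt κ D W where
  toFun x := (X e : MvPolynomial σ K) • x.1 - edgeMulQuot hv x.1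
  map_add' x y := by
    simp only [Submodule.coe_add, smul_add, map_add]; abel
  map_smul' y x := by
    obtain ⟨_, x, hx, rfl⟩ := x
    have : edgeMulQuot (src := src) (tgt := tgt) (κ := κ) (D := D) hv
        (Ideal.Quotient.mk _ (y * x)) = y • edgeMul src tgt κ D W v x := edgeMul_mul hv hx y
    change (X e : MvPolynomial σ K) • (y • Ideal.Quotient.mk _ x) -
      edgeMulQuot hv (Ideal.Quotient.mk _ (y * x)) =
      y • ((X e : MvPolynomial σ K) • Ideal.Quotient.mk _ x - edgeMul src tgt κ D W v x)
    rw [this, smul_sub, smul_comm]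

lemma edgeSub_mk (hv : v ∉ W) (e : σ) {x : MvPolynomial σ K}
    (hx : x ∈ ideal src tgt (Function.update κ v 0) D (insert v W)) :
    edgeSub (src := src) (tgt := tgt) (κ := κ) (D := D) hv e
      ⟨Ideal.Quotient.mk _ x, x, hx, rfl⟩ =
      Ideal.Quotient.mk _ (X e * x) - edgeMul src tgt κ D W v x := rfl

lemma edgeSub_injective (hv : v ∉ W) (he : e ∉ D) :
    Function.Injective (edgeSub (src := src) (tgt := tgt) (κ := κ) (D := D) hv e) := by
  rw [injective_iff_map_eq_zero]
  rintro ⟨_, x, hx, rfl⟩ h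
  apply Subtype.ext
  exact eq_zero_of_smul_eq_edgeMul hv he x (sub_eq_zero.1 h)

/-- On generators of the source the map is explicit: binomials of subsets of `W` already vanish, and
the entering monomial of `insert v γ` goes to the binomial of `insert v γ` in the graph with `e`.
These images generate the kernel of the projection. -/
lemma edgeSub_exact (hv : v ∉ W) (he : e ∉ D) (htgt : tgt e = some v)
    (hsrc : ¬ Hits src (insert v W) e) :
    Function.Exact (edgeSub (src := src) (tgt := tgt) (κ := κ) (D := D) hv e)
      (Submodule.factor (ideal_le_ideal_insert (κ := κ) (D := D) hv htgt hsrc)) := by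
  let g := Submodule.factor (ideal_le_ideal_insert (κ := κ) (D := D) hv htgt hsrc)
  have hg : ∀ x, g (Ideal.Quotient.mk _ x) = Ideal.Quotient.mk _ x := fun _ => rfl
  have hmem : ∀ γ ⊆ W, monomial (into src tgt D (insert v γ)) (1 : K) ∈
      ideal src tgt (Function.update κ v 0) D (insert v W) := fun γ hγ => by
    rw [← relation_update_insert (κ := κ)]
    exact relation_mem_ideal (Finset.insert_subset_insert _ hγ)
  have hval : ∀ γ (hγ : γ ⊆ W), edgeSub hv e ⟨Ideal.Quotient.mk _ _, _, hmem γ hγ, rfl⟩ =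
      Ideal.Quotient.mk (ideal src tgt κ D W) (relation src tgt κ (insert e D) (insert v γ)) := by
    intro γ hγ
    have h1 := edgeMul_mul_into (κ := κ) (src := src) (tgt := tgt) (D := D) hv hγ 1
    rw [one_mul, one_mul] at h1
    rw [edgeSub_mk hv e (hmem γ hγ), h1, relation_insert_edge_insert he htgt hsrc hγ, map_sub]
  rw [LinearMap.exact_iff]
  apply le_antisymm
  · intro z hz
    obtain ⟨x, rfl⟩ := Ideal.Quotient.mk_surjective z
    have hx : x ∈ ideal src tgt κ (insert e D) (insert v W) :=
      Ideal.Quotient.eq_zero_iff_mem.1 hz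
    refine Submodule.span_induction
      (p := fun x _ => Ideal.Quotient.mk _ x ∈ LinearMap.range (edgeSub hv e)) ?_ ?_ ?_ ?_ hx
    · rintro _ ⟨⟨γ, hγ⟩, rfl⟩
      obtain hγ | ⟨δ, hδ, rfl⟩ := subset_insert_cases hγ
      · change Ideal.Quotient.mk _ (relation src tgt κ (insert e D) γ) ∈ _
        rw [relation_insert_edge hv htgt hsrc hγ,
          Ideal.Quotient.eq_zero_iff_mem.2 (relation_mem_ideal hγ)]
        exact zero_mem _
      · exact ⟨_, hval δ hδ⟩
    · rw [map_zero]; exact zero_mem _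
    · intro a b _ _ ha hb; rw [map_add]; exact add_mem ha hb
    · intro a b _ hb; exact Submodule.smul_mem _ a hb
  · rintro _ ⟨⟨_, x, hx, rfl⟩, rfl⟩
    change g _ = 0
    refine Submodule.span_induction
      (p := fun x hx => g (edgeSub hv e ⟨Ideal.Quotient.mk _ x, x, hx, rfl⟩) = 0) ?_ ?_ ?_ ?_ hx
    · rintro _ ⟨⟨γ, hγ⟩, rfl⟩
      obtain hγ' | ⟨δ, hδ, rfl⟩ := subset_insert_cases hγ
      · have : (⟨Ideal.Quotient.mk _ _, _, relation_mem_ideal hγ, rfl⟩ :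
            edgeIdeal src tgt κ D W v) = 0 := by
          apply Subtype.ext
          change Ideal.Quotient.mk _ (relation src tgt (Function.update κ v 0) D γ) = 0
          rw [relation_update hv hγ', Ideal.Quotient.eq_zero_iff_mem]
          exact relation_mem_ideal hγ'
        exact (congrArg (fun t => g (edgeSub hv e t)) this).trans (by simp)
      · have : (⟨Ideal.Quotient.mk _ _, _, relation_mem_ideal hγ, rfl⟩ :
            edgeIdeal src tgt κ D W v) = ⟨Ideal.Quotient.mk _ _, _, hmem δ hδ, rfl⟩ :=
          Subtype.ext (congrArg (Ideal.Quotient.mk (ideal src tgt κ D W)) relation_update_insert)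
        refine (congrArg (fun t => g (edgeSub hv e t)) this).trans ?_
        rw [hval δ hδ, hg, Ideal.Quotient.eq_zero_iff_mem]
        exact relation_mem_ideal (Finset.insert_subset_insert _ hδ)
    · have : (⟨Ideal.Quotient.mk _ 0, 0, zero_mem _, rfl⟩ : edgeIdeal src tgt κ D W v) = 0 :=
        Subtype.ext (map_zero _)
      exact (congrArg (fun t => g (edgeSub hv e t)) this).trans (by simp)
    · intro a b ha hb iha ihb
      have : (⟨Ideal.Quotient.mk _ (a + b), a + b, add_mem ha hb, rfl⟩ :
          edgeIdeal src tgt κ D W v) =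
          ⟨Ideal.Quotient.mk _ a, a, ha, rfl⟩ + ⟨Ideal.Quotient.mk _ b, b, hb, rfl⟩ :=
        Subtype.ext (map_add _ _ _)
      refine (congrArg (fun t => g (edgeSub hv e t)) this).trans ?_
      rw [map_add, map_add, iha, ihb, add_zero]
    · intro a b hb ihb
      have : (⟨Ideal.Quotient.mk _ (a • b), a • b, Submodule.smul_mem _ a hb, rfl⟩ :
          edgeIdeal src tgt κ D W v) = a • ⟨Ideal.Quotient.mk _ b, b, hb, rfl⟩ :=
        Subtype.ext rfl
      refine (congrArg (fun t => g (edgeSub hv e t)) this).trans ?_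
      rw [map_smul, map_smul, ihb, smul_zero]

/-- The module `edgeIdeal` is the left term of two short exact sequences with the same middle term.
The sequence given by inclusion bounds its flat dimension; the one given by `edgeSub` transfers the
bound to the new quotient. -/
lemma hasFlatDimensionLT_step (hv : v ∉ W) (he : e ∉ D) (htgt : tgt e = some v)
    (hsrc : ¬ Hits src (insert v W) e) (n : ℕ)
    (h₁ : HasFlatDimensionLT (MvPolynomial σ K) (MvPolynomial σ K ⧸ ideal src tgt κ D W) n)
    (h₂ : HasFlatDimensionLT (MvPolynomial σ K)
      (MvPolynomial σ K ⧸ ideal src tgt (Function.update κ v 0) D (insert v W)) (n + 1)) :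
    HasFlatDimensionLT (MvPolynomial σ K)
      (MvPolynomial σ K ⧸ ideal src tgt κ (insert e D) (insert v W)) (n + 1) := by
  have h₀ : HasFlatDimensionLT (MvPolynomial σ K) (edgeIdeal src tgt κ D W v) n := by
    refine HasFlatDimensionLT.of_exact_left (edgeIdeal src tgt κ D W v).subtype
      (Submodule.factor (ideal_le_ideal_update hv)) (Submodule.injective_subtype _)
      (Submodule.factor_surjective _) ?_ h₁ h₂
    rw [LinearMap.exact_iff, Submodule.range_subtype]
    ext z
    obtain ⟨x, rfl⟩ := Ideal.Quotient.mk_surjective z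
    constructor
    · intro h
      exact ⟨x, Ideal.Quotient.eq_zero_iff_mem.1 h, rfl⟩
    · rintro ⟨y, hy, hyx⟩
      change Submodule.factor (ideal_le_ideal_update hv) _ = 0
      rw [← hyx]
      exact Ideal.Quotient.eq_zero_iff_mem.2 hy
  exact HasFlatDimensionLT.of_exact_right (edgeSub hv e)
    (Submodule.factor (ideal_le_ideal_insert hv htgt hsrc)) (edgeSub_injective hv he)
    (Submodule.factor_surjective _) (edgeSub_exact hv he htgt hsrc) h₀
    (h₁.mono (Nat.le_succ n))

end Step

/-- The ideal of a graph all of whose vertices are reachable from the root has flat dimension at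
most the number of vertices. -/
theorem hasFlatDimensionLT_quotient (D : Finset σ) (W : Finset V) (κ : V → K)
    (h : ∀ γ ⊆ W, γ.Nonempty → into src tgt D γ = 0 → ∏ v ∈ γ, κ v = 0) :
    HasFlatDimensionLT (MvPolynomial σ K) (MvPolynomial σ K ⧸ ideal src tgt κ D W)
      (W.card + 1) := by
  -- Edges outside `D` count as `1` in all monomials, so deleting an edge only shrinks `D`. Of the
  -- two smaller cases, one loses an edge and a vertex, while the other loses the edge and keeps the
  -- vertex with parameter zero.
  induction hN : D.card + W.card using Nat.strong_induction_on generalizing D W κ with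
  | _ N ih =>
    by_cases hW : W = ∅
    · subst hW
      have h0 : ideal src tgt κ D ∅ = ⊥ := by
        rw [eq_bot_iff]
        refine ideal_le fun γ hγ => ?_
        rw [Finset.subset_empty.1 hγ, Ideal.mem_bot, relation, sub_eq_zero, Finset.prod_empty]
        congr 2
        ext e
        simp [into_apply, outOf_apply, Hits]
      rw [h0]
      refine HasFlatDimensionLT.of_equiv
        (Submodule.quotEquivOfEqBot (⊥ : Ideal (MvPolynomial σ K)) rfl).symm ?_
      exact HasFlatDimensionLT.of_flat
    -- If nothing enters `W`, the parameters of `W` multiply to zero by hypothesis, and the binomial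
    -- of `W` itself is `1`.
    by_cases hin : into src tgt D W = 0
    · have h0 : Subsingleton (MvPolynomial σ K ⧸ ideal src tgt κ D W) := by
        rw [Ideal.Quotient.subsingleton_iff, Ideal.eq_top_iff_one]
        have := relation_mem_ideal (src := src) (tgt := tgt) (κ := κ) (D := D) (Finset.Subset.refl W)
        rw [relation, h W (Finset.Subset.refl W) (Finset.nonempty_iff_ne_empty.2 hW) hin, hin,
          monomial_zero, sub_zero] at this
        exact this
      exact HasFlatDimensionLT.of_subsingleton.mono (Nat.zero_le _)
    obtain ⟨e, he⟩ := DFunLike.ne_iff.1 hin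
    rw [into_apply] at he
    obtain ⟨heD, hsrc, v, hvW, htgt⟩ : e ∈ D ∧ ¬ Hits src W e ∧ Hits tgt W e := by
      by_contra hc
      rw [if_neg hc] at he
      exact he rfl
    obtain ⟨D, he', rfl⟩ : ∃ D', e ∉ D' ∧ D = insert e D' :=
      ⟨D.erase e, Finset.notMem_erase _ _, (Finset.insert_erase heD).symm⟩
    obtain ⟨W, hv', rfl⟩ : ∃ W', v ∉ W' ∧ W = insert v W' :=
      ⟨W.erase v, Finset.notMem_erase _ _, (Finset.insert_erase hvW).symm⟩
    -- Since `e` ends at `v`, it enters no subset of the smaller `W`, so such subsets inherit the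
    -- hypothesis. Subsets containing `v` satisfy it because their product has the factor zero.
    have hinto : ∀ γ ⊆ W, into src tgt (insert e D) γ = into src tgt D γ := by
      intro γ hγ
      ext f
      by_cases hf : f = e
      · subst hf
        have : ¬ Hits tgt γ f := by
          rintro ⟨w, hw, hw'⟩
          rw [htgt] at hw'
          exact hv' (Option.some.inj hw' ▸ hγ hw)
        simp [into_apply, this]
      · simp [into_apply, hf]
    rw [Finset.card_insert_of_notMem hv'] at hN ⊢
    rw [Finset.card_insert_of_notMem he'] at hN
    refine hasFlatDimensionLT_step hv' he' htgt hsrc _ ?_ ?_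
    · refine ih (D.card + W.card) (by omega) D W κ (fun γ hγ hne h0 => ?_) rfl
      exact h γ (hγ.trans (Finset.subset_insert _ _)) hne (by rw [hinto γ hγ, h0])
    · have := ih (D.card + (W.card + 1)) (by omega) D (insert v W) (Function.update κ v 0)
        (fun γ hγ hne h0 => ?_) (by rw [Finset.card_insert_of_notMem hv'])
      · rwa [Finset.card_insert_of_notMem hv'] at this
      obtain hγ' | ⟨δ, hδ, rfl⟩ := subset_insert_cases hγ
      · rw [prod_update_of_subset hv' hγ']
        exact h γ hγ hne (by rw [hinto γ hγ', h0])
      · exact Finset.prod_eq_zero (Finset.mem_insert_self v δ) (Function.update_self _ _ _)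

end CutIdeal

/-! ### Regular sequences of monic polynomials after a linear change of variables -/

section RegularSequence

open MvPolynomial

/-- A monic polynomial stays monic over `B ⧸ I`, hence is not a zero divisor there. -/
lemma Polynomial.Monic.mem_map_C_of_mul_mem {B : Type*} [CommRing B] {I : Ideal B}
    {g a : Polynomial B} (hg : g.Monic) (h : g * a ∈ I.map Polynomial.C) :
    a ∈ I.map Polynomial.C := by
  have key : ∀ p : Polynomial B, p ∈ I.map Polynomial.C ↔
      p.map (Ideal.Quotient.mk I) = 0 := by
    intro p
    rw [Ideal.mem_map_C_iff, Polynomial.ext_iff]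
    simp only [Polynomial.coeff_map, Polynomial.coeff_zero, Ideal.Quotient.eq_zero_iff_mem]
  rw [key] at h ⊢
  rw [Polynomial.map_mul] at h
  exact ((hg.map _).mul_right_eq_zero_iff).1 h

variable {K : Type u} [Field K]

/-- A polynomial that is monic in the variable `i` is a non-zero-divisor modulo every ideal
generated by polynomials that do not involve `i`. -/
lemma MvPolynomial.mem_span_of_monic_mul_mem {ι : Type*} {i i₀ : ι} (hi : i₀ ≠ i)
    {S : Set (MvPolynomial ι K)} (hS : ∀ p ∈ S, p ∈ supported K ({i}ᶜ : Set ι))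
    {F : Polynomial (Polynomial K)} (hF : F.Monic) {a : MvPolynomial ι K}
    (h : F.eval₂ (Polynomial.aeval (X i₀ : MvPolynomial ι K)).toRingHom (X i) * a ∈ Ideal.span S) :
    a ∈ Ideal.span S := by
  classical
  -- The ring is regarded as polynomials in the variable `i` over the ring `B` in the remaining
  -- variables; the generators in `S` then become constants.
  let B := MvPolynomial {j // ¬ j = i} K
  let r : B →ₐ[K] MvPolynomial ι K := rename Subtype.val
  let φ : MvPolynomial ι K →ₐ[K] Polynomial B :=
    aeval fun j => if h : j = i then Polynomial.X else Polynomial.C (X ⟨j, h⟩)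
  let θ : Polynomial B →+* MvPolynomial ι K := Polynomial.eval₂RingHom r.toRingHom (X i)
  have hθφ : ∀ p, θ (φ p) = p := by
    intro p
    have : θ.comp φ.toRingHom = RingHom.id _ := by
      apply MvPolynomial.ringHom_ext
      · intro k
        change θ (φ (C k)) = C k
        rw [algHom_C]
        change Polynomial.eval₂ _ _ (Polynomial.C (C k)) = _
        rw [Polynomial.eval₂_C]
        change r (C k) = _
        rw [algHom_C]; rfl
      · intro j
        change θ (φ (X j)) = X j
        simp only [φ, aeval_X]
        split_ifs with h
        · subst h; exact Polynomial.eval₂_X _ _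
        · refine (Polynomial.eval₂_C _ _).trans ?_
          exact rename_X _ _
    exact RingHom.congr_fun this p
  have hφr : ∀ b : B, φ (r b) = Polynomial.C b := by
    intro b
    have : φ.toRingHom.comp r.toRingHom = (Polynomial.C : B →+* Polynomial B) := by
      apply MvPolynomial.ringHom_ext
      · intro k
        change φ (r (C k)) = _
        rw [algHom_C, MvPolynomial.algebraMap_eq, algHom_C]
        rfl
      · intro j
        change φ (r (X j)) = _
        rw [show r (X j) = X j.1 from rename_X _ _, aeval_X, dif_neg j.2]
    exact RingHom.congr_fun this b
  let I : Ideal B := Ideal.span {b | r b ∈ S}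
  have h1 : ∀ p ∈ Ideal.span S, φ p ∈ I.map Polynomial.C := by
    intro p hp
    have : Ideal.span S ≤ (I.map Polynomial.C).comap φ.toRingHom := by
      rw [Ideal.span_le]
      intro q hq
      have := hS q hq
      rw [supported_eq_range_rename] at this
      obtain ⟨b, hb'⟩ : ∃ b : B, r b = q := this
      change φ q ∈ I.map Polynomial.C
      rw [← hb', hφr]
      exact Ideal.mem_map_of_mem _ (Ideal.subset_span (by rwa [← hb'] at hq))
    exact this hp
  have h2 : ∀ p, φ p ∈ I.map Polynomial.C → p ∈ Ideal.span S := by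
    intro p hp
    have : I.map Polynomial.C ≤ (Ideal.span S).comap θ := by
      rw [Ideal.map_le_iff_le_comap, Ideal.span_le]
      intro b hb
      change θ (Polynomial.C b) ∈ Ideal.span S
      rw [← hφr, hθφ]
      exact Ideal.subset_span hb
    rw [← hθφ p]
    exact this hp
  apply h2
  have h3 := h1 _ h
  rw [map_mul] at h3
  refine Polynomial.Monic.mem_map_C_of_mul_mem ?_ h3
  have : φ (F.eval₂ (Polynomial.aeval (X i₀ : MvPolynomial ι K)).toRingHom (X i)) =
      F.map (Polynomial.aeval (X ⟨i₀, hi⟩ : B)).toRingHom := by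
    change φ.toRingHom _ = _
    rw [Polynomial.hom_eval₂, Polynomial.map]
    congr 1
    · apply Polynomial.ringHom_ext
      · intro k
        change φ (Polynomial.aeval (X i₀) (Polynomial.C k)) =
          Polynomial.C (Polynomial.aeval _ (Polynomial.C k))
        rw [Polynomial.aeval_C, Polynomial.aeval_C, AlgHom.commutes]
        rfl
      · change φ (Polynomial.aeval (X i₀) Polynomial.X) =
          Polynomial.C (Polynomial.aeval _ Polynomial.X)
        rw [Polynomial.aeval_X, Polynomial.aeval_X]
        simp only [φ, aeval_X]
        rw [dif_neg hi]
    · change φ (X i) = _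
      simp only [φ, aeval_X, dif_pos]
  rw [this]
  exact hF.map _

lemma Module.Basis.sumExtend_apply_inl {ι V : Type*} [AddCommGroup V] [Module K V] {v : ι → V}
    (hs : LinearIndependent K v) (i : ι) : Module.Basis.sumExtend hs (Sum.inl i) = v i := by
  simp only [Module.Basis.sumExtend, Module.Basis.reindex_apply,
    Module.Basis.extend_apply_self]
  rfl

/-- The linear form with given coefficients. -/
def linearForm (K : Type u) [Field K] (σ : Type) : (σ →₀ K) →ₗ[K] MvPolynomial σ K :=
  Finsupp.linearCombination K X

lemma linearForm_single {σ : Type} (e : σ) : linearForm K σ (Finsupp.single e 1) = X e := by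
  simp [linearForm]

/-- The linear change of variables given by a basis. -/
def linearChange {σ : Type} {ι : Type*} (b : Module.Basis ι K (σ →₀ K)) :
    MvPolynomial ι K ≃ₐ[K] MvPolynomial σ K :=
  AlgEquiv.ofAlgHom (aeval fun i => linearForm K σ (b i))
    (aeval fun e => Finsupp.linearCombination K X (b.repr (Finsupp.single e 1)))
    (by
      apply MvPolynomial.algHom_ext
      intro e
      rw [AlgHom.comp_apply, aeval_X, AlgHom.id_apply, ← linearForm_single,
        ← AlgHom.toLinearMap_apply, Finsupp.apply_linearCombination]
      conv_rhs => rw [← b.linearCombination_repr (Finsupp.single e 1)]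
      rw [Finsupp.apply_linearCombination]
      congr 2
      ext i
      simp)
    (by
      apply MvPolynomial.algHom_ext
      intro i
      rw [AlgHom.comp_apply, aeval_X, AlgHom.id_apply]
      have : ∀ v : σ →₀ K, (aeval fun e => Finsupp.linearCombination K X
          (b.repr (Finsupp.single e 1)) : MvPolynomial σ K →ₐ[K] MvPolynomial ι K)
          (linearForm K σ v) = Finsupp.linearCombination K X (b.repr v) := by
        intro v
        induction v using Finsupp.induction_linear with
        | zero => simp
        | add f g hf hg => simp only [map_add, hf, hg]
        | single e a =>
          have : Finsupp.single e a = a • Finsupp.single e (1 : K) := by simp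
          rw [this, map_smul, linearForm_single, map_smul, aeval_X, map_smul, map_smul]
      rw [this, Module.Basis.repr_self]
      simp)

lemma linearChange_X {σ : Type} {ι : Type*} (b : Module.Basis ι K (σ →₀ K)) (i : ι) :
    linearChange b (X i) = linearForm K σ (b i) := by
  change aeval _ (X i) = _
  rw [aeval_X]

/-- Vanishing of `Tor` for a quotient by independent linear forms and a quotient of flat dimension
at most `s`, if the two quotients intersect in a scheme that is finite over a line. -/
theorem isZero_tor_of_linearIndependent {σ τ : Type} [Fintype σ] [Fintype τ] (s : ℕ)
    (hcard : Fintype.card σ = Fintype.card τ + 1 + s) (l : τ → σ →₀ K) (e₀ : σ)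
    (hl : LinearIndependent K (Sum.elim l fun _ : Unit => Finsupp.single e₀ (1 : K)))
    (L N : Ideal (MvPolynomial σ K)) (hL : L = Ideal.span (Set.range fun j => linearForm K σ (l j)))
    (hint : ∀ e, ((Polynomial.aeval (Ideal.Quotient.mk (L ⊔ N) (X e₀)) :
      Polynomial K →ₐ[K] MvPolynomial σ K ⧸ (L ⊔ N)).toRingHom).IsIntegralElem
      (Ideal.Quotient.mk (L ⊔ N) (X e)))
    (hfd : HasFlatDimensionLT (MvPolynomial σ K) (MvPolynomial σ K ⧸ N) (s + 1)) (i : ℕ) :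
    CategoryTheory.Limits.IsZero (((CategoryTheory.Tor' (ModuleCat.{u} (MvPolynomial σ K))
      (i + 1)).obj (ModuleCat.of _ (MvPolynomial σ K ⧸ L))).obj
      (ModuleCat.of _ (MvPolynomial σ K ⧸ N))) := by
  classical
  -- New coordinates: the forms `l j`, the variable of `e₀`, and a complement, which has `s`
  -- elements by the count of variables.
  let b := Module.Basis.sumExtend hl
  let ψ := linearChange b
  have : Fintype ((τ ⊕ Unit) ⊕ Module.Basis.sumExtendIndex hl) :=
    FiniteDimensional.fintypeBasisIndex b
  have : Fintype (Module.Basis.sumExtendIndex hl) := 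
    Fintype.ofInjective (Sum.inr : _ → (τ ⊕ Unit) ⊕ Module.Basis.sumExtendIndex hl)
      Sum.inr_injective
  have hs : Fintype.card (Module.Basis.sumExtendIndex hl) = s := by
    have h1 := Module.finrank_eq_nat_card_basis b
    rw [Module.finrank_finsupp_self, hcard] at h1
    rw [Nat.card_sum, Nat.card_sum, Nat.card_eq_fintype_card,
      Nat.card_eq_fintype_card, Nat.card_eq_fintype_card, Fintype.card_unit] at h1
    omega
  let ε : Fin s ≃ Module.Basis.sumExtendIndex hl := (Fintype.equivFinOfCardEq hs).symm
  have hintAll : ∀ x : MvPolynomial σ K, ((Polynomial.aeval (Ideal.Quotient.mk (L ⊔ N) (X e₀)) :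
      Polynomial K →ₐ[K] MvPolynomial σ K ⧸ (L ⊔ N)).toRingHom).IsIntegralElem
      (Ideal.Quotient.mk (L ⊔ N) x) := by
    intro x
    induction x using MvPolynomial.induction_on with
    | C k =>
      have : Ideal.Quotient.mk (L ⊔ N) (C k) = (Polynomial.aeval
          (Ideal.Quotient.mk (L ⊔ N) (X e₀))).toRingHom (Polynomial.C k) := by
        change _ = Polynomial.aeval _ (Polynomial.C k)
        rw [Polynomial.aeval_C]; rfl
      rw [this]
      exact RingHom.isIntegralElem_map _
    | add p q hp hq => rw [map_add]; exact RingHom.IsIntegralElem.add _ hp hq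
    | mul_X p e hp => rw [map_mul]; exact RingHom.IsIntegralElem.mul _ hp (hint e)
  -- Monic equations, over the polynomials in the variable of `e₀`, for the complementary
  -- coordinates modulo `L ⊔ N`. Substituting the coordinates into them gives the elements `w' r` of
  -- `L ⊔ N`.
  choose F hFm hF using fun r : Fin s => hintAll (ψ (X (Sum.inr (ε r))))
  let w' : ℕ → MvPolynomial ((τ ⊕ Unit) ⊕ Module.Basis.sumExtendIndex hl) K := fun r =>
    if h : r < s then (F ⟨r, h⟩).eval₂ (Polynomial.aeval
      (X (Sum.inl (Sum.inr ())) :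
        MvPolynomial ((τ ⊕ Unit) ⊕ Module.Basis.sumExtendIndex hl) K)).toRingHom
      (X (Sum.inr (ε ⟨r, h⟩))) else 0
  let S : ℕ → Set (MvPolynomial ((τ ⊕ Unit) ⊕ Module.Basis.sumExtendIndex hl) K) := fun r =>
    Set.range (fun j => X (Sum.inl (Sum.inl j))) ∪ w' '' Set.Iio r
  have hψx₀ : ψ (X (Sum.inl (Sum.inr ()))) = X e₀ := by
    rw [linearChange_X, ← linearForm_single]
    congr 1
    exact Module.Basis.sumExtend_apply_inl hl _
  have hJ0 : (Ideal.span (S 0)).map ψ.toRingEquiv.toRingHom = L := by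
    rw [Ideal.map_span, hL]
    congr 1
    have : Set.Iio 0 = (∅ : Set ℕ) := by ext; simp
    simp only [S]
    rw [this, Set.image_empty, Set.union_empty, ← Set.range_comp]
    congr 1
    ext1 j
    change ψ (X _) = _
    rw [linearChange_X]
    congr 1
    exact Module.Basis.sumExtend_apply_inl hl _
  have key := isZero_tor_of_regular_sequence (A := MvPolynomial σ K) (MvPolynomial σ K ⧸ N) s
    (fun r => (Ideal.span (S r)).map ψ.toRingEquiv.toRingHom) (fun r => ψ (w' r)) ?_ ?_ ?_ hfd i
  · beta_reduce at key
    rwa [hJ0] at key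
  · intro r _
    have : S (r + 1) = S r ∪ {w' r} := by
      simp only [S]
      rw [Set.union_assoc, ← Set.image_singleton, ← Set.image_union]
      congr 2
      ext k
      simp only [Set.mem_Iio, Set.mem_union, Set.mem_singleton_iff]
      omega
    rw [this, Ideal.span_union, Ideal.map_sup, Ideal.map_span _ {w' r}, Set.image_singleton]
    rfl
  · intro r hr a ha
    obtain ⟨a, rfl⟩ := ψ.surjective a
    have hmem : ∀ y, ψ y ∈ (Ideal.span (S r)).map ψ.toRingEquiv.toRingHom ↔
        y ∈ Ideal.span (S r) := by
      intro y
      constructor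
      · intro h
        obtain ⟨z, hz, hzy⟩ := (Ideal.mem_map_iff_of_surjective ψ.toRingEquiv.toRingHom
          ψ.surjective).1 h
        rwa [← ψ.injective hzy]
      · exact fun h => Ideal.mem_map_of_mem ψ.toRingEquiv.toRingHom h
    rw [← map_mul, hmem] at ha
    rw [hmem]
    simp only [w', dif_pos hr] at ha
    -- The element `w' r` is monic in its own coordinate, which occurs neither in the forms `l j`
    -- nor in the earlier elements of the sequence.
    refine mem_span_of_monic_mul_mem (by simp) ?_ (hFm ⟨r, hr⟩) ha
    rintro p (⟨j, rfl⟩ | ⟨k, hk, rfl⟩)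
    · exact (X_mem_supported).2 (by simp)
    · rw [Set.mem_Iio] at hk
      simp only [w', dif_pos (hk.trans hr)]
      rw [Polynomial.eval₂_eq_sum]
      refine Subalgebra.sum_mem _ fun m _ => ?_
      refine Subalgebra.mul_mem _ ?_ (Subalgebra.pow_mem _ (X_mem_supported.2 ?_) m)
      · change Polynomial.aeval _ _ ∈ _
        rw [Polynomial.aeval_eq_sum_range]
        refine Subalgebra.sum_mem _ fun m _ => Subalgebra.smul_mem _
          (Subalgebra.pow_mem _ (X_mem_supported.2 (by simp)) m) _
      · simp only [Set.mem_compl_iff, Set.mem_singleton_iff, Sum.inr.injEq,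
          EmbeddingLike.apply_eq_iff_eq, Fin.mk.injEq]
        omega
  · intro r hr
    -- The annihilator of the quotient by `N` is `N`, so the condition is that the integral equation
    -- holds modulo `L ⊔ N`.
    rw [hJ0, Ideal.annihilator_quotient]
    simp only [w', dif_pos hr]
    rw [← Ideal.Quotient.eq_zero_iff_mem, ← hF ⟨r, hr⟩]
    change (Ideal.Quotient.mk (L ⊔ N)) (ψ.toRingEquiv.toRingHom _) = _
    rw [Polynomial.hom_eval₂, Polynomial.hom_eval₂]
    congr 1
    apply Polynomial.ringHom_ext
    · intro k
      change Ideal.Quotient.mk (L ⊔ N) (ψ (Polynomial.aeval _ (Polynomial.C k))) =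
        Polynomial.aeval _ (Polynomial.C k)
      rw [Polynomial.aeval_C, Polynomial.aeval_C, AlgEquiv.commutes]
      rfl
    · change Ideal.Quotient.mk (L ⊔ N) (ψ (Polynomial.aeval _ Polynomial.X)) =
        Polynomial.aeval _ Polynomial.X
      rw [Polynomial.aeval_X, Polynomial.aeval_X, hψx₀]

end RegularSequence

namespace BraidGraph

open MvPolynomial

/-! ### Powers of `t` -/

section Powers

variable (𝕜 : Type u) [Field 𝕜]

lemma tPow_add (a b : ℤ) : tPow 𝕜 (a + b) = tPow 𝕜 a * tPow 𝕜 b := by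
  simp [tPow, HahnSeries.single_mul_single]

lemma tPow_zero : tPow 𝕜 0 = 1 := rfl

lemma tPow_ne_zero (a : ℤ) : tPow 𝕜 a ≠ 0 := by
  intro h
  have := tPow_mul_tPow_neg 𝕜 a
  rw [h, zero_mul] at this
  exact zero_ne_one this

lemma tPow_sum {ι : Type*} (s : Finset ι) (f : ι → ℤ) :
    tPow 𝕜 (∑ i ∈ s, f i) = ∏ i ∈ s, tPow 𝕜 (f i) := by
  classical
  induction s using Finset.induction_on with
  | empty => rw [Finset.sum_empty, Finset.prod_empty, tPow_zero]
  | insert a s ha ih => rw [Finset.sum_insert ha, Finset.prod_insert ha, tPow_add, ih]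

lemma tPow_pow (a : ℤ) (k : ℕ) : tPow 𝕜 a ^ k = tPow 𝕜 (k * a) := by
  induction k with
  | zero => simp [tPow_zero]
  | succ k ih => rw [pow_succ, ih, ← tPow_add]; congr 1; push_cast; ring

/-- This is what the Laurent parameter provides: `t` is not a root of unity, which solves the
recurrence for integrality, and `t^w - 1` is a unit, which kills both sides for disconnected graphs.
-/
lemma tPow_sub_one_ne_zero {a : ℤ} (ha : a ≠ 0) : tPow 𝕜 a - 1 ≠ 0 := by
  intro h
  have h0 := congrArg (fun x : LaurentSeries 𝕜 => HahnSeries.coeff x 0) h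
  have h1 : (tPow 𝕜 a).coeff 0 = 0 := HahnSeries.coeff_single_of_ne (Ne.symm ha)
  have h2 : (1 : LaurentSeries 𝕜).coeff 0 = 1 := by simp
  simp only [HahnSeries.coeff_sub, h1, h2, HahnSeries.coeff_zero, zero_sub] at h0
  exact one_ne_zero (neg_eq_zero.1 h0)

end Powers

/-! ### Cuts of a graph as sums over vertices -/

namespace ThinGraph

variable (G : ThinGraph)

/-- Sums over the two sides of a cut are computed by the sums over the vertices inside it. -/
lemma sum_cutOut_sub_sum_cutIn {M : Type*} [AddCommGroup M] (γ : Finset G.Node) (g : G.Edge → M) :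
    ∑ e ∈ G.cutOut γ, g e - ∑ e ∈ G.cutIn γ, g e =
      ∑ v ∈ γ, (∑ e ∈ G.outEdges v, g e - ∑ e ∈ G.inEdges v, g e) := by
  have h1 : ∀ f : G.Edge → Option G.Node, ∑ v ∈ γ, ∑ e with f e = some v, g e =
      ∑ e with ∃ v ∈ γ, f e = some v, g e := by
    intro f
    rw [← Finset.sum_biUnion]
    · congr 1
      ext e
      simp
    · intro v _ w _ hvw
      rw [Function.onFun, Finset.disjoint_left]
      intro e he he'
      rw [Finset.mem_filter] at he he'
      exact hvw (Option.some.inj (he.2.symm.trans he'.2))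
  rw [Finset.sum_sub_distrib]
  have h2 := h1 G.src
  have h3 := h1 G.tgt
  change ∑ v ∈ γ, ∑ e ∈ G.outEdges v, g e = ∑ e with G.Starts γ e, g e at h2
  change ∑ v ∈ γ, ∑ e ∈ G.inEdges v, g e = ∑ e with G.Ends γ e, g e at h3
  rw [h2, h3, cutOut, cutIn, Finset.sum_filter, Finset.sum_filter, Finset.sum_filter,
    Finset.sum_filter, ← Finset.sum_sub_distrib, ← Finset.sum_sub_distrib]
  refine Finset.sum_congr rfl fun e _ => ?_
  by_cases a : G.Starts γ e <;> by_cases b : G.Ends γ e <;> simp [a, b]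

lemma sum_internal_add_sum_cutIn {M : Type*} [AddCommMonoid M] (γ : Finset G.Node)
    (g : G.Edge → M) : ∑ e ∈ G.internal γ, g e + ∑ e ∈ G.cutIn γ, g e =
      ∑ v ∈ γ, ∑ e ∈ G.inEdges v, g e := by
  have h1 : ∑ v ∈ γ, ∑ e ∈ G.inEdges v, g e = ∑ e with G.Ends γ e, g e := by
    rw [← Finset.sum_biUnion]
    · congr 1
      ext e
      simp [inEdges, Ends]
    · intro v _ w _ hvw
      rw [Function.onFun, Finset.disjoint_left]
      intro e he he'
      rw [inEdges, Finset.mem_filter] at he he'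
      exact hvw (Option.some.inj (he.2.symm.trans he'.2))
  rw [h1, internal, cutIn, Finset.sum_filter, Finset.sum_filter, Finset.sum_filter,
    ← Finset.sum_add_distrib]
  refine Finset.sum_congr rfl fun e _ => ?_
  by_cases a : G.Starts γ e <;> by_cases b : G.Ends γ e <;> simp [a, b]

lemma prod_cutIn_X (K : Type u) [CommRing K] (γ : Finset G.Node) :
    ∏ e ∈ G.cutIn γ, (X e : MvPolynomial G.Edge K) =
      monomial (CutIdeal.into G.src G.tgt Finset.univ γ) 1 := by
  rw [cutIn, CutIdeal.prod_X_eq_monomial]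
  congr 2
  ext e
  simp only [CutIdeal.into, Finset.mem_univ, true_and]
  rfl

lemma prod_cutOut_X (K : Type u) [CommRing K] (γ : Finset G.Node) :
    ∏ e ∈ G.cutOut γ, (X e : MvPolynomial G.Edge K) =
      monomial (CutIdeal.outOf G.src G.tgt Finset.univ γ) 1 := by
  rw [cutOut, CutIdeal.prod_X_eq_monomial]
  congr 2
  ext e
  simp only [CutIdeal.outOf, Finset.mem_univ, true_and]
  rfl

lemma into_eq_sum (γ : Finset G.Node) : CutIdeal.into G.src G.tgt Finset.univ γ =
    ∑ e ∈ G.cutIn γ, Finsupp.single e 1 := by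
  ext e
  rw [Finsupp.finsetSum_apply]
  simp only [Finsupp.single_apply, Finset.sum_ite_eq']
  simp only [CutIdeal.into_apply, cutIn, Finset.mem_filter, Finset.mem_univ, true_and]
  rfl

lemma outOf_eq_sum (γ : Finset G.Node) : CutIdeal.outOf G.src G.tgt Finset.univ γ =
    ∑ e ∈ G.cutOut γ, Finsupp.single e 1 := by
  ext e
  rw [Finsupp.finsetSum_apply]
  simp only [Finsupp.single_apply, Finset.sum_ite_eq']
  simp only [CutIdeal.outOf_apply, cutOut, Finset.mem_filter, Finset.mem_univ, true_and]
  rfl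

end ThinGraph

/-! ### The ideals of the edge ring in terms of cut binomials -/

section EdgeIdeals

variable (𝕜 : Type u) [Field 𝕜] (G : FramedGraph)

/-- The total framing of the edges that enter a vertex, as a power of `t`. -/
def vertexParameter (v : G.Node) : LaurentSeries 𝕜 :=
  tPow 𝕜 (∑ e ∈ G.inEdges v, G.framing e)

lemma toEdgeRing_x (e : G.Edge) : toEdgeRing 𝕜 G (xVar 𝕜 e) = X e := by
  simp [toEdgeRing, xVar]

lemma toEdgeRing_y (e : G.Edge) :
    toEdgeRing 𝕜 G (yVar 𝕜 e) = C (tPow 𝕜 (-G.framing e)) * X e := by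
  simp [toEdgeRing, yVar]

lemma edgeLinearIdeal_eq : edgeLinearIdeal 𝕜 G = Ideal.span (Set.range fun v : G.Thick =>
    ∑ e ∈ G.outEdges (Sum.inl v), (X e : EdgeRing 𝕜 G) -
      ∑ e ∈ G.inEdges (Sum.inl v), C (tPow 𝕜 (-G.framing e)) * X e) := by
  rw [edgeLinearIdeal, linearIdeal, Ideal.map_span, ← Set.range_comp]
  congr 2
  ext1 v
  simp only [Function.comp_apply, map_sub, map_sum, toEdgeRing_x, toEdgeRing_y]

/-- Clearing the denominators in `y_e = t^(-ℓ) x_e` adds the framings of the entering edges to the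
weight. The total is the framing of all edges that end in `γ`, so the coefficient becomes a product
over the vertices of `γ`, as the cut ideals require. -/
lemma edgeNonlocal_generator (γ : Finset G.Node) :
    C (tPow 𝕜 (∑ e ∈ G.cutIn γ, G.framing e)) * toEdgeRing 𝕜 G
      (C (tPow 𝕜 (weight G γ)) * ∏ e ∈ G.cutOut γ, xVar 𝕜 e - ∏ e ∈ G.cutIn γ, yVar 𝕜 e) =
      -CutIdeal.relation G.src G.tgt (vertexParameter 𝕜 G) Finset.univ γ := by
  rw [map_sub, map_mul, algHom_C, algebraMap_eq, map_prod, map_prod]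
  simp only [toEdgeRing_x, toEdgeRing_y, Finset.prod_mul_distrib]
  rw [← map_prod, ← tPow_sum, mul_sub, ← mul_assoc, ← mul_assoc, ← C_mul, ← C_mul, ← tPow_add,
    ← tPow_add, Finset.sum_neg_distrib, add_neg_cancel, tPow_zero, C_1, one_mul,
    G.prod_cutIn_X, G.prod_cutOut_X, C_mul_monomial, mul_one, CutIdeal.relation, neg_sub]
  simp only [vertexParameter]
  rw [← tPow_sum, ← G.sum_internal_add_sum_cutIn, add_comm, weight]

lemma edgeNonlocalIdeal_eq : edgeNonlocalIdeal 𝕜 G =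
    CutIdeal.ideal G.src G.tgt (vertexParameter 𝕜 G) Finset.univ Finset.univ := by
  rw [edgeNonlocalIdeal, nonlocalIdeal, Ideal.map_span, ← Set.range_comp]
  apply le_antisymm
  · rw [Ideal.span_le]
    rintro _ ⟨γ, rfl⟩
    have h := edgeNonlocal_generator 𝕜 G γ
    have hmem := neg_mem (CutIdeal.relation_mem_ideal (src := G.src) (tgt := G.tgt)
      (κ := vertexParameter 𝕜 G) (D := Finset.univ) (Finset.subset_univ γ))
    rw [← h] at hmem
    have := Ideal.mul_mem_left _ (C (tPow 𝕜 (-∑ e ∈ G.cutIn γ, G.framing e))) hmem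
    rwa [← mul_assoc, ← C_mul, mul_comm (tPow 𝕜 _), tPow_mul_tPow_neg, C_1, one_mul] at this
  · refine CutIdeal.ideal_le fun γ _ => ?_
    rw [← neg_mem_iff, ← edgeNonlocal_generator]
    exact Ideal.mul_mem_left _ _ (Ideal.subset_span ⟨γ, rfl⟩)

/-- Monomials whose exponents differ by the boundary of a set of vertices agree, up to a power
of `t`, modulo the non-local ideal. -/
lemma monomial_sub_monomial_mem (γ : Finset G.Node) {o i : G.Edge →₀ ℕ} {a b : ℤ}
    (h : ∀ e, (o e : ℤ) - i e = ∑ v ∈ γ, ((∑ f ∈ G.outEdges v, if f = e then (1 : ℤ) else 0) -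
      ∑ f ∈ G.inEdges v, if f = e then (1 : ℤ) else 0))
    (hab : a - b = ∑ v ∈ γ, ∑ e ∈ G.inEdges v, G.framing e) :
    monomial o (tPow 𝕜 a) - monomial i (tPow 𝕜 b) ∈ edgeNonlocalIdeal 𝕜 G := by
  have h' : ∀ e, (o e : ℤ) - i e = (CutIdeal.outOf G.src G.tgt Finset.univ γ e : ℤ) -
      CutIdeal.into G.src G.tgt Finset.univ γ e := by
    intro e
    rw [h, ← G.sum_cutOut_sub_sum_cutIn, G.outOf_eq_sum, G.into_eq_sum, Finsupp.finsetSum_apply,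
      Finsupp.finsetSum_apply]
    simp only [Finsupp.single_apply]
    push_cast
    rfl
  -- An edge crosses the cut in at most one direction. If it leaves `γ`, the exponents differ by `1`
  -- there, so it divides the first monomial. The quotient is a common cofactor that multiplies the
  -- relation of `γ`.
  have hle : CutIdeal.outOf G.src G.tgt Finset.univ γ ≤ o := by
    intro e
    have := h' e
    rw [CutIdeal.outOf_apply, CutIdeal.into_apply] at this
    rw [CutIdeal.outOf_apply]
    by_cases a : CutIdeal.Hits G.src γ e <;> by_cases b : CutIdeal.Hits G.tgt γ e <;>
      simp [a, b] at this ⊢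
    omega
  rw [edgeNonlocalIdeal_eq, ← neg_mem_iff, neg_sub]
  have hmem := Ideal.mul_mem_left _
    (monomial (o - CutIdeal.outOf G.src G.tgt Finset.univ γ) (tPow 𝕜 b))
    (CutIdeal.relation_mem_ideal (src := G.src) (tgt := G.tgt)
      (κ := vertexParameter 𝕜 G) (D := Finset.univ) (Finset.subset_univ γ))
  convert hmem using 1
  rw [CutIdeal.relation, mul_sub, monomial_mul, monomial_mul, mul_one, tsub_add_cancel_of_le hle]
  congr 2
  · congr 1
    ext e
    have h1 := h' e
    have h2 := hle e
    simp only [Finsupp.add_apply, Finsupp.tsub_apply]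
    omega
  · simp only [vertexParameter]
    rw [← tPow_sum, ← hab, ← tPow_add]
    congr 1
    ring

end EdgeIdeals

end BraidGraph

namespace BraidGraph

open MvPolynomial

/-! ### Graphs in which every nonempty set of vertices is entered -/

section Cuts

namespace ThinGraph

variable (G : ThinGraph)

lemma mem_cutIn {γ : Finset G.Node} {e : G.Edge} :
    e ∈ G.cutIn γ ↔ ¬ G.Starts γ e ∧ G.Ends γ e := by
  simp [cutIn]

lemma mem_cutOut {γ : Finset G.Node} {e : G.Edge} :
    e ∈ G.cutOut γ ↔ G.Starts γ e ∧ ¬ G.Ends γ e := by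
  simp [cutOut]

lemma mem_inEdges {v : G.Node} {e : G.Edge} : e ∈ G.inEdges v ↔ G.tgt e = some v := by
  simp [inEdges]

lemma mem_outEdges {v : G.Node} {e : G.Edge} : e ∈ G.outEdges v ↔ G.src e = some v := by
  simp [outEdges]

variable {G}

/-- If there is one source and every set of vertices is entered, then the graph is connected. -/
lemma connected_of_cutIn_nonempty {e₀ : G.Edge} (h₀ : ∀ e, G.src e = none ↔ e = e₀)
    (hcut : ∀ γ : Finset G.Node, γ.Nonempty → (G.cutIn γ).Nonempty) :
    G.adjacency.Connected := by
  classical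
  -- The beginnings of the edges not reachable from `e₀`. An edge entering this set would be
  -- reachable and adjacent to an unreachable edge.
  let γ : Finset G.Node := {v | ∃ e, G.src e = some v ∧ ¬ G.adjacency.Reachable e₀ e}
  have hreach : ∀ e, (∀ v, G.src e = some v → v ∉ γ) → G.adjacency.Reachable e₀ e := by
    intro e he
    by_contra hr
    cases h : G.src e with
    | none =>
      rw [(h₀ e).1 h] at hr
      exact hr (SimpleGraph.Reachable.refl _)
    | some u => exact he u h (Finset.mem_filter.2 ⟨Finset.mem_univ _, e, h, hr⟩)
  have hγ : γ = ∅ := by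
    by_contra hne
    obtain ⟨e, he⟩ := hcut γ (Finset.nonempty_iff_ne_empty.2 hne)
    obtain ⟨hs, v, hv, ht⟩ := G.mem_cutIn.1 he
    obtain ⟨f, hf, hf'⟩ := (Finset.mem_filter.1 hv).2
    have hr := hreach e fun u hu hu' => hs ⟨u, hu', hu⟩
    by_cases hef : e = f
    · exact hf' (hef ▸ hr)
    · refine hf' (hr.trans (SimpleGraph.Adj.reachable ?_))
      rw [adjacency, SimpleGraph.fromRel_adj]
      exact ⟨hef, Or.inl ⟨v, Or.inr ht, Or.inl hf⟩⟩
  have hall : ∀ e, G.adjacency.Reachable e₀ e := fun e =>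
    hreach e fun v _ => hγ ▸ Finset.notMem_empty v
  have : Nonempty G.Edge := ⟨e₀⟩
  exact SimpleGraph.Connected.mk fun e f => (hall e).symm.trans (hall f)

lemma into_ne_zero {γ : Finset G.Node} (h : (G.cutIn γ).Nonempty) :
    CutIdeal.into G.src G.tgt Finset.univ γ ≠ 0 := by
  obtain ⟨e, he⟩ := h
  intro h
  have h1 := DFunLike.congr_fun h e
  rw [into_eq_sum, Finsupp.finsetSum_apply] at h1
  simp only [Finsupp.single_apply, Finset.sum_ite_eq', if_pos he] at h1
  exact one_ne_zero h1

end ThinGraph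

variable (𝕜 : Type u) [Field 𝕜]

/-- The coefficients of the linear relation at a thick edge. -/
def linearRelation (G : FramedGraph) (j : G.Thick) : G.Edge →₀ LaurentSeries 𝕜 :=
  ∑ e ∈ G.outEdges (Sum.inl j), Finsupp.single e 1 -
    ∑ e ∈ G.inEdges (Sum.inl j), Finsupp.single e (tPow 𝕜 (-G.framing e))

lemma edgeLinearIdeal_eq_span_linearForm (G : FramedGraph) : edgeLinearIdeal 𝕜 G =
    Ideal.span (Set.range fun j : G.Thick =>
      linearForm (LaurentSeries 𝕜) G.Edge (linearRelation 𝕜 G j)) := by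
  rw [edgeLinearIdeal_eq]
  congr 2
  ext1 j
  rw [linearRelation, map_sub, map_sum, map_sum]
  have h : ∀ (e : G.Edge) (a : LaurentSeries 𝕜),
      linearForm (LaurentSeries 𝕜) G.Edge (Finsupp.single e a) = C a * X e := by
    intro e a
    rw [linearForm, Finsupp.linearCombination_single, smul_eq_C_mul]
  simp only [h, C_1, one_mul]

lemma linearRelation_apply (G : FramedGraph) (j : G.Thick) (e : G.Edge) :
    linearRelation 𝕜 G j e = (if G.src e = some (Sum.inl j) then 1 else 0) -
      if G.tgt e = some (Sum.inl j) then tPow 𝕜 (-G.framing e) else 0 := by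
  have h1 : ∀ (s : Finset G.Edge) (f : G.Edge → LaurentSeries 𝕜),
      (∑ e' ∈ s, Finsupp.single e' (f e') : G.Edge →₀ LaurentSeries 𝕜) e =
        if e ∈ s then f e else 0 := by
    intro s f
    rw [Finsupp.finsetSum_apply]
    simp only [Finsupp.single_apply, Finset.sum_ite_eq']
  rw [linearRelation, Finsupp.sub_apply, h1, h1]
  simp only [ThinGraph.mem_outEdges, ThinGraph.mem_inEdges]

/-- The linear relations of a graph with one source in which every set of vertices is entered are
linearly independent, even together with the source. -/
lemma linearIndependent_linearRelation {G : FramedGraph} {e₀ : G.Edge}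
    (h₀ : ∀ e, G.src e = none ↔ e = e₀)
    (hcut : ∀ γ : Finset G.Node, γ.Nonempty → (G.cutIn γ).Nonempty)
    (hnode : ∀ v : G.Node, ∃ j : G.Thick, v = Sum.inl j)
    (hdeg : ∀ v : G.Node, (G.outEdges v).card = (G.inEdges v).card) :
    LinearIndependent (LaurentSeries 𝕜) (Sum.elim (linearRelation 𝕜 G) fun _ : Unit =>
      Finsupp.single e₀ (1 : LaurentSeries 𝕜)) := by
  classical
  rw [Fintype.linearIndependent_iff]
  intro a ha
  rw [Fintype.sum_sum_type] at ha
  simp only [Sum.elim_inl, Sum.elim_inr, Finset.univ_unique, Finset.sum_singleton] at ha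
  have heq : ∀ e, e ≠ e₀ → ∑ j : G.Thick, a (Sum.inl j) *
      ((if G.src e = some (Sum.inl j) then 1 else 0) -
        if G.tgt e = some (Sum.inl j) then tPow 𝕜 (-G.framing e) else 0) = 0 := by
    intro e he
    have h1 := DFunLike.congr_fun ha e
    rw [Finsupp.add_apply, Finsupp.finsetSum_apply, Finsupp.smul_apply,
      Finsupp.single_eq_of_ne he, smul_zero, add_zero] at h1
    rw [Finsupp.zero_apply] at h1
    simpa only [Finsupp.smul_apply, smul_eq_mul, linearRelation_apply] using h1
  -- The vertices that occur in the given dependency. At an edge other than `e₀` the coefficients at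
  -- its two ends agree up to a power of `t`, so the edge has both ends in `γ` or neither.
  let γ : Finset G.Node := Finset.univ.filter fun v => ∃ j, v = Sum.inl j ∧ a (Sum.inl j) ≠ 0
  have hmem : ∀ j : G.Thick, (Sum.inl j : G.Node) ∈ γ ↔ a (Sum.inl j) ≠ 0 := by
    intro j
    simp [γ]
  have hhit : ∀ (f : G.Edge → Option G.Node) (e : G.Edge) (j : G.Thick),
      f e = some (Sum.inl j) → ((∃ v ∈ γ, f e = some v) ↔ a (Sum.inl j) ≠ 0) := by
    intro f e j h
    rw [← hmem]
    constructor
    · rintro ⟨v, hv, hv'⟩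
      rw [h] at hv'
      cases hv'
      exact hv
    · exact fun h' => ⟨_, h', h⟩
  have hsum : ∀ (f : G.Edge → Option G.Node) (e : G.Edge) (j : G.Thick)
      (b : G.Thick → LaurentSeries 𝕜), f e = some (Sum.inl j) →
      (∑ k, if f e = some (Sum.inl k) then b k else 0) = b j := by
    intro f e j b h
    rw [Finset.sum_eq_single j]
    · rw [if_pos h]
    · intro k _ hk
      rw [if_neg]
      rw [h]
      intro h'
      exact hk (Sum.inl.inj (Option.some.inj h')).symm
    · exact fun h => absurd (Finset.mem_univ _) h
  have hiff : ∀ e, e ≠ e₀ → (G.Starts γ e ↔ G.Ends γ e) := by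
    intro e he
    have h1 := heq e he
    simp only [mul_sub, Finset.sum_sub_distrib, mul_ite, mul_one, mul_zero] at h1
    obtain ⟨u, hu⟩ := Option.ne_none_iff_exists'.1 (mt (h₀ e).1 he)
    obtain ⟨j, rfl⟩ := hnode u
    rw [hsum G.src e j _ hu] at h1
    rw [ThinGraph.Starts, hhit G.src e j hu]
    cases htgt : G.tgt e with
    | none =>
      simp only [htgt, reduceCtorEq, if_false, Finset.sum_const_zero, sub_zero] at h1
      refine iff_of_false (not_not.2 h1) ?_
      rintro ⟨v, -, hv⟩
      rw [htgt] at hv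
      cases hv
    | some w =>
      obtain ⟨k, rfl⟩ := hnode w
      rw [hsum G.tgt e k _ htgt, sub_eq_zero] at h1
      rw [ThinGraph.Ends, hhit G.tgt e k htgt, h1]
      simp [tPow_ne_zero]
  have hout : G.cutOut γ = ∅ := by
    rw [Finset.eq_empty_iff_forall_notMem]
    intro e he
    obtain ⟨h1, h2⟩ := G.mem_cutOut.1 he
    by_cases hb : e = e₀
    · obtain ⟨v, -, hv⟩ := h1
      rw [(h₀ e).2 hb] at hv
      cases hv
    · exact h2 ((hiff e hb).1 h1)
  -- In-degrees equal out-degrees, so as many edges enter `γ` as leave it. As none leaves, `γ` must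
  -- be empty.
  have hin : G.cutIn γ = ∅ := by
    have habel := G.sum_cutOut_sub_sum_cutIn γ (fun _ => (1 : ℤ))
    rw [hout, Finset.sum_empty, zero_sub] at habel
    rw [Finset.sum_eq_zero (s := γ)] at habel
    · rw [neg_eq_zero, Finset.sum_const, nsmul_eq_mul, mul_one, Nat.cast_eq_zero] at habel
      exact Finset.card_eq_zero.1 habel
    · intro v _
      simp [hdeg v]
  have hγ : ¬ γ.Nonempty := fun hne => by
    have := hcut γ hne
    rw [hin] at this
    exact Finset.not_nonempty_empty this
  have ha0 : ∀ j, a (Sum.inl j) = 0 := by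
    intro j
    by_contra h
    exact hγ ⟨_, (hmem j).2 h⟩
  rintro (j | x)
  · exact ha0 j
  · simp only [ha0, zero_smul, Finset.sum_const_zero, zero_add] at ha
    have h1 := DFunLike.congr_fun ha e₀
    rw [Finsupp.smul_apply, Finsupp.single_eq_same, smul_eq_mul, mul_one, Finsupp.zero_apply] at h1
    exact h1

end Cuts

/-! ### Thin edges of the closed braid, followed along strands -/

section Strands

variable {m n : ℕ} (c : Fin n → Fin m)

lemma exists_touches (hm : 0 < m) (hc : Function.Surjective c) (p : Fin (m + 1)) :
    ∃ j, Touches c p j := by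
  induction p using Fin.cases with
  | zero =>
    obtain ⟨j, hj⟩ := hc ⟨0, hm⟩
    exact ⟨j, Or.inl (by rw [hj]; rfl)⟩
  | succ k =>
    obtain ⟨j, hj⟩ := hc k
    exact ⟨j, Or.inr (by rw [hj])⟩

lemma climb_of_touches {p : Fin (m + 1)} {j : Fin n} (h : Touches c p j) :
    climb c p j = (some (Sum.inl j), 1) := by
  have hj : j ∈ layersFrom c p j := by simp [layersFrom, h]
  have hne : (layersFrom c p j).Nonempty := ⟨j, hj⟩
  have hmin : (layersFrom c p j).min' hne = j := by
    apply le_antisymm (Finset.min'_le _ _ hj)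
    apply Finset.le_min'
    intro k hk
    simp only [layersFrom, Finset.mem_filter] at hk
    exact hk.2.2
  rw [climb, dif_pos hne, hmin]
  simp

lemma layersFrom_succ_of_not_touches {p : Fin (m + 1)} {j : Fin n} (h : ¬ Touches c p j) :
    layersFrom c p (j + 1) = layersFrom c p j := by
  ext k
  simp only [layersFrom, Finset.mem_filter, Finset.mem_univ, true_and, and_congr_right_iff]
  intro hk
  have : (k : ℕ) ≠ j := fun h' => h (Fin.ext h' ▸ hk)
  omega

lemma layersFrom_last (p : Fin (m + 1)) : layersFrom c p n = ∅ := by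
  ext k
  simp [layersFrom]

lemma climb_of_not_touches {p : Fin (m + 1)} (hp : ∃ j, Touches c p j) {j : Fin n}
    (h : ¬ Touches c p j) :
    climb c p j = ((climb c p (j + 1)).1, (climb c p (j + 1)).2 + 1) := by
  have hall : (layersFrom c p 0).Nonempty := by
    obtain ⟨k, hk⟩ := hp
    exact ⟨k, by simp [layersFrom, hk]⟩
  unfold climb
  simp only [layersFrom_succ_of_not_touches c h]
  split_ifs <;> simp <;> ring

lemma climb_zero_last : climb c 0 n = (none, 0) := by
  rw [climb, dif_neg (by simp [layersFrom_last]), if_pos rfl, sub_self]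

lemma climb_last {p : Fin (m + 1)} (hp : ∃ j, Touches c p j) (h0 : p ≠ 0) :
    climb c p n = climb c p 0 := by
  have hall : (layersFrom c p 0).Nonempty := by
    obtain ⟨k, hk⟩ := hp
    exact ⟨k, by simp [layersFrom, hk]⟩
  rw [climb, dif_neg (by simp [layersFrom_last]), if_neg h0, dif_pos hall, climb, dif_pos hall]
  simp only [Nat.cast_zero, Prod.mk.injEq, true_and]
  ring

/-- The edge that leaves the thick edge in layer `j` on strand `p`. -/
def strandEdge (p : Fin (m + 1)) (j : Fin n) : ClosedEdge c :=
  if p = (c j).castSucc then .left j else .right j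

/-- Follow strand `p` upwards from the bottom, recording the thin edge and the number of layers
passed since its beginning. -/
def trace (base : ClosedEdge c × ℤ) (p : Fin (m + 1)) : ℕ → ClosedEdge c × ℤ
  | 0 => base
  | h + 1 => if hh : h < n then
      if Touches c p ⟨h, hh⟩ then (strandEdge c p ⟨h, hh⟩, 0)
      else ((trace base p h).1, (trace base p h).2 + 1)
    else trace base p h

/-- The thin edge of the closed braid graph that passes just below layer `h` on strand `p`,
together with the number of layers passed since its beginning. -/
def position (p : Fin (m + 1)) (h : ℕ) : ClosedEdge c × ℤ :=
  -- The edge at the bottom of a closed strand is the one at its top, found by a preliminary turn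
  -- around the strand. The start `(.bottom, 0)` of that turn is a default value, forgotten at the
  -- first crossing.
  trace c (if p = 0 then (.bottom, 0) else trace c (.bottom, 0) p n) p h

/-- A crossing resets the record, so the starting value is lost above it. This makes `position`
consistent with closing up. -/
lemma trace_eq_of_touches {p : Fin (m + 1)} {j : Fin n} (hj : Touches c p j)
    (a b : ClosedEdge c × ℤ) (h : ℕ) (hh : (j : ℕ) < h) : trace c a p h = trace c b p h := by
  induction h with
  | zero => omega
  | succ h ih =>
    rcases (Nat.lt_succ_iff.1 hh).lt_or_eq with h1 | h1
    · rw [trace, trace, ih h1]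
    · subst h1
      rw [trace, trace, dif_pos j.isLt, dif_pos j.isLt, if_pos hj, if_pos hj]

lemma position_zero_zero : position c 0 0 = (.bottom, 0) := by
  simp [position, trace]

lemma position_of_touches {p : Fin (m + 1)} {j : Fin n} (h : Touches c p j) :
    position c p (j + 1) = (strandEdge c p j, 0) := by
  rw [position, trace, dif_pos j.isLt, if_pos h]

lemma position_of_not_touches {p : Fin (m + 1)} {j : Fin n} (h : ¬ Touches c p j) :
    position c p (j + 1) = ((position c p j).1, (position c p j).2 + 1) := by
  rw [position, trace, dif_pos j.isLt, if_neg h]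
  rfl

lemma position_last {p : Fin (m + 1)} (hp : ∃ j, Touches c p j) (h0 : p ≠ 0) :
    position c p n = position c p 0 := by
  obtain ⟨j, hj⟩ := hp
  simp only [position, if_neg h0]
  rw [trace_eq_of_touches c hj _ (.bottom, 0) n j.isLt]
  rfl

variable {c}

/-- Induction upwards along the strands of the closed braid. -/
lemma climb_induction (ht : ∀ p, ∃ j, Touches c p j) {P : Fin (m + 1) → ℕ → Prop}
    (h0 : P 0 0) (h1 : ∀ p (j : Fin n), Touches c p j → P p (j + 1))
    (h2 : ∀ p (j : Fin n), ¬ Touches c p j → P p j → P p (j + 1))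
    (h3 : ∀ p, p ≠ 0 → P p n → P p 0) (p : Fin (m + 1)) (h : ℕ) (hh : h ≤ n) : P p h := by
  have step : ∀ k, k < n → P p k → P p (k + 1) := fun k hk hP => by
    by_cases ht' : Touches c p ⟨k, hk⟩
    · exact h1 p ⟨k, hk⟩ ht'
    · exact h2 p ⟨k, hk⟩ ht' hP
  -- On a closed strand the statement at the bottom comes from the top, which is reached from just
  -- above some crossing of the strand.
  have base : P p 0 := by
    by_cases hp : p = 0
    · exact hp ▸ h0
    · obtain ⟨j, hj⟩ := ht p
      refine h3 p hp ?_
      have : ∀ k, (j : ℕ) + 1 ≤ k → k ≤ n → P p k := by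
        intro k hk
        induction k, hk using Nat.le_induction with
        | base => exact fun _ => h1 p j hj
        | succ k hk ih => exact fun hkn => step k (by omega) (ih (by omega))
      exact this n j.isLt le_rfl
  induction h with
  | zero => exact base
  | succ k ih => exact step k (by omega) (ih (by omega))

/-- Induction downwards along the strands of the closed braid. -/
lemma descend_induction (ht : ∀ p, ∃ j, Touches c p j) {P : Fin (m + 1) → ℕ → Prop}
    (h0 : P 0 n) (h1 : ∀ p (j : Fin n), Touches c p j → P p j)
    (h2 : ∀ p (j : Fin n), ¬ Touches c p j → P p (j + 1) → P p j)
    (h3 : ∀ p, p ≠ 0 → P p 0 → P p n) (p : Fin (m + 1)) (h : ℕ) (hh : h ≤ n) : P p h := by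
  have step : ∀ k, k < n → P p (k + 1) → P p k := fun k hk hP => by
    by_cases ht' : Touches c p ⟨k, hk⟩
    · exact h1 p ⟨k, hk⟩ ht'
    · exact h2 p ⟨k, hk⟩ ht' hP
  have top : P p n := by
    by_cases hp : p = 0
    · exact hp ▸ h0
    · obtain ⟨j, hj⟩ := ht p
      refine h3 p hp ?_
      obtain ⟨k, hk⟩ : ∃ k, k = 0 := ⟨0, rfl⟩
      have hz : k ≤ (j : ℕ) := by omega
      rw [← hk]
      clear hk
      induction hz using Nat.decreasingInduction with
      | self => exact h1 p j hj
      | of_succ k hk ih => exact step k (by omega) ih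
  induction hh using Nat.decreasingInduction with
  | self => exact top
  | of_succ k hk ih => exact step k hk ih

lemma isEmpty_crossingless (ht : ∀ p, ∃ j, Touches c p j) : IsEmpty (Crossingless c) :=
  ⟨fun p => (ht p.1).elim fun j hj => p.2 j hj⟩

lemma tgtAndFraming_bottom (ht : ∀ p, ∃ j, Touches c p j) :
    (ClosedEdge.bottom : ClosedEdge c).tgtAndFraming c = climb c 0 0 := by
  rw [ClosedEdge.tgtAndFraming, dif_neg]
  push Not
  exact ht 0

lemma tgtAndFraming_strandEdge {p : Fin (m + 1)} {j : Fin n} (h : Touches c p j) :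
    (strandEdge c p j).tgtAndFraming c = climb c p (j + 1) := by
  rw [strandEdge]
  split_ifs with hp
  · rw [ClosedEdge.tgtAndFraming, hp]
  · rw [ClosedEdge.tgtAndFraming, h.resolve_left hp]

/-- Layers already passed and layers still to climb add up to a constant along a thin edge, namely
its framing. -/
lemma tgtAndFraming_position (ht : ∀ p, ∃ j, Touches c p j) (p : Fin (m + 1)) (h : ℕ)
    (hh : h ≤ n) : (position c p h).1.tgtAndFraming c =
      ((climb c p h).1, (position c p h).2 + (climb c p h).2) := by
  refine climb_induction ht (P := fun p h => (position c p h).1.tgtAndFraming c =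
      ((climb c p h).1, (position c p h).2 + (climb c p h).2)) ?_ ?_ ?_ ?_ p h hh
  · rw [position_zero_zero, tgtAndFraming_bottom ht, zero_add]
  · intro p j hj
    rw [position_of_touches c hj, tgtAndFraming_strandEdge hj, zero_add]
  · intro p j hj ih
    rw [position_of_not_touches c hj, ih, climb_of_not_touches c (ht p) hj]
    simp only [Prod.mk.injEq, true_and]
    ring
  · intro p hp ih
    rwa [position_last c (ht p) hp, climb_last c (ht p) hp] at ih

/-- The strand on which a thin edge of the closed braid graph lies. -/
def ClosedEdge.strand : ClosedEdge c → Fin (m + 1)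
  | .bottom => 0
  | .left j => (c j).castSucc
  | .right j => (c j).succ
  | .bivalentOut p => p.1

lemma strand_strandEdge {p : Fin (m + 1)} {j : Fin n} (h : Touches c p j) :
    (strandEdge c p j).strand = p := by
  rw [strandEdge]
  split_ifs with hp
  · exact hp.symm
  · exact (h.resolve_left hp).symm

lemma strand_position (ht : ∀ p, ∃ j, Touches c p j) (p : Fin (m + 1)) (h : ℕ)
    (hh : h ≤ n) : (position c p h).1.strand = p := by
  refine climb_induction ht (P := fun p h => (position c p h).1.strand = p) ?_ ?_ ?_ ?_ p h hh
  · rw [position_zero_zero]; rfl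
  · intro p j hj
    rw [position_of_touches c hj, strand_strandEdge hj]
  · intro p j hj ih
    rwa [position_of_not_touches c hj]
  · intro p hp ih
    rwa [position_last c (ht p) hp] at ih

/-- Up to the next crossing the thin edge does not change. This identifies the edges entering a
given thick edge. -/
lemma position_of_climb (ht : ∀ p, ∃ j, Touches c p j) {j : Fin n} (p : Fin (m + 1)) (h : ℕ)
    (hh : h ≤ n) (hj : (climb c p h).1 = some (Sum.inl j)) :
    Touches c p j ∧ (position c p j).1 = (position c p h).1 := by
  revert hj
  refine descend_induction ht (P := fun p h => (climb c p h).1 = some (Sum.inl j) →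
    Touches c p j ∧ (position c p j).1 = (position c p h).1) ?_ ?_ ?_ ?_ p h hh
  · rw [climb_zero_last]
    intro h
    cases h
  · intro p k hk h
    rw [climb_of_touches c hk] at h
    cases h
    exact ⟨hk, rfl⟩
  · intro p k hk ih h
    rw [climb_of_not_touches c (ht p) hk] at h
    have := ih h
    rwa [position_of_not_touches c hk] at this
  · intro p hp ih h
    rw [climb_last c (ht p) hp] at h
    rw [position_last c (ht p) hp]
    exact ih h

lemma touches_castSucc (j : Fin n) : Touches c (c j).castSucc j := Or.inl rfl

lemma touches_succ (j : Fin n) : Touches c (c j).succ j := Or.inr rfl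

lemma strandEdge_castSucc (j : Fin n) : strandEdge c (c j).castSucc j = .left j := if_pos rfl

lemma strandEdge_succ (j : Fin n) : strandEdge c (c j).succ j = .right j :=
  if_neg (Fin.castSucc_lt_succ).ne'

/-- Every thin edge begins somewhere on its strand. -/
lemma exists_position_eq (ht : ∀ p, ∃ j, Touches c p j) (e : ClosedEdge c) :
    ∃ p h, h ≤ n ∧ position c p h = (e, 0) := by
  cases e with
  | bottom => exact ⟨0, 0, Nat.zero_le _, position_zero_zero c⟩
  | left j => exact ⟨_, _, j.isLt, by
      rw [position_of_touches c (touches_castSucc j), strandEdge_castSucc]⟩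
  | right j => exact ⟨_, _, j.isLt, by
      rw [position_of_touches c (touches_succ j), strandEdge_succ]⟩
  | bivalentOut p => exact (isEmpty_crossingless ht).elim p

lemma position_castSucc_ne_succ (ht : ∀ p, ∃ j, Touches c p j) (j : Fin n) :
    (position c (c j).castSucc j).1 ≠ (position c (c j).succ j).1 := by
  intro h
  have := congrArg ClosedEdge.strand h
  rw [strand_position ht _ _ j.isLt.le, strand_position ht _ _ j.isLt.le] at this
  exact (Fin.castSucc_lt_succ).ne this

lemma inEdges_closedBraidGraph (ht : ∀ p, ∃ j, Touches c p j) (j : Fin n) :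
    (closedBraidGraph c).inEdges (Sum.inl j) =
      ({(position c (c j).castSucc j).1, (position c (c j).succ j).1} : Finset (ClosedEdge c)) := by
  have key : ∀ p, Touches c p j → ((position c p j).1.tgtAndFraming c).1 = some (Sum.inl j) := by
    intro p hp
    rw [tgtAndFraming_position ht p j j.isLt.le, climb_of_touches c hp]
  refine Finset.ext fun e => (ThinGraph.mem_inEdges _).trans (Iff.trans (b :=
    e = (position c (c j).castSucc j).1 ∨ e = (position c (c j).succ j).1) ?_
    (Iff.symm (Finset.mem_insert.trans (or_congr_right Finset.mem_singleton))))
  change (ClosedEdge.tgtAndFraming c e).1 = some (Sum.inl j) ↔ _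
  constructor
  · intro he
    obtain ⟨p, h, hh, hp⟩ := exists_position_eq ht e
    have h1 := tgtAndFraming_position ht p h hh
    rw [hp] at h1
    obtain ⟨h2, h3⟩ := position_of_climb ht p h hh (j := j) (by rw [← he, h1])
    rw [hp] at h3
    rcases h2 with rfl | rfl
    · exact Or.inl h3.symm
    · exact Or.inr h3.symm
  · rintro (rfl | rfl)
    · exact key _ (touches_castSucc j)
    · exact key _ (touches_succ j)

lemma outEdges_closedBraidGraph (j : Fin n) :
    (closedBraidGraph c).outEdges (Sum.inl j) =
      ({.left j, .right j} : Finset (ClosedEdge c)) := by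
  refine Finset.ext fun e => (ThinGraph.mem_outEdges _).trans (Iff.trans (b :=
    e = ClosedEdge.left j ∨ e = ClosedEdge.right j) ?_
    (Iff.symm (Finset.mem_insert.trans (or_congr_right Finset.mem_singleton))))
  change ClosedEdge.source c e = some (Sum.inl j) ↔ _
  cases e with
  | left k =>
    constructor
    · intro h
      cases h
      exact Or.inl rfl
    · rintro (h | h)
      · cases h
        rfl
      · cases h
  | right k =>
    constructor
    · intro h
      cases h
      exact Or.inr rfl
    · rintro (h | h)
      · cases h
      · cases h
        rfl
  | _ => simp [ClosedEdge.source]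

lemma sum_inEdges_closedBraidGraph (ht : ∀ p, ∃ j, Touches c p j) {M : Type*} [AddCommMonoid M]
    (j : Fin n) (f : ClosedEdge c → M) : ∑ e ∈ (closedBraidGraph c).inEdges (Sum.inl j), f e =
      f (position c (c j).castSucc j).1 + f (position c (c j).succ j).1 := by
  rw [inEdges_closedBraidGraph ht]
  exact Finset.sum_pair (position_castSucc_ne_succ ht j)

lemma sum_outEdges_closedBraidGraph {M : Type*} [AddCommMonoid M]
    (j : Fin n) (f : ClosedEdge c → M) : ∑ e ∈ (closedBraidGraph c).outEdges (Sum.inl j), f e =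
      f (.left j) + f (.right j) := by
  rw [outEdges_closedBraidGraph]
  have h : (ClosedEdge.left j : ClosedEdge c) ≠ .right j := by simp
  exact Finset.sum_pair h

lemma framing_position (ht : ∀ p, ∃ j, Touches c p j) {p : Fin (m + 1)} {j : Fin n}
    (h : Touches c p j) :
    (closedBraidGraph c).framing (position c p j).1 = (position c p j).2 + 1 := by
  change ((position c p j).1.tgtAndFraming c).2 = _
  rw [tgtAndFraming_position ht p j j.isLt.le, climb_of_touches c h]

lemma tgt_position (ht : ∀ p, ∃ j, Touches c p j) {p : Fin (m + 1)} {j : Fin n}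
    (h : Touches c p j) :
    (closedBraidGraph c).tgt (position c p j).1 = some (Sum.inl j) := by
  have := congrArg Prod.fst (tgtAndFraming_position ht p j j.isLt.le)
  rwa [climb_of_touches c h] at this

lemma src_strandEdge (p : Fin (m + 1)) (j : Fin n) :
    (closedBraidGraph c).src (strandEdge c p j) = some (Sum.inl j) := by
  change ClosedEdge.source c (strandEdge c p j) = _
  rw [strandEdge]
  split_ifs <;> rfl

end Strands

/-! ### Every nonempty set of vertices of a connected closed braid graph is entered -/

section Reachability

variable {m n : ℕ} {c : Fin n → Fin m}

/-- Every nonempty set of vertices of a connected closed braid graph is entered by an edge. -/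
lemma cutIn_nonempty (hm : 0 < m) (hc : Function.Surjective c)
    {γ : Finset (closedBraidGraph c).Node} (hγ : γ.Nonempty) :
    ((closedBraidGraph c).cutIn γ).Nonempty := by
  have ht := exists_touches c hm hc
  by_contra hcut
  rw [Finset.not_nonempty_iff_eq_empty] at hcut
  -- If no edge enters `γ`, then walking backwards along edges never leaves `γ`.
  have hback : ∀ e : ClosedEdge c, (closedBraidGraph c).Ends γ e →
      (closedBraidGraph c).Starts γ e := by
    intro e he
    by_contra hs
    have := (ThinGraph.mem_cutIn _).2 ⟨hs, he⟩
    rw [hcut] at this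
    exact absurd this (Finset.notMem_empty _)
  have hin : ∀ p (j : Fin n), Touches c p j → Sum.inl j ∈ γ →
      (closedBraidGraph c).Starts γ (position c p j).1 := fun p j hj hjγ =>
    hback _ ⟨_, hjγ, tgt_position ht hj⟩
  have hmem : ∀ p (j : Fin n), Touches c p j →
      (closedBraidGraph c).Starts γ (position c p (j + 1)).1 → Sum.inl j ∈ γ := by
    rintro p j hj ⟨v, hv, hs⟩
    rw [position_of_touches c hj] at hs
    have h1 := (src_strandEdge (c := c) p j).symm.trans hs
    exact Option.some.inj h1 ▸ hv
  have hdown : ∀ p h, h ≤ n → (closedBraidGraph c).Starts γ (position c p h).1 →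
      (closedBraidGraph c).Starts γ (position c p 0).1 := by
    intro p h
    induction h with
    | zero => exact fun _ h => h
    | succ h ih =>
      intro hh hs
      refine ih (by omega) ?_
      by_cases hj : Touches c p ⟨h, hh⟩
      · exact hin p ⟨h, hh⟩ hj (hmem p ⟨h, hh⟩ hj hs)
      · have := position_of_not_touches c hj
        rw [show position c p (h + 1) = _ from this] at hs
        exact hs
  -- Walking down strand `k + 1` and around its closure meets a crossing in column `k`, where the
  -- walk passes to strand `k`. By induction it reaches strand `0` and runs down to the cut, where
  -- the bottom edge begins at no vertex.
  have hstarts : ∀ p h, h ≤ n → ¬ (closedBraidGraph c).Starts γ (position c p h).1 := by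
    intro p
    induction p using Fin.induction with
    | zero =>
      intro h hh hs
      obtain ⟨v, -, hs⟩ := hdown 0 h hh hs
      rw [position_zero_zero] at hs
      cases hs
    | succ k ih =>
      intro h hh hs
      have h1 := hdown _ h hh hs
      rw [← position_last c (ht _) (Fin.succ_ne_zero k)] at h1
      obtain ⟨j, hj⟩ := hc k
      have hj' : Touches c k.succ j := Or.inr (by rw [hj])
      have h2 : ∀ h, (j : ℕ) + 1 ≤ h → h ≤ n →
          (closedBraidGraph c).Starts γ (position c k.succ h).1 →
          (closedBraidGraph c).Starts γ (position c k.succ (j + 1)).1 := by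
        intro h hh'
        induction h, hh' using Nat.le_induction with
        | base => exact fun _ h => h
        | succ h hh' ih' =>
          intro hh hs
          refine ih' (by omega) ?_
          by_cases hj : Touches c k.succ ⟨h, hh⟩
          · exact hin _ ⟨h, hh⟩ hj (hmem _ ⟨h, hh⟩ hj hs)
          · have := position_of_not_touches c hj
            rw [show position c k.succ (h + 1) = _ from this] at hs
            exact hs
      have h3 := hmem _ j hj' (h2 n j.isLt le_rfl h1)
      exact ih j j.isLt.le (hin _ j (Or.inl (by rw [hj])) h3)
  obtain ⟨v, hv⟩ := hγ
  cases v with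
  | inl j => exact hstarts _ _ (Fin.isLt j).le (hin _ j (touches_castSucc j) hv)
  | inr q => exact (isEmpty_crossingless ht).elim q

lemma src_eq_none_iff (e : ClosedEdge c) : (closedBraidGraph c).src e = none ↔ e = .bottom := by
  change ClosedEdge.source c e = none ↔ _
  cases e <;> simp [ClosedEdge.source]

lemma connected_closedBraidGraph (hm : 0 < m) (hc : Function.Surjective c) :
    (closedBraidGraph c).adjacency.Connected :=
  ThinGraph.connected_of_cutIn_nonempty src_eq_none_iff fun _ => cutIn_nonempty hm hc

lemma exists_eq_inl (ht : ∀ p, ∃ j, Touches c p j) (v : (closedBraidGraph c).Node) :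
    ∃ j : (closedBraidGraph c).Thick, v = Sum.inl j := by
  cases v with
  | inl j => exact ⟨j, rfl⟩
  | inr q => exact (isEmpty_crossingless ht).elim q

lemma card_outEdges_eq_card_inEdges (ht : ∀ p, ∃ j, Touches c p j)
    (v : (closedBraidGraph c).Node) :
    ((closedBraidGraph c).outEdges v).card = ((closedBraidGraph c).inEdges v).card := by
  obtain ⟨j, rfl⟩ := exists_eq_inl ht v
  rw [Finset.card_eq_sum_ones, Finset.card_eq_sum_ones]
  exact (sum_outEdges_closedBraidGraph j _).trans (sum_inEdges_closedBraidGraph ht j fun _ => 1).symm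

end Reachability

end BraidGraph

namespace BraidGraph

open MvPolynomial

/-! ### The layered diagram and its map to the closed braid graph -/

section Layered

variable {m n : ℕ} (c : Fin n → Fin m)

/-- The edge of the layered diagram just below layer `h` on strand `p`. -/
def layeredEdge (p : Fin (m + 1)) : ℕ → (layeredGraph c).Edge
  -- A closed strand enters layer `0` along the edge that leaves the last layer. The value `none` is
  -- genuine only for the bottom of strand `0`; elsewhere (no layers, or heights above `n`) it is a
  -- default.
  | 0 => if p = 0 then (none : Option (Fin n × Fin (m + 1))) else
      if h : 0 < n then some (⟨n - 1, Nat.sub_lt h one_pos⟩, p) else none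
  | h + 1 => if hh : h < n then some (⟨h, hh⟩, p) else (none : Option (Fin n × Fin (m + 1)))

lemma layeredEdge_succ (p : Fin (m + 1)) (j : Fin n) :
    layeredEdge c p (j + 1) = (some (j, p) : Option (Fin n × Fin (m + 1))) := dif_pos j.isLt

lemma layeredEdge_zero_zero :
    layeredEdge c 0 0 = (none : Option (Fin n × Fin (m + 1))) := by
  unfold layeredEdge
  exact if_pos rfl

lemma layeredEdge_zero {p : Fin (m + 1)} (hp : p ≠ 0) (hn : 0 < n) :
    layeredEdge c p 0 = (some (⟨n - 1, Nat.sub_lt hn one_pos⟩, p) : Option (Fin n × Fin (m + 1))) :=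
  (if_neg hp).trans (dif_pos hn)

lemma layeredEdge_last {p : Fin (m + 1)} (hp : p ≠ 0) : layeredEdge c p n = layeredEdge c p 0 := by
  cases n with
  | zero => rfl
  | succ n => exact (layeredEdge_succ c p (Fin.last n)).trans (layeredEdge_zero c hp n.succ_pos).symm

lemma exists_eq_layeredEdge (s : (layeredGraph c).Edge) :
    ∃ p h, h ≤ n ∧ s = layeredEdge c p h := by
  cases s with
  | none => exact ⟨0, 0, Nat.zero_le _, (layeredEdge_zero_zero c).symm⟩
  | some x => exact ⟨x.2, x.1 + 1, x.1.isLt, (layeredEdge_succ c x.2 x.1).symm⟩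

lemma layeredEdge_injective {p q : Fin (m + 1)} {h : ℕ} (hh : h ≤ n) (hn : 0 < n)
    (heq : layeredEdge c p h = layeredEdge c q h) : p = q := by
  cases h with
  | zero =>
    by_cases hp : p = 0 <;> by_cases hq : q = 0
    · rw [hp, hq]
    · rw [hp, layeredEdge_zero_zero, layeredEdge_zero c hq hn] at heq
      cases heq
    · rw [hq, layeredEdge_zero_zero, layeredEdge_zero c hp hn] at heq
      cases heq
    · rw [layeredEdge_zero c hp hn, layeredEdge_zero c hq hn] at heq
      exact congrArg Prod.snd (Option.some.inj heq)
  | succ h =>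
    have h1 := (layeredEdge_succ c p ⟨h, hh⟩).symm.trans (heq.trans (layeredEdge_succ c q ⟨h, hh⟩))
    exact congrArg Prod.snd (Option.some.inj h1)

lemma src_layeredEdge (p : Fin (m + 1)) (j : Fin n) :
    (layeredGraph c).src (layeredEdge c p (j + 1)) = some (layeredNode c j p) := by
  rw [layeredEdge_succ]
  rfl

lemma src_layeredEdge_zero_zero : (layeredGraph c).src (layeredEdge c 0 0) = none := by
  rw [layeredEdge_zero_zero]
  rfl

lemma tgt_some (p : Fin (m + 1)) (j : Fin n) :
    (layeredGraph c).tgt (some (j, p) : Option (Fin n × Fin (m + 1))) =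
      if h : (j : ℕ) + 1 < n then some (layeredNode c ⟨j + 1, h⟩ p)
      else if p = 0 then none
      else some (layeredNode c ⟨0, j.pos⟩ p) := rfl

lemma tgt_layeredEdge (p : Fin (m + 1)) (j : Fin n) :
    (layeredGraph c).tgt (layeredEdge c p j) = some (layeredNode c j p) := by
  obtain ⟨j, hj⟩ := j
  cases j with
  | zero =>
    by_cases hp : p = 0
    · subst hp
      rw [layeredEdge_zero_zero]
      exact dif_pos hj
    · rw [layeredEdge_zero c hp hj, tgt_some, dif_neg (by simp; omega), if_neg hp]
  | succ j =>
    rw [show layeredEdge c p (j + 1) = _ from layeredEdge_succ c p ⟨j, by omega⟩, tgt_some,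
      dif_pos hj]

lemma tgt_layeredEdge_last : (layeredGraph c).tgt (layeredEdge c 0 n) = none := by
  cases n with
  | zero => rfl
  | succ n =>
    rw [show layeredEdge c 0 (n + 1) = _ from layeredEdge_succ c 0 (Fin.last n), tgt_some,
      dif_neg (by simp), if_pos rfl]
    rfl

lemma layeredNode_of_touches {p : Fin (m + 1)} {j : Fin n} (h : Touches c p j) :
    layeredNode c j p = Sum.inl j := dif_pos h

lemma layeredNode_of_not_touches {p : Fin (m + 1)} {j : Fin n} (h : ¬ Touches c p j) :
    layeredNode c j p = Sum.inr ⟨(j, p), h⟩ := dif_neg h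

lemma layeredNode_eq_inl {p : Fin (m + 1)} {j k : Fin n} (h : layeredNode c j p = Sum.inl k) :
    j = k ∧ Touches c p k := by
  by_cases hj : Touches c p j
  · rw [layeredNode_of_touches c hj] at h
    cases h
    exact ⟨rfl, hj⟩
  · rw [layeredNode_of_not_touches c hj] at h
    cases h

lemma layeredNode_eq_inr {p : Fin (m + 1)} {j : Fin n}
    {q : {q : Fin n × Fin (m + 1) // ¬ Touches c q.2 q.1}} (h : layeredNode c j p = Sum.inr q) :
    j = q.1.1 ∧ p = q.1.2 := by
  by_cases hj : Touches c p j
  · rw [layeredNode_of_touches c hj] at h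
    cases h
  · rw [layeredNode_of_not_touches c hj] at h
    cases h
    exact ⟨rfl, rfl⟩

lemma exists_of_tgt_eq {s : (layeredGraph c).Edge} {v : (layeredGraph c).Node}
    (h : (layeredGraph c).tgt s = some v) :
    ∃ (p : Fin (m + 1)) (j : Fin n), s = layeredEdge c p j ∧ layeredNode c j p = v := by
  obtain ⟨p, k, hk, rfl⟩ := exists_eq_layeredEdge c s
  have key : ∀ j : Fin n, (layeredGraph c).tgt (layeredEdge c p j) = some v →
      layeredNode c j p = v := fun j hj =>
    Option.some.inj ((tgt_layeredEdge c p j).symm.trans hj)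
  rcases hk.lt_or_eq with hk | rfl
  · exact ⟨p, ⟨k, hk⟩, rfl, key ⟨k, hk⟩ h⟩
  · by_cases hp : p = 0
    · rw [hp, tgt_layeredEdge_last] at h
      cases h
    · rw [layeredEdge_last c hp] at h ⊢
      have hk : 0 < k := by
        by_contra h0
        obtain rfl : k = 0 := by omega
        generalize layeredEdge c p 0 = s at h
        cases s with
        | none => cases h
        | some x => exact x.1.elim0
      exact ⟨p, ⟨0, hk⟩, rfl, key ⟨0, hk⟩ h⟩

lemma exists_of_src_eq {s : (layeredGraph c).Edge} {v : (layeredGraph c).Node}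
    (h : (layeredGraph c).src s = some v) :
    ∃ (p : Fin (m + 1)) (j : Fin n), s = layeredEdge c p (j + 1) ∧ layeredNode c j p = v := by
  cases s with
  | none => cases h
  | some x => exact ⟨x.2, x.1, (layeredEdge_succ c x.2 x.1).symm, Option.some.inj h⟩

lemma inEdges_layeredGraph_inl (j : Fin n) : (layeredGraph c).inEdges (Sum.inl j) =
    {layeredEdge c (c j).castSucc j, layeredEdge c (c j).succ j} := by
  ext s
  rw [ThinGraph.mem_inEdges, Finset.mem_insert, Finset.mem_singleton]
  constructor
  · intro h
    obtain ⟨p, k, rfl, h2⟩ := exists_of_tgt_eq c h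
    obtain ⟨rfl, h4⟩ := layeredNode_eq_inl c h2
    rcases h4 with rfl | rfl
    · exact Or.inl rfl
    · exact Or.inr rfl
  · rintro (rfl | rfl)
    · rw [tgt_layeredEdge, layeredNode_of_touches c (touches_castSucc j)]
      rfl
    · rw [tgt_layeredEdge, layeredNode_of_touches c (touches_succ j)]
      rfl

lemma outEdges_layeredGraph_inl (j : Fin n) : (layeredGraph c).outEdges (Sum.inl j) =
    {layeredEdge c (c j).castSucc (j + 1), layeredEdge c (c j).succ (j + 1)} := by
  ext s
  rw [ThinGraph.mem_outEdges, Finset.mem_insert, Finset.mem_singleton]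
  constructor
  · intro h
    obtain ⟨p, k, rfl, h2⟩ := exists_of_src_eq c h
    obtain ⟨rfl, h4⟩ := layeredNode_eq_inl c h2
    rcases h4 with rfl | rfl
    · exact Or.inl rfl
    · exact Or.inr rfl
  · rintro (rfl | rfl)
    · rw [src_layeredEdge, layeredNode_of_touches c (touches_castSucc j)]
      rfl
    · rw [src_layeredEdge, layeredNode_of_touches c (touches_succ j)]
      rfl

lemma inEdges_layeredGraph_inr (q : {q : Fin n × Fin (m + 1) // ¬ Touches c q.2 q.1}) :
    (layeredGraph c).inEdges (Sum.inr q) = {layeredEdge c q.1.2 q.1.1} := by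
  ext s
  rw [ThinGraph.mem_inEdges, Finset.mem_singleton]
  constructor
  · intro h
    obtain ⟨p, k, rfl, h2⟩ := exists_of_tgt_eq c h
    obtain ⟨rfl, rfl⟩ := layeredNode_eq_inr c h2
    rfl
  · rintro rfl
    rw [tgt_layeredEdge, layeredNode_of_not_touches c q.2]
    rfl

lemma outEdges_layeredGraph_inr (q : {q : Fin n × Fin (m + 1) // ¬ Touches c q.2 q.1}) :
    (layeredGraph c).outEdges (Sum.inr q) = {layeredEdge c q.1.2 (q.1.1 + 1)} := by
  ext s
  rw [ThinGraph.mem_outEdges, Finset.mem_singleton]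
  constructor
  · intro h
    obtain ⟨p, k, rfl, h2⟩ := exists_of_src_eq c h
    obtain ⟨rfl, rfl⟩ := layeredNode_eq_inr c h2
    rfl
  · rintro rfl
    rw [src_layeredEdge, layeredNode_of_not_touches c q.2]
    rfl

lemma layeredEdge_castSucc_ne_succ (j : Fin n) {h : ℕ} (hh : h ≤ n) :
    layeredEdge c (c j).castSucc h ≠ layeredEdge c (c j).succ h := fun h' =>
  (Fin.castSucc_lt_succ).ne (layeredEdge_injective c hh j.pos h')

section Sums

variable {M : Type*} [AddCommMonoid M] (f : (layeredGraph c).Edge → M)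

lemma sum_inEdges_inl (j : Fin n) : ∑ s ∈ (layeredGraph c).inEdges (Sum.inl j), f s =
    f (layeredEdge c (c j).castSucc j) + f (layeredEdge c (c j).succ j) := by
  rw [inEdges_layeredGraph_inl,
    Finset.sum_pair (layeredEdge_castSucc_ne_succ c j j.isLt.le)]

lemma sum_outEdges_inl (j : Fin n) : ∑ s ∈ (layeredGraph c).outEdges (Sum.inl j), f s =
    f (layeredEdge c (c j).castSucc (j + 1)) + f (layeredEdge c (c j).succ (j + 1)) := by
  rw [outEdges_layeredGraph_inl,
    Finset.sum_pair (layeredEdge_castSucc_ne_succ c j (Nat.succ_le_of_lt j.isLt))]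

lemma sum_inEdges_inr (q : {q : Fin n × Fin (m + 1) // ¬ Touches c q.2 q.1}) :
    ∑ s ∈ (layeredGraph c).inEdges (Sum.inr q), f s = f (layeredEdge c q.1.2 q.1.1) := by
  rw [inEdges_layeredGraph_inr, Finset.sum_singleton]

lemma sum_outEdges_inr (q : {q : Fin n × Fin (m + 1) // ¬ Touches c q.2 q.1}) :
    ∑ s ∈ (layeredGraph c).outEdges (Sum.inr q), f s = f (layeredEdge c q.1.2 (q.1.1 + 1)) := by
  rw [outEdges_layeredGraph_inr, Finset.sum_singleton]

end Sums

/-- The thin edge of the closed braid graph that contains an edge of the layered diagram, and the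
number of layers between their beginnings. -/
def ownPosition : (layeredGraph c).Edge → ClosedEdge c × ℤ
  | none => position c 0 0
  | some (j, p) => position c p (j + 1)

/-- The thin edge of the closed braid graph that contains an edge of the layered diagram. -/
def owner (s : (layeredGraph c).Edge) : (closedBraidGraph c).Edge := (ownPosition c s).1

/-- The number of layers between the beginning of a thin edge of the closed braid graph and an edge
of the layered diagram on it. -/
def offset (s : (layeredGraph c).Edge) : ℤ := (ownPosition c s).2

/-- `firstSegment` as a map between edge sets of graphs. -/
def first (e : (closedBraidGraph c).Edge) : (layeredGraph c).Edge := firstSegment c e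

variable {c}

lemma ownPosition_layeredEdge (ht : ∀ p, ∃ j, Touches c p j) (p : Fin (m + 1)) {h : ℕ}
    (hh : h ≤ n) : ownPosition c (layeredEdge c p h) = position c p h := by
  have hsucc : ∀ (p : Fin (m + 1)) (j : Fin n),
      ownPosition c (layeredEdge c p (j + 1)) = position c p (j + 1) := by
    intro p j
    rw [layeredEdge_succ]
    rfl
  cases h with
  | zero =>
    by_cases hp : p = 0
    · rw [hp, layeredEdge_zero_zero]
      rfl
    · obtain ⟨j, -⟩ := ht p
      rw [← layeredEdge_last c hp, ← position_last c (ht p) hp]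
      obtain ⟨k, rfl⟩ : ∃ k, n = k + 1 := ⟨n - 1, by have := j.pos; omega⟩
      exact hsucc p (Fin.last k)
  | succ h => exact hsucc p ⟨h, hh⟩

lemma first_strandEdge {p : Fin (m + 1)} {j : Fin n} (h : Touches c p j) :
    first c (strandEdge c p j) = layeredEdge c p (j + 1) := by
  rw [layeredEdge_succ, strandEdge]
  split_ifs with hp
  · rw [hp]; rfl
  · rw [h.resolve_left hp]; rfl

lemma exists_first_eq (ht : ∀ p, ∃ j, Touches c p j) (e : (closedBraidGraph c).Edge) :
    (e = ClosedEdge.bottom ∧ first c e = layeredEdge c 0 0) ∨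
      ∃ p j, Touches c p j ∧ e = strandEdge c p j ∧ first c e = layeredEdge c p (j + 1) := by
  have key : ∀ p j, Touches c p j → e = strandEdge c p j → e = strandEdge c p j ∧
      first c e = layeredEdge c p (j + 1) := fun p j h he => ⟨he, by rw [he, first_strandEdge h]⟩
  cases e with
  | bottom => exact Or.inl ⟨rfl, (layeredEdge_zero_zero c).symm⟩
  | left j =>
    exact Or.inr ⟨_, j, touches_castSucc j, key _ j (touches_castSucc j)
      (strandEdge_castSucc j).symm⟩
  | right j =>
    exact Or.inr ⟨_, j, touches_succ j, key _ j (touches_succ j) (strandEdge_succ j).symm⟩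
  | bivalentOut p => exact (isEmpty_crossingless ht).elim p

lemma ownPosition_first (ht : ∀ p, ∃ j, Touches c p j) (e : (closedBraidGraph c).Edge) :
    ownPosition c (first c e) = (e, 0) := by
  rcases exists_first_eq ht e with ⟨h1, h2⟩ | ⟨p, j, hj, h1, h2⟩
  · rw [h2, ownPosition_layeredEdge ht 0 (Nat.zero_le _), position_zero_zero, h1]
    rfl
  · rw [h2, ownPosition_layeredEdge ht p j.isLt, position_of_touches c hj, h1]
    rfl

lemma owner_first (ht : ∀ p, ∃ j, Touches c p j) (e : (closedBraidGraph c).Edge) :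
    owner c (first c e) = e := congrArg Prod.fst (ownPosition_first ht e)

lemma offset_first (ht : ∀ p, ∃ j, Touches c p j) (e : (closedBraidGraph c).Edge) :
    offset c (first c e) = 0 := congrArg Prod.snd (ownPosition_first ht e)

lemma owner_layeredEdge (ht : ∀ p, ∃ j, Touches c p j) (p : Fin (m + 1)) {h : ℕ} (hh : h ≤ n) :
    owner c (layeredEdge c p h) = (position c p h).1 :=
  congrArg Prod.fst (ownPosition_layeredEdge ht p hh)

lemma offset_layeredEdge (ht : ∀ p, ∃ j, Touches c p j) (p : Fin (m + 1)) {h : ℕ} (hh : h ≤ n) :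
    offset c (layeredEdge c p h) = (position c p h).2 :=
  congrArg Prod.snd (ownPosition_layeredEdge ht p hh)

lemma owner_succ_of_not_touches (ht : ∀ p, ∃ j, Touches c p j) {p : Fin (m + 1)} {j : Fin n}
    (h : ¬ Touches c p j) : owner c (layeredEdge c p (j + 1)) = owner c (layeredEdge c p j) := by
  rw [owner_layeredEdge ht p j.isLt, owner_layeredEdge ht p j.isLt.le, position_of_not_touches c h]

lemma offset_succ_of_not_touches (ht : ∀ p, ∃ j, Touches c p j) {p : Fin (m + 1)} {j : Fin n}
    (h : ¬ Touches c p j) :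
    offset c (layeredEdge c p (j + 1)) = offset c (layeredEdge c p j) + 1 := by
  rw [offset_layeredEdge ht p j.isLt, offset_layeredEdge ht p j.isLt.le,
    position_of_not_touches c h]

lemma offset_succ_of_touches (ht : ∀ p, ∃ j, Touches c p j) {p : Fin (m + 1)} {j : Fin n}
    (h : Touches c p j) : offset c (layeredEdge c p (j + 1)) = 0 := by
  rw [offset_layeredEdge ht p j.isLt, position_of_touches c h]

lemma framing_owner (ht : ∀ p, ∃ j, Touches c p j) {p : Fin (m + 1)} {j : Fin n}
    (h : Touches c p j) : (closedBraidGraph c).framing (owner c (layeredEdge c p j)) =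
      offset c (layeredEdge c p j) + 1 := by
  rw [offset_layeredEdge ht p j.isLt.le, owner_layeredEdge ht p j.isLt.le, framing_position ht h]

lemma sum_closed_inEdges (ht : ∀ p, ∃ j, Touches c p j) {M : Type*} [AddCommMonoid M]
    (j : Fin n) (f : (closedBraidGraph c).Edge → M) :
    ∑ e ∈ (closedBraidGraph c).inEdges (Sum.inl j), f e =
      f (owner c (layeredEdge c (c j).castSucc j)) + f (owner c (layeredEdge c (c j).succ j)) := by
  rw [owner_layeredEdge ht _ j.isLt.le, owner_layeredEdge ht _ j.isLt.le]
  exact sum_inEdges_closedBraidGraph ht j f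

lemma sum_closed_outEdges (ht : ∀ p, ∃ j, Touches c p j) {M : Type*} [AddCommMonoid M]
    (j : Fin n) (f : (closedBraidGraph c).Edge → M) :
    ∑ e ∈ (closedBraidGraph c).outEdges (Sum.inl j), f e =
      f (owner c (layeredEdge c (c j).castSucc (j + 1))) +
        f (owner c (layeredEdge c (c j).succ (j + 1))) := by
  rw [owner_layeredEdge ht _ j.isLt, owner_layeredEdge ht _ j.isLt,
    position_of_touches c (touches_castSucc j), position_of_touches c (touches_succ j),
    strandEdge_castSucc, strandEdge_succ]
  exact sum_outEdges_closedBraidGraph j f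

/-- The thick edges in a set of vertices of the layered diagram. -/
def thickPart (γ : Finset (layeredGraph c).Node) : Finset (closedBraidGraph c).Node :=
  γ.toLeft.disjSum ∅

lemma sum_thickPart {M : Type*} [AddCommMonoid M] (γ : Finset (layeredGraph c).Node)
    (f : (closedBraidGraph c).Node → M) :
    ∑ v ∈ thickPart γ, f v = ∑ j ∈ γ.toLeft, f (Sum.inl j) := by
  refine (Finset.sum_disjSum (γ.toLeft : Finset (Fin n)) (∅ : Finset (Crossingless c)) f).trans ?_
  rw [Finset.sum_empty, add_zero]
  rfl

lemma sum_layered {M : Type*} [AddCommMonoid M] (γ : Finset (layeredGraph c).Node)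
    (f : (layeredGraph c).Node → M) :
    ∑ v ∈ γ, f v = ∑ j ∈ γ.toLeft, f (Sum.inl j) + ∑ q ∈ γ.toRight, f (Sum.inr q) := by
  conv_lhs => rw [← Finset.toLeft_disjSum_toRight (u := γ)]
  rw [Finset.sum_disjSum]

/-- At a bivalent vertex the offset grows by `1`, which cancels the weight `1`. At a thick edge it
drops to `0` from the framing minus `1` on both strands, so the weight `2` is completed to the sum
of the two framings. -/
lemma vertexWeight_sub (ht : ∀ p, ∃ j, Touches c p j) (γ : Finset (layeredGraph c).Node) :
    vertexWeight (layeredGraph c) γ - ∑ v ∈ γ, (∑ s ∈ (layeredGraph c).outEdges v, offset c s -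
      ∑ s ∈ (layeredGraph c).inEdges v, offset c s) = ∑ v ∈ thickPart γ,
        ∑ e ∈ (closedBraidGraph c).inEdges v, (closedBraidGraph c).framing e := by
  rw [vertexWeight, ← Finset.sum_sub_distrib, sum_layered, sum_thickPart]
  have h1 : ∀ j : Fin n, (2 : ℤ) - (∑ s ∈ (layeredGraph c).outEdges (Sum.inl j), offset c s -
      ∑ s ∈ (layeredGraph c).inEdges (Sum.inl j), offset c s) =
      ∑ e ∈ (closedBraidGraph c).inEdges (Sum.inl j), (closedBraidGraph c).framing e := by
    intro j
    rw [sum_closed_inEdges ht, framing_owner ht (touches_castSucc j),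
      framing_owner ht (touches_succ j), sum_outEdges_inl, sum_inEdges_inl,
      offset_succ_of_touches ht (touches_castSucc j), offset_succ_of_touches ht (touches_succ j)]
    ring
  have h2 : ∀ q : {q : Fin n × Fin (m + 1) // ¬ Touches c q.2 q.1},
      (1 : ℤ) - (∑ s ∈ (layeredGraph c).outEdges (Sum.inr q), offset c s -
      ∑ s ∈ (layeredGraph c).inEdges (Sum.inr q), offset c s) = 0 := by
    intro q
    rw [sum_outEdges_inr, sum_inEdges_inr, offset_succ_of_not_touches ht q.2]
    ring
  refine (congrArg₂ (· + ·) (Finset.sum_congr rfl fun j _ => h1 j)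
    ((Finset.sum_congr rfl fun q _ => h2 q).trans Finset.sum_const_zero)).trans (add_zero _)

/-- A bivalent vertex lies in the interior of one thin edge, so its two contributions cancel; only
thick edges remain. -/
lemma sum_owner (ht : ∀ p, ∃ j, Touches c p j) {M : Type*} [AddCommGroup M]
    (γ : Finset (layeredGraph c).Node) (f : (closedBraidGraph c).Edge → M) :
    ∑ v ∈ γ, (∑ s ∈ (layeredGraph c).outEdges v, f (owner c s) -
      ∑ s ∈ (layeredGraph c).inEdges v, f (owner c s)) =
    ∑ v ∈ thickPart γ, (∑ e ∈ (closedBraidGraph c).outEdges v, f e -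
      ∑ e ∈ (closedBraidGraph c).inEdges v, f e) := by
  rw [sum_layered, sum_thickPart]
  have h2 : ∀ q : {q : Fin n × Fin (m + 1) // ¬ Touches c q.2 q.1},
      (∑ s ∈ (layeredGraph c).outEdges (Sum.inr q), f (owner c s) -
      ∑ s ∈ (layeredGraph c).inEdges (Sum.inr q), f (owner c s)) = 0 := by
    intro q
    rw [sum_outEdges_inr, sum_inEdges_inr, owner_succ_of_not_touches ht q.2, sub_self]
  have h1 : ∀ j : Fin n, (∑ s ∈ (layeredGraph c).outEdges (Sum.inl j), f (owner c s) -
      ∑ s ∈ (layeredGraph c).inEdges (Sum.inl j), f (owner c s)) =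
      ∑ e ∈ (closedBraidGraph c).outEdges (Sum.inl j), f e -
        ∑ e ∈ (closedBraidGraph c).inEdges (Sum.inl j), f e := by
    intro j
    rw [sum_closed_inEdges ht, sum_closed_outEdges ht, sum_outEdges_inl, sum_inEdges_inl]
  exact (congrArg₂ (· + ·) (Finset.sum_congr rfl fun j _ => h1 j)
    ((Finset.sum_congr rfl fun q _ => h2 q).trans Finset.sum_const_zero)).trans (add_zero _)

end Layered

end BraidGraph

namespace BraidGraph

open MvPolynomial

/-! ### From the layered relations to the relations of the edge ring -/

section Comparison

variable (𝕜 : Type u) [Field 𝕜] {m n : ℕ} (c : Fin n → Fin m)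

/-- The ideal of relations of `A(G)`. -/
def altIdeal : Ideal (ThinRing 𝕜 (layeredGraph c)) :=
  twistedLinearIdeal 𝕜 (layeredGraph c) ⊔ twistedQuadraticIdeal 𝕜 (layeredGraph c) ⊔
    twistedNonlocalIdeal 𝕜 (layeredGraph c)

/-- The map from the ring of the layered diagram to the edge ring that moves every variable to the
beginning of the thin edge of the closed braid graph. -/
def layeredToEdgeRing : ThinRing 𝕜 (layeredGraph c) →ₐ[LaurentSeries 𝕜]
    EdgeRing 𝕜 (closedBraidGraph c) :=
  aeval fun s => C (tPow 𝕜 (-offset c s)) * X (owner c s)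

/-- The inclusion of the edge ring in the ring of the layered diagram. -/
def edgeToLayeredRing : EdgeRing 𝕜 (closedBraidGraph c) →ₐ[LaurentSeries 𝕜]
    ThinRing 𝕜 (layeredGraph c) :=
  rename (first c)

lemma layeredToEdgeRing_X (s : (layeredGraph c).Edge) :
    layeredToEdgeRing 𝕜 c (X s) = C (tPow 𝕜 (-offset c s)) * X (owner c s) := by
  rw [layeredToEdgeRing, aeval_X]

lemma edgeToLayeredRing_X (e : (closedBraidGraph c).Edge) :
    edgeToLayeredRing 𝕜 c (X e) = X (first c e) := by
  rw [edgeToLayeredRing, rename_X]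

variable {c}

lemma layeredToEdgeRing_edgeToLayeredRing (ht : ∀ p, ∃ j, Touches c p j)
    (f : EdgeRing 𝕜 (closedBraidGraph c)) :
    layeredToEdgeRing 𝕜 c (edgeToLayeredRing 𝕜 c f) = f := by
  have : (layeredToEdgeRing 𝕜 c).comp (edgeToLayeredRing 𝕜 c) = AlgHom.id _ _ := by
    apply MvPolynomial.algHom_ext
    intro e
    rw [AlgHom.comp_apply, edgeToLayeredRing_X, layeredToEdgeRing_X, offset_first ht,
      owner_first ht, neg_zero, tPow_zero, C_1, one_mul, AlgHom.id_apply]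
  exact DFunLike.congr_fun this f

lemma layeredToEdgeRing_prod (A : Finset (layeredGraph c).Edge) :
    layeredToEdgeRing 𝕜 c (∏ s ∈ A, X s) =
      monomial (∑ s ∈ A, Finsupp.single (owner c s) 1) (tPow 𝕜 (-∑ s ∈ A, offset c s)) := by
  rw [map_prod, ← Finset.sum_neg_distrib, tPow_sum]
  simp only [layeredToEdgeRing_X]
  rw [Finset.prod_mul_distrib, ← map_prod, ← Finset.prod_congr rfl fun s _ => rfl]
  rw [← mul_one (∏ s ∈ A, tPow 𝕜 (-offset c s)), ← C_mul_monomial, mul_one,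
    monomial_sum_one]
  rfl

/-- Written for arbitrary edge sets `A` and `B` with the boundary of `γ`, this covers the quadratic,
bivalent and non-local relations alike. The exponents match by `sum_owner` and the powers of `t` by
`vertexWeight_sub`. -/
lemma layeredToEdgeRing_mem (ht : ∀ p, ∃ j, Touches c p j) (γ : Finset (layeredGraph c).Node)
    {A B : Finset (layeredGraph c).Edge} (h : ∀ g : (layeredGraph c).Edge → ℤ,
      ∑ s ∈ A, g s - ∑ s ∈ B, g s = ∑ v ∈ γ, (∑ s ∈ (layeredGraph c).outEdges v, g s -
        ∑ s ∈ (layeredGraph c).inEdges v, g s)) :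
    layeredToEdgeRing 𝕜 c (C (tPow 𝕜 (vertexWeight (layeredGraph c) γ)) * ∏ s ∈ A, X s -
      ∏ s ∈ B, X s) ∈ edgeNonlocalIdeal 𝕜 (closedBraidGraph c) := by
  rw [map_sub, map_mul, algHom_C, algebraMap_eq, layeredToEdgeRing_prod, layeredToEdgeRing_prod,
    C_mul_monomial, ← tPow_add]
  refine monomial_sub_monomial_mem 𝕜 _ (thickPart γ) ?_ ?_
  · intro e
    rw [← sum_owner ht γ fun f => if f = e then (1 : ℤ) else 0,
      ← h fun s => if owner c s = e then 1 else 0, Finsupp.finsetSum_apply,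
      Finsupp.finsetSum_apply]
    simp only [Finsupp.single_apply]
    push_cast
    rfl
  · rw [← vertexWeight_sub ht γ, ← h]
    ring

lemma vertexWeight_singleton (G : ThinGraph) (v : G.Node) :
    vertexWeight G {v} = Sum.elim (fun _ => 2) (fun _ => 1) v := by
  rw [vertexWeight, Finset.sum_singleton]

/-- The framing of an incoming edge exceeds the offset of its last segment by one, and the factor
`t` makes up for this. -/
lemma layeredToEdgeRing_linear (ht : ∀ p, ∃ j, Touches c p j) (j : Fin n) :
    layeredToEdgeRing 𝕜 c (C (tPow 𝕜 1) * ∑ s ∈ (layeredGraph c).outEdges (Sum.inl j), X s -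
      ∑ s ∈ (layeredGraph c).inEdges (Sum.inl j), X s) = C (tPow 𝕜 1) *
      (∑ e ∈ (closedBraidGraph c).outEdges (Sum.inl j), (X e : EdgeRing 𝕜 (closedBraidGraph c)) -
        ∑ e ∈ (closedBraidGraph c).inEdges (Sum.inl j),
          C (tPow 𝕜 (-(closedBraidGraph c).framing e)) * X e) := by
  have h : ∀ a : ℤ, tPow 𝕜 1 * tPow 𝕜 (-(a + 1)) = tPow 𝕜 (-a) := fun a => by
    rw [← tPow_add]
    congr 1
    ring
  rw [sum_closed_inEdges ht j, sum_closed_outEdges ht j, sum_outEdges_inl, sum_inEdges_inl,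
    map_sub, map_mul, algHom_C, algebraMap_eq, map_add, map_add, layeredToEdgeRing_X,
    layeredToEdgeRing_X, layeredToEdgeRing_X, layeredToEdgeRing_X,
    framing_owner ht (touches_castSucc j), framing_owner ht (touches_succ j),
    offset_succ_of_touches ht (touches_castSucc j), offset_succ_of_touches ht (touches_succ j),
    neg_zero, tPow_zero, C_1, one_mul, one_mul, mul_sub, mul_add (C (tPow 𝕜 1)) (C _ * _),
    ← mul_assoc, ← mul_assoc, ← C_mul, ← C_mul, h, h]

lemma altIdeal_le_comap (ht : ∀ p, ∃ j, Touches c p j) : altIdeal 𝕜 c ≤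
    (edgeLinearIdeal 𝕜 (closedBraidGraph c) ⊔ edgeNonlocalIdeal 𝕜 (closedBraidGraph c)).comap
      (layeredToEdgeRing 𝕜 c) := by
  have hN : ∀ f, layeredToEdgeRing 𝕜 c f ∈ edgeNonlocalIdeal 𝕜 (closedBraidGraph c) →
      f ∈ (edgeLinearIdeal 𝕜 (closedBraidGraph c) ⊔
        edgeNonlocalIdeal 𝕜 (closedBraidGraph c)).comap (layeredToEdgeRing 𝕜 c) :=
    fun f hf => Ideal.mem_comap.2 (Ideal.mem_sup_right hf)
  -- The relations at a single vertex use all its incident edges. They can differ from the cut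
  -- relation of the singleton when an edge is a loop, but have the same boundary.
  have hvertex : ∀ v : (layeredGraph c).Node, ∀ g : (layeredGraph c).Edge → ℤ,
      ∑ s ∈ (layeredGraph c).outEdges v, g s - ∑ s ∈ (layeredGraph c).inEdges v, g s =
      ∑ v ∈ {v}, (∑ s ∈ (layeredGraph c).outEdges v, g s -
        ∑ s ∈ (layeredGraph c).inEdges v, g s) := fun v g => by rw [Finset.sum_singleton]
  refine sup_le (sup_le ?_ (sup_le ?_ ?_)) ?_
  · rw [twistedLinearIdeal, Ideal.span_le]
    rintro _ ⟨j, rfl⟩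
    refine Ideal.mem_comap.2 (Ideal.mem_sup_left ?_)
    have hgen : ∑ e ∈ (closedBraidGraph c).outEdges (Sum.inl j),
        (X e : EdgeRing 𝕜 (closedBraidGraph c)) - ∑ e ∈ (closedBraidGraph c).inEdges (Sum.inl j),
          C (tPow 𝕜 (-(closedBraidGraph c).framing e)) * X e ∈
        edgeLinearIdeal 𝕜 (closedBraidGraph c) := by
      rw [edgeLinearIdeal_eq]
      exact Ideal.subset_span ⟨j, rfl⟩
    have hmul := Ideal.mul_mem_left _ (C (tPow 𝕜 1)) hgen
    exact (congrArg (· ∈ edgeLinearIdeal 𝕜 (closedBraidGraph c))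
      (layeredToEdgeRing_linear 𝕜 ht j)).mpr hmul
  · rw [Ideal.span_le]
    rintro _ ⟨j, rfl⟩
    refine hN _ ?_
    have := layeredToEdgeRing_mem 𝕜 ht {Sum.inl j} (hvertex (Sum.inl j))
    rwa [vertexWeight_singleton] at this
  · rw [Ideal.span_le]
    rintro _ ⟨q, rfl⟩
    refine hN _ ?_
    have := layeredToEdgeRing_mem 𝕜 ht {Sum.inr q} (hvertex (Sum.inr q))
    rwa [vertexWeight_singleton] at this
  · rw [twistedNonlocalIdeal, Ideal.span_le]
    rintro _ ⟨γ, rfl⟩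
    exact hN _ (layeredToEdgeRing_mem 𝕜 ht γ fun g =>
      (layeredGraph c).sum_cutOut_sub_sum_cutIn γ g)

end Comparison

/-! ### Refining cuts of the closed braid graph to cuts of the layered diagram -/

section Refinement

namespace ThinGraph

variable {G : ThinGraph} {γ : Finset G.Node} {e : G.Edge}

lemma ends_of_tgt_eq_some {v : G.Node} (h : G.tgt e = some v) : G.Ends γ e ↔ v ∈ γ := by
  constructor
  · rintro ⟨w, hw, h'⟩
    rw [h] at h'
    cases h'
    exact hw
  · exact fun hv => ⟨v, hv, h⟩

lemma not_ends_of_tgt_eq_none (h : G.tgt e = none) : ¬ G.Ends γ e := by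
  rintro ⟨w, -, h'⟩
  rw [h] at h'
  cases h'

lemma starts_of_src_eq_some {v : G.Node} (h : G.src e = some v) : G.Starts γ e ↔ v ∈ γ := by
  constructor
  · rintro ⟨w, hw, h'⟩
    rw [h] at h'
    cases h'
    exact hw
  · exact fun hv => ⟨v, hv, h⟩

lemma not_starts_of_src_eq_none (h : G.src e = none) : ¬ G.Starts γ e := by
  rintro ⟨w, -, h'⟩
  rw [h] at h'
  cases h'

end ThinGraph

variable {m n : ℕ} {c : Fin n → Fin m} (γ : Finset (closedBraidGraph c).Node)

open Classical in
/-- The vertices of the layered diagram on the thin edges that end in a set of vertices of the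
closed braid graph, including these ends. -/
def refinement : Finset (layeredGraph c).Node :=
  Finset.univ.filter fun u => ∃ (p : Fin (m + 1)) (j : Fin n), layeredNode c j p = u ∧
    (closedBraidGraph c).Ends γ (owner c (layeredEdge c p j))

lemma ends_owner_of_touches (ht : ∀ p, ∃ j, Touches c p j) {p : Fin (m + 1)} {j : Fin n}
    (h : Touches c p j) :
    (closedBraidGraph c).Ends γ (owner c (layeredEdge c p j)) ↔ Sum.inl j ∈ γ := by
  rw [owner_layeredEdge ht p j.isLt.le]
  exact ThinGraph.ends_of_tgt_eq_some (tgt_position ht h)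

lemma layeredNode_mem_refinement (ht : ∀ p, ∃ j, Touches c p j) (p : Fin (m + 1)) (j : Fin n) :
    layeredNode c j p ∈ refinement γ ↔
      (closedBraidGraph c).Ends γ (owner c (layeredEdge c p j)) := by
  refine (@Finset.mem_filter _ _ (_) _ _).trans ?_
  constructor
  · rintro ⟨-, q, k, h1, h2⟩
    by_cases hj : Touches c p j
    · rw [layeredNode_of_touches c hj] at h1
      obtain ⟨rfl, h3⟩ := layeredNode_eq_inl c h1
      rw [ends_owner_of_touches γ ht h3] at h2
      rwa [ends_owner_of_touches γ ht hj]
    · rw [layeredNode_of_not_touches c hj] at h1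
      obtain ⟨rfl, rfl⟩ := layeredNode_eq_inr c h1
      exact h2
  · exact fun h => ⟨Finset.mem_univ _, p, j, rfl, h⟩

/-- The refinement contains all vertices along a thin edge, its end included, or none of the
bivalent ones and not its end; which of the two depends on the end alone. -/
lemma ends_refinement (ht : ∀ p, ∃ j, Touches c p j) (s : (layeredGraph c).Edge) :
    (layeredGraph c).Ends (refinement γ) s ↔ (closedBraidGraph c).Ends γ (owner c s) := by
  have key : ∀ p (j : Fin n), (layeredGraph c).Ends (refinement γ) (layeredEdge c p j) ↔
      (closedBraidGraph c).Ends γ (owner c (layeredEdge c p j)) := fun p j =>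
    (ThinGraph.ends_of_tgt_eq_some (tgt_layeredEdge c p j)).trans
      (layeredNode_mem_refinement γ ht p j)
  obtain ⟨p, h, hh, rfl⟩ := exists_eq_layeredEdge c s
  rcases hh.lt_or_eq with hh | rfl
  · exact key p ⟨h, hh⟩
  · by_cases hp : p = 0
    · subst hp
      refine iff_of_false (ThinGraph.not_ends_of_tgt_eq_none (tgt_layeredEdge_last c)) ?_
      refine ThinGraph.not_ends_of_tgt_eq_none ?_
      rw [owner_layeredEdge ht 0 le_rfl]
      have := congrArg Prod.fst (tgtAndFraming_position ht 0 h le_rfl)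
      rwa [climb_zero_last] at this
    · obtain ⟨j, -⟩ := ht p
      rw [layeredEdge_last c hp]
      exact key p ⟨0, j.pos⟩

lemma starts_refinement (ht : ∀ p, ∃ j, Touches c p j) (p : Fin (m + 1)) (j : Fin n) :
    (layeredGraph c).Starts (refinement γ) (layeredEdge c p (j + 1)) ↔
      (closedBraidGraph c).Ends γ (owner c (layeredEdge c p j)) :=
  (ThinGraph.starts_of_src_eq_some (src_layeredEdge c p j)).trans
    (layeredNode_mem_refinement γ ht p j)

lemma starts_refinement_first (ht : ∀ p, ∃ j, Touches c p j) (e : (closedBraidGraph c).Edge) :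
    (layeredGraph c).Starts (refinement γ) (first c e) ↔ (closedBraidGraph c).Starts γ e := by
  rcases exists_first_eq ht e with ⟨h1, h2⟩ | ⟨p, j, hj, h1, h2⟩
  · rw [h2]
    exact iff_of_false (ThinGraph.not_starts_of_src_eq_none (src_layeredEdge_zero_zero c))
      (ThinGraph.not_starts_of_src_eq_none ((src_eq_none_iff e).2 h1))
  · rw [h2, starts_refinement γ ht, ends_owner_of_touches γ ht hj]
    refine (ThinGraph.starts_of_src_eq_some ?_).symm
    rw [h1]
    exact src_strandEdge p j

/-- Such a segment begins at a bivalent vertex inside its thin edge. Hence the cuts of a refinement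
meet thin edges only in their first segments. -/
lemma starts_iff_ends_of_not_first (ht : ∀ p, ∃ j, Touches c p j) {s : (layeredGraph c).Edge}
    (hs : ∀ e, first c e ≠ s) :
    (layeredGraph c).Starts (refinement γ) s ↔ (layeredGraph c).Ends (refinement γ) s := by
  cases s with
  | none => exact absurd rfl (hs ClosedEdge.bottom)
  | some x =>
    have h1 := layeredEdge_succ c x.2 x.1
    by_cases hx : Touches c x.2 x.1
    · exact absurd ((first_strandEdge hx).trans h1) (hs _)
    · have h2 := starts_refinement γ ht x.2 x.1
      rw [← owner_succ_of_not_touches ht hx, ← ends_refinement γ ht, h1] at h2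
      exact h2

lemma first_injective (ht : ∀ p, ∃ j, Touches c p j) : Function.Injective (first c) :=
  Function.LeftInverse.injective (owner_first ht)

lemma cutOut_refinement (ht : ∀ p, ∃ j, Touches c p j) :
    (layeredGraph c).cutOut (refinement γ) =
      ((closedBraidGraph c).cutOut γ).map ⟨first c, first_injective ht⟩ := by
  ext s
  rw [ThinGraph.mem_cutOut, Finset.mem_map]
  constructor
  · rintro ⟨h1, h2⟩
    by_cases hs : ∀ e, first c e ≠ s
    · exact absurd ((starts_iff_ends_of_not_first γ ht hs).1 h1) h2
    · push Not at hs
      obtain ⟨e, rfl⟩ := hs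
      refine ⟨e, (ThinGraph.mem_cutOut _).2 ⟨(starts_refinement_first γ ht e).1 h1, ?_⟩, rfl⟩
      rwa [ends_refinement γ ht, owner_first ht] at h2
  · rintro ⟨e, he, rfl⟩
    obtain ⟨h1, h2⟩ := (ThinGraph.mem_cutOut _).1 he
    refine ⟨(starts_refinement_first γ ht e).2 h1, ?_⟩
    change ¬ (layeredGraph c).Ends _ (first c e)
    rwa [ends_refinement γ ht, owner_first ht]

lemma cutIn_refinement (ht : ∀ p, ∃ j, Touches c p j) :
    (layeredGraph c).cutIn (refinement γ) =
      ((closedBraidGraph c).cutIn γ).map ⟨first c, first_injective ht⟩ := by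
  ext s
  rw [ThinGraph.mem_cutIn, Finset.mem_map]
  constructor
  · rintro ⟨h1, h2⟩
    by_cases hs : ∀ e, first c e ≠ s
    · exact absurd ((starts_iff_ends_of_not_first γ ht hs).2 h2) h1
    · push Not at hs
      obtain ⟨e, rfl⟩ := hs
      refine ⟨e, (ThinGraph.mem_cutIn _).2 ⟨mt (starts_refinement_first γ ht e).2 h1, ?_⟩, rfl⟩
      rwa [ends_refinement γ ht, owner_first ht] at h2
  · rintro ⟨e, he, rfl⟩
    obtain ⟨h1, h2⟩ := (ThinGraph.mem_cutIn _).1 he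
    refine ⟨mt (starts_refinement_first γ ht e).1 h1, ?_⟩
    change (layeredGraph c).Ends _ (first c e)
    rwa [ends_refinement γ ht, owner_first ht]

lemma thickPart_refinement (ht : ∀ p, ∃ j, Touches c p j) : thickPart (refinement γ) = γ := by
  have h1 : ∀ j : Fin n, (Sum.inl j : (layeredGraph c).Node) ∈ refinement γ ↔
      (Sum.inl j : (closedBraidGraph c).Node) ∈ γ := fun j => by
    have h := layeredNode_mem_refinement γ ht (c j).castSucc j
    rw [layeredNode_of_touches c (touches_castSucc j)] at h
    exact h.trans (ends_owner_of_touches γ ht (touches_castSucc j))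
  refine Finset.ext fun v => ?_
  obtain ⟨j, rfl⟩ := exists_eq_inl ht v
  exact (Finset.inl_mem_disjSum.trans Finset.mem_toLeft).trans (h1 j)

/-- First segments have offset zero, so the correction terms of `vertexWeight_sub` vanish for a
refined cut. -/
lemma vertexWeight_refinement (ht : ∀ p, ∃ j, Touches c p j) :
    vertexWeight (layeredGraph c) (refinement γ) = ∑ v ∈ γ,
      ∑ e ∈ (closedBraidGraph c).inEdges v, (closedBraidGraph c).framing e := by
  have hz : ∀ A : Finset (closedBraidGraph c).Edge,
      ∑ s ∈ A.map ⟨first c, first_injective ht⟩, offset c s = 0 := fun A => by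
    rw [Finset.sum_map]
    exact Finset.sum_eq_zero fun e _ => offset_first ht e
  have h := vertexWeight_sub ht (refinement γ)
  rw [← ThinGraph.sum_cutOut_sub_sum_cutIn, cutOut_refinement γ ht, cutIn_refinement γ ht,
    hz, hz, thickPart_refinement γ ht, sub_zero, sub_zero] at h
  exact h

end Refinement

/-! ### Identification of `A(G)` with a quotient of the edge ring -/

section Kernel

variable (𝕜 : Type u) [Field 𝕜] {m n : ℕ} {c : Fin n → Fin m}

lemma linear_mem_altIdeal (j : Fin n) : C (tPow 𝕜 1) *
    ((X (layeredEdge c (c j).castSucc (j + 1)) + X (layeredEdge c (c j).succ (j + 1)) :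
      ThinRing 𝕜 (layeredGraph c))) -
    (X (layeredEdge c (c j).castSucc j) + X (layeredEdge c (c j).succ j)) ∈ altIdeal 𝕜 c := by
  have h : C (tPow 𝕜 1) * ∑ s ∈ (layeredGraph c).outEdges (Sum.inl j), thinVar 𝕜 s -
      ∑ s ∈ (layeredGraph c).inEdges (Sum.inl j), thinVar 𝕜 s ∈ altIdeal 𝕜 c :=
    Ideal.mem_sup_left (Ideal.mem_sup_left (Ideal.subset_span ⟨j, rfl⟩))
  rwa [sum_outEdges_inl, sum_inEdges_inl] at h

lemma quadratic_mem_altIdeal (j : Fin n) : C (tPow 𝕜 2) *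
    ((X (layeredEdge c (c j).castSucc (j + 1)) * X (layeredEdge c (c j).succ (j + 1)) :
      ThinRing 𝕜 (layeredGraph c))) -
    (X (layeredEdge c (c j).castSucc j) * X (layeredEdge c (c j).succ j)) ∈ altIdeal 𝕜 c := by
  have h : C (tPow 𝕜 2) * ∏ s ∈ (layeredGraph c).outEdges (Sum.inl j), thinVar 𝕜 s -
      ∏ s ∈ (layeredGraph c).inEdges (Sum.inl j), thinVar 𝕜 s ∈ altIdeal 𝕜 c :=
    Ideal.mem_sup_left (Ideal.mem_sup_right (Ideal.mem_sup_left (Ideal.subset_span ⟨j, rfl⟩)))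
  rwa [outEdges_layeredGraph_inl, inEdges_layeredGraph_inl,
    Finset.prod_pair (layeredEdge_castSucc_ne_succ c j (Nat.succ_le_of_lt j.isLt)),
    Finset.prod_pair (layeredEdge_castSucc_ne_succ c j j.isLt.le)] at h

lemma bivalent_mem_altIdeal {p : Fin (m + 1)} {j : Fin n} (hj : ¬ Touches c p j) :
    (C (tPow 𝕜 1) * X (layeredEdge c p (j + 1)) - X (layeredEdge c p j) :
      ThinRing 𝕜 (layeredGraph c)) ∈ altIdeal 𝕜 c := by
  have h : C (tPow 𝕜 1) * ∏ s ∈ (layeredGraph c).outEdges (Sum.inr ⟨(j, p), hj⟩), thinVar 𝕜 s -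
      ∏ s ∈ (layeredGraph c).inEdges (Sum.inr ⟨(j, p), hj⟩), thinVar 𝕜 s ∈ altIdeal 𝕜 c :=
    Ideal.mem_sup_left (Ideal.mem_sup_right (Ideal.mem_sup_right (Ideal.subset_span ⟨_, rfl⟩)))
  rwa [outEdges_layeredGraph_inr, inEdges_layeredGraph_inr, Finset.prod_singleton,
    Finset.prod_singleton] at h

lemma nonlocal_mem_altIdeal (γ : Finset (layeredGraph c).Node) :
    C (tPow 𝕜 (vertexWeight (layeredGraph c) γ)) * ∏ s ∈ (layeredGraph c).cutOut γ,
      (X s : ThinRing 𝕜 (layeredGraph c)) - ∏ s ∈ (layeredGraph c).cutIn γ, X s ∈ altIdeal 𝕜 c :=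
  Ideal.mem_sup_right (Ideal.subset_span ⟨γ, rfl⟩)

/-- Climbing a thin edge from its first segment, each bivalent relation contributes one factor
`t^(-1)`; the offset counts them. -/
lemma X_sub_mem_altIdeal (ht : ∀ p, ∃ j, Touches c p j) (s : (layeredGraph c).Edge) :
    (X s - C (tPow 𝕜 (-offset c s)) * X (first c (owner c s)) : ThinRing 𝕜 (layeredGraph c)) ∈
      altIdeal 𝕜 c := by
  obtain ⟨p, h, hh, rfl⟩ := exists_eq_layeredEdge c s
  rw [← Ideal.Quotient.eq]
  have key : ∀ e s, first c e = s → Ideal.Quotient.mk (altIdeal 𝕜 c) (X s) =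
      Ideal.Quotient.mk (altIdeal 𝕜 c) (C (tPow 𝕜 (-offset c s)) * X (first c (owner c s))) := by
    rintro e s rfl
    rw [owner_first ht, offset_first ht, neg_zero, tPow_zero, C_1, one_mul]
  refine climb_induction ht (P := fun p h => Ideal.Quotient.mk (altIdeal 𝕜 c)
    (X (layeredEdge c p h)) = Ideal.Quotient.mk (altIdeal 𝕜 c)
      (C (tPow 𝕜 (-offset c (layeredEdge c p h))) * X (first c (owner c (layeredEdge c p h)))))
    ?_ ?_ ?_ ?_ p h hh
  · exact key ClosedEdge.bottom _ (layeredEdge_zero_zero c).symm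
  · exact fun p j hj => key _ _ (first_strandEdge hj)
  · intro p j hj ih
    rw [← Ideal.Quotient.eq.2 (bivalent_mem_altIdeal 𝕜 hj)] at ih
    rw [owner_succ_of_not_touches ht hj, offset_succ_of_not_touches ht hj]
    have h1 := congrArg (fun x => Ideal.Quotient.mk (altIdeal 𝕜 c) (C (tPow 𝕜 (-1))) * x) ih
    simp only [← map_mul, ← mul_assoc, ← tPow_add] at h1
    rw [neg_add_cancel, tPow_zero, C_1, one_mul] at h1
    rw [h1, neg_add_rev]
  · intro p hp ih
    rwa [layeredEdge_last c hp] at ih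

lemma mk_edgeToLayeredRing_layeredToEdgeRing (ht : ∀ p, ∃ j, Touches c p j)
    (f : ThinRing 𝕜 (layeredGraph c)) :
    Ideal.Quotient.mk (altIdeal 𝕜 c) (edgeToLayeredRing 𝕜 c (layeredToEdgeRing 𝕜 c f)) =
      Ideal.Quotient.mk (altIdeal 𝕜 c) f := by
  have : (Ideal.Quotient.mkₐ (LaurentSeries 𝕜) (altIdeal 𝕜 c)).comp
      ((edgeToLayeredRing 𝕜 c).comp (layeredToEdgeRing 𝕜 c)) =
      Ideal.Quotient.mkₐ (LaurentSeries 𝕜) (altIdeal 𝕜 c) := by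
    apply MvPolynomial.algHom_ext
    intro s
    rw [AlgHom.comp_apply, AlgHom.comp_apply, layeredToEdgeRing_X, map_mul, algHom_C,
      algebraMap_eq, edgeToLayeredRing_X]
    exact (Ideal.Quotient.eq.2 (X_sub_mem_altIdeal 𝕜 ht s)).symm
  exact DFunLike.congr_fun this f

lemma edgeToLayeredRing_prod (ht : ∀ p, ∃ j, Touches c p j)
    (A : Finset (closedBraidGraph c).Edge) :
    edgeToLayeredRing 𝕜 c (∏ e ∈ A, X e) =
      ∏ s ∈ A.map ⟨first c, first_injective ht⟩, X s := by
  rw [map_prod, Finset.prod_map]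
  exact Finset.prod_congr rfl fun e _ => edgeToLayeredRing_X 𝕜 c e

/-- A linear generator is, up to the unit `t`, the image of a layered one. A non-local generator is
the layered relation of the refined cut. -/
lemma le_comap_altIdeal (ht : ∀ p, ∃ j, Touches c p j) :
    edgeLinearIdeal 𝕜 (closedBraidGraph c) ⊔ edgeNonlocalIdeal 𝕜 (closedBraidGraph c) ≤
      (altIdeal 𝕜 c).comap (edgeToLayeredRing 𝕜 c) := by
  refine sup_le ?_ ?_
  · rw [edgeLinearIdeal_eq, Ideal.span_le]
    rintro _ ⟨j, rfl⟩
    have h1 := congrArg (fun f => Ideal.Quotient.mk (altIdeal 𝕜 c) (edgeToLayeredRing 𝕜 c f))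
      (layeredToEdgeRing_linear 𝕜 ht j)
    have h2 : Ideal.Quotient.mk (altIdeal 𝕜 c) (C (tPow 𝕜 1) *
        ∑ s ∈ (layeredGraph c).outEdges (Sum.inl j), X s -
        ∑ s ∈ (layeredGraph c).inEdges (Sum.inl j), X s) = 0 :=
      Ideal.Quotient.eq_zero_iff_mem.2
        (Ideal.mem_sup_left (Ideal.mem_sup_left (Ideal.subset_span ⟨j, rfl⟩)))
    simp only [mk_edgeToLayeredRing_layeredToEdgeRing 𝕜 ht] at h1
    rw [h2] at h1
    have h3 := Ideal.mul_mem_left _ (C (tPow 𝕜 (-1))) (Ideal.Quotient.eq_zero_iff_mem.1 h1.symm)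
    rw [map_mul, algHom_C, algebraMap_eq, ← mul_assoc, ← C_mul, mul_comm (tPow 𝕜 _),
      tPow_mul_tPow_neg, C_1, one_mul] at h3
    exact h3
  · rw [edgeNonlocalIdeal_eq]
    refine CutIdeal.ideal_le fun γ _ => Ideal.mem_comap.2 ?_
    have h := nonlocal_mem_altIdeal 𝕜 (refinement γ)
    rw [vertexWeight_refinement γ ht, cutOut_refinement γ ht, cutIn_refinement γ ht,
      ← edgeToLayeredRing_prod 𝕜 ht, ← edgeToLayeredRing_prod 𝕜 ht, ThinGraph.prod_cutIn_X,
      ThinGraph.prod_cutOut_X, tPow_sum] at h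
    have h' := neg_mem h
    rw [neg_sub] at h'
    convert h' using 1
    rw [CutIdeal.relation, map_sub]
    congr 1
    rw [← mul_one (∏ v ∈ γ, vertexParameter 𝕜 _ v), ← C_mul_monomial, map_mul, algHom_C,
      algebraMap_eq]
    rfl

lemma edgeToLayeredRing_mem_altIdeal (ht : ∀ p, ∃ j, Touches c p j)
    (f : EdgeRing 𝕜 (closedBraidGraph c)) : edgeToLayeredRing 𝕜 c f ∈ altIdeal 𝕜 c ↔
      f ∈ edgeLinearIdeal 𝕜 (closedBraidGraph c) ⊔ edgeNonlocalIdeal 𝕜 (closedBraidGraph c) := by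
  constructor
  · intro h
    have := altIdeal_le_comap 𝕜 ht h
    rwa [Ideal.mem_comap, layeredToEdgeRing_edgeToLayeredRing 𝕜 ht] at this
  · exact fun h => le_comap_altIdeal 𝕜 ht h

lemma ker_edgeRingToAlt (ht : ∀ p, ∃ j, Touches c p j) : RingHom.ker (edgeRingToAlt 𝕜 c) =
    edgeLinearIdeal 𝕜 (closedBraidGraph c) ⊔ edgeNonlocalIdeal 𝕜 (closedBraidGraph c) := by
  ext f
  rw [RingHom.mem_ker, ← edgeToLayeredRing_mem_altIdeal 𝕜 ht]
  exact Ideal.Quotient.eq_zero_iff_mem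

lemma edgeRingToAlt_surjective (ht : ∀ p, ∃ j, Touches c p j) :
    Function.Surjective (edgeRingToAlt 𝕜 c) := by
  intro a
  obtain ⟨f, rfl⟩ := Ideal.Quotient.mk_surjective a
  exact ⟨layeredToEdgeRing 𝕜 c f, mk_edgeToLayeredRing_layeredToEdgeRing 𝕜 ht f⟩

end Kernel

end BraidGraph

namespace BraidGraph

/-! ### Integrality over the variable of the cut edge -/

section Integrality

open Polynomial

variable {K B : Type*} [Field K] [CommRing B] [Algebra K B]

/-- If `(Y - x) g(Y) = (Y - q x') g_q(Y)`, where the roots of `g_q` are those of `g` multiplied by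
`q`, and `x = q ^ (m + 1) x'`, then the coefficients of `g` are polynomials in `x`. -/
lemma coeff_mem_range_aeval {m : ℕ} {q : K} (hq0 : q ≠ 0) (hq : ∀ k, 0 < k → q ^ k ≠ 1)
    (b : Fin m → B) (x x' : B) (hx : algebraMap K B q ^ (m + 1) * x' = x)
    (h : (X - C x) * ∏ i, (X - C (b i)) = (X - C (algebraMap K B q * x')) *
      ∏ i, (X - C (algebraMap K B q * b i))) (i : ℕ) :
    (∏ i, (X - C (b i))).coeff i ∈ Set.range (aeval x : K[X] →ₐ[K] B) := by
  set g := ∏ i, (X - C (b i)) with hg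
  set g' := ∏ i, (X - C (algebraMap K B q * b i)) with hg'
  set s := algebraMap K B q with hs
  nontriviality B
  have hdeg : g.natDegree = m := by
    rw [hg, natDegree_finsetProd_X_sub_C_eq_card, Finset.card_univ, Fintype.card_fin]
  have hmonic : g.Monic := monic_prod_X_sub_C _ _
  -- This is `g_q(q Y) = q^m g(Y)`, read off in each coefficient without division.
  have hscale : ∀ i, g'.coeff i * s ^ i = s ^ m * g.coeff i := by
    intro i
    rw [← comp_C_mul_X_coeff, ← coeff_C_mul]
    congr 1
    have hpow : (C (s ^ m) : B[X]) = ∏ _i : Fin m, C s := by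
      rw [Finset.prod_const, Finset.card_univ, Fintype.card_fin, C_pow]
    rw [hg', hg, prod_comp, hpow, ← Finset.prod_mul_distrib]
    refine Finset.prod_congr rfl fun i _ => ?_
    rw [sub_comp, X_comp, C_comp, C_mul]
    ring
  -- The coefficients of `Y^(i+1)` in `h` are compared after multiplication by `s^(i+1)`; then
  -- `hscale` eliminates `g'` and `hx` eliminates `x'`.
  have hrec : ∀ i, (s ^ (i + 1) - s ^ (m + 1)) * g.coeff i =
      (s ^ (i + 1) - 1) * (x * g.coeff (i + 1)) := by
    intro i
    have h1 := congrArg (fun p => coeff p (i + 1) * s ^ (i + 1)) h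
    simp only [coeff_X_sub_C_mul] at h1
    have h2 := hscale i
    have h3 := hscale (i + 1)
    have h4 : g'.coeff i * s ^ (i + 1) = s ^ (m + 1) * g.coeff i := by
      linear_combination s * h2
    have h5 : s * x' * g'.coeff (i + 1) * s ^ (i + 1) = x * g.coeff (i + 1) := by
      linear_combination s * x' * h3 + g.coeff (i + 1) * hx
    linear_combination h1 + h4 - h5
  rcases lt_or_ge m i with hi | hi
  · rw [coeff_eq_zero_of_natDegree_lt (hdeg.trans_lt hi)]
    exact ⟨0, map_zero _⟩
  -- Downward from the leading coefficient `1`. The factor `q^(i+1) - q^(m+1)` is invertible for `i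
  -- < m` because `q` is not a root of unity.
  · induction hi using Nat.decreasingInduction with
    | self =>
      have : g.coeff m = 1 := by
        rw [← hdeg]
        exact hmonic
      rw [this]
      exact ⟨1, map_one _⟩
    | of_succ i hi ih =>
      obtain ⟨p, hp⟩ := ih
      have hne : q ^ (i + 1) - q ^ (m + 1) ≠ 0 := by
        intro h0
        obtain ⟨k, rfl⟩ : ∃ k, m = i + (k + 1) := ⟨m - i - 1, by omega⟩
        refine hq (k + 1) k.succ_pos (mul_left_cancel₀ (pow_ne_zero (i + 1) hq0) ?_)
        rw [mul_one, ← pow_add, sub_eq_zero.1 h0]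
        congr 1
        ring
      refine ⟨C ((q ^ (i + 1) - q ^ (m + 1))⁻¹ * (q ^ (i + 1) - 1)) * (X * p), ?_⟩
      rw [map_mul, aeval_C, map_mul, map_mul, aeval_X, hp, mul_assoc, map_sub (algebraMap K B),
        map_one, map_pow, ← hs, ← hrec i, ← mul_assoc]
      rw [hs, ← map_pow, ← map_pow, ← map_sub, ← map_mul, inv_mul_cancel₀ hne, map_one, one_mul]

/-- At a crossing, the sum and the product of the two rescaled roots are preserved by the linear and
quadratic relations; on every other strand the rescaled root itself is preserved. -/
lemma prod_layer_eq {m n : ℕ} (c : Fin n → Fin m) (s : B) (a : Fin (m + 1) → ℕ → B)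
    (hadd : ∀ j : Fin n, s * (a (c j).castSucc (j + 1) + a (c j).succ (j + 1)) =
      a (c j).castSucc j + a (c j).succ j)
    (hmul : ∀ j : Fin n, s ^ 2 * (a (c j).castSucc (j + 1) * a (c j).succ (j + 1)) =
      a (c j).castSucc j * a (c j).succ j)
    (hone : ∀ p (j : Fin n), ¬ Touches c p j → s * a p (j + 1) = a p j) (h : ℕ) (hh : h ≤ n) :
    ∏ p, (X - C (s ^ h * a p h)) = ∏ p, (X - C (a p 0)) := by
  induction h with
  | zero => simp
  | succ h ih =>
    rw [← ih (by omega)]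
    set j : Fin n := ⟨h, hh⟩ with hj
    have hne : (c j).succ ≠ (c j).castSucc := (Fin.castSucc_lt_succ).ne'
    have hsplit : ∀ f : Fin (m + 1) → B[X], ∏ p, f p = f (c j).castSucc * (f (c j).succ *
        ∏ p ∈ (Finset.univ.erase (c j).castSucc).erase (c j).succ, f p) := fun f => by
      rw [Finset.mul_prod_erase _ f (Finset.mem_erase.2 ⟨hne, Finset.mem_univ _⟩),
        Finset.mul_prod_erase _ f (Finset.mem_univ _)]
    rw [hsplit, hsplit, ← mul_assoc, ← mul_assoc]
    congr 1
    · have h1 := congrArg C (hadd j)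
      have h2 := congrArg C (hmul j)
      simp only [C_mul, C_add, C_pow] at h1 h2 ⊢
      linear_combination (-X * C s ^ h) * h1 + (C s ^ h) ^ 2 * h2
    · refine Finset.prod_congr rfl fun p hp => ?_
      rw [Finset.mem_erase, Finset.mem_erase] at hp
      have hp' : ¬ Touches c p j := fun ht => ht.elim hp.2.1 hp.1
      rw [pow_succ, mul_assoc]
      rw [show s * a p (h + 1) = a p h from hone p j hp']

/-- Variables on the edges of a layered diagram that satisfy the local relations and are closed up
around all strands but one are integral over the polynomials in the variable of the cut edge. -/
lemma isIntegralElem_layer {m n : ℕ} (hn : 0 < n) (c : Fin n → Fin m) {t : K} (ht0 : t ≠ 0)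
    (ht : ∀ k, 0 < k → t ^ k ≠ 1) (a : Fin (m + 1) → ℕ → B)
    (hadd : ∀ j : Fin n, algebraMap K B t * (a (c j).castSucc (j + 1) + a (c j).succ (j + 1)) =
      a (c j).castSucc j + a (c j).succ j)
    (hmul : ∀ j : Fin n, algebraMap K B t ^ 2 *
      (a (c j).castSucc (j + 1) * a (c j).succ (j + 1)) = a (c j).castSucc j * a (c j).succ j)
    (hone : ∀ p (j : Fin n), ¬ Touches c p j → algebraMap K B t * a p (j + 1) = a p j)
    (hclose : ∀ p, p ≠ 0 → a p n = a p 0)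
    (hcut : algebraMap K B t ^ (n * (m + 1)) * a 0 n = a 0 0) (p : Fin (m + 1)) (h : ℕ)
    (hh : h ≤ n) : (aeval (a 0 0) : K[X] →ₐ[K] B).toRingHom.IsIntegralElem (a p h) := by
  set φ := (aeval (a 0 0) : K[X] →ₐ[K] B).toRingHom with hφ
  have hlayer := prod_layer_eq c (algebraMap K B t) a hadd hmul hone
  have hF : ∏ p, (X - C (a p 0)) = (X - C (a 0 0)) * ∏ i : Fin m, (X - C (a i.succ 0)) :=
    Fin.prod_univ_succ _
  -- Layers `0` and `n` are compared. The closed strands have equal variables at both ends, so their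
  -- roots are multiplied by `q = t^n`; the cut strand contributes `a 0 0` below and `q * a 0 n`
  -- above. The assumption `hcut` says `a 0 0 = q^(m+1) * a 0 n`.
  have hcoeff := coeff_mem_range_aeval (q := t ^ n) (pow_ne_zero n ht0)
    (fun k hk => by
      rw [← pow_mul]
      exact ht _ (Nat.mul_pos hn hk))
    (fun i : Fin m => a i.succ 0) (a 0 0) (a 0 n) (by rw [map_pow, ← pow_mul, hcut]) (by
      rw [← hF, ← hlayer n le_rfl, Fin.prod_univ_succ, map_pow]
      congr 1
      exact Finset.prod_congr rfl fun i _ => by rw [hclose _ (Fin.succ_ne_zero i)])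
  have hlift : (∏ p, (X - C (a p 0)) : B[X]) ∈ Polynomial.lifts φ := by
    rw [hF]
    refine mul_mem ?_ ((lifts_iff_coeff_lifts _).2 hcoeff)
    refine (mem_lifts _).2 ⟨X - C X, ?_⟩
    rw [Polynomial.map_sub, map_X, map_C]
    congr 2
    exact aeval_X _
  obtain ⟨P, hP, -, hmonic⟩ := lifts_and_natDegree_eq_and_monic hlift (monic_prod_X_sub_C _ _)
  -- The rescaled variable is a root of its layer polynomial, which equals the one at the bottom and
  -- so has coefficients in the polynomials in `a 0 0`.
  have hint : φ.IsIntegralElem (algebraMap K B t ^ h * a p h) := by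
    refine ⟨P, hmonic, ?_⟩
    rw [← eval_map, hP, ← hlayer h hh, eval_prod]
    refine Finset.prod_eq_zero (Finset.mem_univ p) ?_
    rw [eval_sub, eval_X, eval_C, sub_self]
  have hunit : φ (C (t⁻¹ ^ h)) * (algebraMap K B t ^ h * a p h) = a p h := by
    have : φ (C (t⁻¹ ^ h)) = algebraMap K B (t⁻¹ ^ h) := aeval_C _ _
    rw [this, ← mul_assoc, ← map_pow, ← map_mul, ← mul_pow, inv_mul_cancel₀ ht0, one_pow,
      map_one, one_mul]
  rw [← hunit]
  exact RingHom.IsIntegralElem.mul φ (RingHom.isIntegralElem_map φ) hint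

end Integrality

/-! ### The relations of the layered diagram in the quotient ring -/

section Relations

open MvPolynomial

variable (𝕜 : Type u) [Field 𝕜] {m n : ℕ} {c : Fin n → Fin m}

lemma cutOut_univ (hn : 0 < n) :
    (layeredGraph c).cutOut Finset.univ = {layeredEdge c 0 n} := by
  ext s
  rw [ThinGraph.mem_cutOut, Finset.mem_singleton]
  constructor
  · rintro ⟨h1, h2⟩
    obtain ⟨p, h, hh, rfl⟩ := exists_eq_layeredEdge c s
    have key : ∀ j : Fin n, layeredEdge c p h = layeredEdge c p j → False := fun j hj => by
      rw [hj] at h2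
      exact h2 ⟨_, Finset.mem_univ _, tgt_layeredEdge c p j⟩
    rcases hh.lt_or_eq with hh | rfl
    · exact (key ⟨h, hh⟩ rfl).elim
    · by_cases hp : p = 0
      · rw [hp]
      · exact (key ⟨0, hn⟩ (layeredEdge_last c hp)).elim
  · rintro rfl
    refine ⟨?_, ThinGraph.not_ends_of_tgt_eq_none (tgt_layeredEdge_last c)⟩
    obtain ⟨k, rfl⟩ : ∃ k, n = k + 1 := ⟨n - 1, by omega⟩
    exact ⟨_, Finset.mem_univ _, src_layeredEdge c 0 (Fin.last k)⟩

lemma cutIn_univ (hn : 0 < n) :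
    (layeredGraph c).cutIn Finset.univ = {layeredEdge c 0 0} := by
  ext s
  rw [ThinGraph.mem_cutIn, Finset.mem_singleton]
  constructor
  · rintro ⟨h1, h2⟩
    cases s with
    | none => exact (layeredEdge_zero_zero c).symm
    | some x => exact absurd ⟨_, Finset.mem_univ _, rfl⟩ h1
  · rintro rfl
    exact ⟨ThinGraph.not_starts_of_src_eq_none (src_layeredEdge_zero_zero c),
      ⟨_, Finset.mem_univ _, tgt_layeredEdge c 0 ⟨0, hn⟩⟩⟩

lemma card_touches (c : Fin n → Fin m) (j : Fin n) :
    (Finset.univ.filter fun p => Touches c p j).card = 2 := by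
  rw [Finset.card_eq_two]
  refine ⟨(c j).castSucc, (c j).succ, (Fin.castSucc_lt_succ).ne, ?_⟩
  ext p
  rw [Finset.mem_filter, Finset.mem_insert, Finset.mem_singleton]
  exact and_iff_right (Finset.mem_univ p)

/-- Each layer has one thick edge, of weight `2`, and `m - 1` bivalent vertices. -/
lemma vertexWeight_univ (hm : 0 < m) :
    vertexWeight (layeredGraph c) Finset.univ = (n * (m + 1) : ℕ) := by
  have hcard : Fintype.card {q : Fin n × Fin (m + 1) // ¬ Touches c q.2 q.1} = n * (m - 1) := by
    rw [Fintype.card_subtype, Finset.filter_not]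
    rw [Finset.card_sdiff_of_subset (Finset.filter_subset _ _)]
    have h1 : (Finset.univ.filter fun q : Fin n × Fin (m + 1) => Touches c q.2 q.1).card =
        n * 2 := by
      rw [Finset.card_filter, Fintype.sum_prod_type]
      simp only [← Finset.card_filter, card_touches]
      simp
    rw [h1, Finset.card_univ, Fintype.card_prod, Fintype.card_fin, Fintype.card_fin,
      ← Nat.mul_sub]
    rfl
  have hsum : vertexWeight (layeredGraph c) Finset.univ =
      ∑ _j : Fin n, (2 : ℤ) + ∑ _q : {q : Fin n × Fin (m + 1) // ¬ Touches c q.2 q.1}, (1 : ℤ) :=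
    Fintype.sum_sum_type _
  rw [hsum, Finset.sum_const, Finset.sum_const, Finset.card_univ, Finset.card_univ, hcard,
    Fintype.card_fin, nsmul_eq_mul, nsmul_eq_mul]
  obtain ⟨k, rfl⟩ : ∃ k, m = k + 1 := ⟨m - 1, by omega⟩
  push_cast
  simp
  ring

/-- By `altIdeal_le_comap` the images of the layered variables satisfy all layered relations, so
`isIntegralElem_layer` applies. Its condition on the cut strand is the non-local relation of the set
of all vertices, whose only cut edges are the two ends of that strand. -/
lemma isIntegralElem_edge (hm : 0 < m) (hn : 0 < n) (ht : ∀ p, ∃ j, Touches c p j)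
    (e : (closedBraidGraph c).Edge) :
    ((Polynomial.aeval (Ideal.Quotient.mk (edgeLinearIdeal 𝕜 (closedBraidGraph c) ⊔
      edgeNonlocalIdeal 𝕜 (closedBraidGraph c)) (X (ClosedEdge.bottom : ClosedEdge c))) :
        Polynomial (LaurentSeries 𝕜) →ₐ[LaurentSeries 𝕜] _).toRingHom).IsIntegralElem
      (Ideal.Quotient.mk (edgeLinearIdeal 𝕜 (closedBraidGraph c) ⊔
        edgeNonlocalIdeal 𝕜 (closedBraidGraph c)) (X e)) := by
  set J := edgeLinearIdeal 𝕜 (closedBraidGraph c) ⊔ edgeNonlocalIdeal 𝕜 (closedBraidGraph c)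
  let ψ : ThinRing 𝕜 (layeredGraph c) →ₐ[LaurentSeries 𝕜] EdgeRing 𝕜 (closedBraidGraph c) ⧸ J :=
    (Ideal.Quotient.mkₐ _ J).comp (layeredToEdgeRing 𝕜 c)
  have hψ : ∀ f g, f - g ∈ altIdeal 𝕜 c → ψ f = ψ g := fun f g h => by
    have := altIdeal_le_comap 𝕜 ht h
    rw [Ideal.mem_comap, map_sub] at this
    exact Ideal.Quotient.eq.2 this
  have hC : ∀ a, ψ (C a) = algebraMap (LaurentSeries 𝕜) _ a := fun a => ψ.commutes a
  have hfirst : ∀ e, ψ (X (first c e)) = Ideal.Quotient.mk J (X e) := fun e => by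
    have := layeredToEdgeRing_edgeToLayeredRing 𝕜 ht (X e)
    rw [edgeToLayeredRing_X] at this
    exact congrArg (Ideal.Quotient.mk J) this
  have hpow : ∀ k : ℕ, tPow 𝕜 1 ^ k = tPow 𝕜 k := fun k => by rw [tPow_pow, mul_one]
  have hmain := isIntegralElem_layer hn c (t := tPow 𝕜 1) (tPow_ne_zero 𝕜 1)
    (fun k hk h => tPow_sub_one_ne_zero 𝕜 (a := k) (by omega) (by rw [← hpow, h, sub_self]))
    (fun p h => ψ (X (layeredEdge c p h)))
    (fun j => by
      have := hψ _ _ (linear_mem_altIdeal 𝕜 (c := c) j)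
      rwa [map_mul, hC, map_add, map_add] at this)
    (fun j => by
      have := hψ _ _ (quadratic_mem_altIdeal 𝕜 (c := c) j)
      rw [map_mul, hC, map_mul, map_mul] at this
      rw [← map_pow, hpow]
      exact this)
    (fun p j hj => by
      have := hψ _ _ (bivalent_mem_altIdeal 𝕜 hj)
      rwa [map_mul, hC] at this)
    (fun p hp => by rw [layeredEdge_last c hp])
    (by
      have := hψ _ _ (nonlocal_mem_altIdeal 𝕜 (c := c) Finset.univ)
      rwa [cutOut_univ hn, cutIn_univ hn, Finset.prod_singleton, Finset.prod_singleton,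
        map_mul, hC, vertexWeight_univ hm, ← hpow, map_pow] at this)
  obtain ⟨p, h, hh, hs⟩ := exists_eq_layeredEdge c (first c e)
  have h1 := hmain p h hh
  have h0 : ψ (X (layeredEdge c 0 0)) =
      Ideal.Quotient.mk J (X (ClosedEdge.bottom : ClosedEdge c)) := by
    rw [layeredEdge_zero_zero]
    exact hfirst ClosedEdge.bottom
  rw [← hs, hfirst, h0] at h1
  exact h1

end Relations

end BraidGraph

/-! ### Tor in degree zero and vanishing criteria -/

section TorZero

open CategoryTheory

variable {A : Type u} [CommRing A]

/-- Right exactness of the tensor product, which identifies its zeroth left derived functor with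
itself. -/
instance preservesFiniteColimits_tensoringRight (Y : ModuleCat.{u} A) :
    Limits.PreservesFiniteColimits ((MonoidalCategory.tensoringRight (ModuleCat.{u} A)).obj Y) := by
  have : Limits.PreservesColimits (MonoidalCategory.tensorLeft Y) :=
    (ihom.adjunction Y).leftAdjoint_preservesColimits
  exact Limits.preservesFiniteColimits_of_natIso (BraidedCategory.tensorLeftIsoTensorRight Y)

/-- In degree zero, `Tor` is the tensor product. -/
def torZeroEquiv (X Y : ModuleCat.{u} A) :
    ((Tor' (ModuleCat.{u} A) 0).obj X).obj Y ≃ₗ[A] X ⊗[A] Y :=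
  (((MonoidalCategory.tensoringRight (ModuleCat.{u} A)).obj Y).leftDerivedZeroIsoSelf.app
    X).toLinearEquiv

/-- The tensor product of two quotients of a ring. -/
def quotTensorQuotEquivQuotSup (I J : Ideal A) : ((A ⧸ I) ⊗[A] (A ⧸ J)) ≃ₗ[A] A ⧸ (I ⊔ J) :=
  (TensorProduct.quotientTensorQuotientEquiv I J).trans
    (Submodule.Quotient.equiv _ _ (TensorProduct.lid A A) (by
      rw [Submodule.map_sup]
      congr 1
      · rw [← LinearMap.range_comp]
        apply le_antisymm
        · rintro _ ⟨z, rfl⟩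
          induction z with
          | zero => simp
          | add a b ha hb => rw [map_add]; exact add_mem ha hb
          | tmul x y => simpa using I.mul_mem_right y x.2
        · exact fun x hx => ⟨⟨x, hx⟩ ⊗ₜ 1, by simp⟩
      · rw [← LinearMap.range_comp]
        apply le_antisymm
        · rintro _ ⟨z, rfl⟩
          induction z with
          | zero => simp
          | add a b ha hb => rw [map_add]; exact add_mem ha hb
          | tmul x y => simpa using J.mul_mem_left x y.2
        · exact fun x hx => ⟨1 ⊗ₜ ⟨x, hx⟩, by simp⟩))

lemma subsingleton_tensorProduct_left (M N : Type*) [AddCommGroup M] [Module A M]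
    [AddCommGroup N] [Module A N] [Subsingleton M] : Subsingleton (M ⊗[A] N) :=
  subsingleton_of_forall_eq 0 fun z => by
    induction z with
    | zero => rfl
    | add a b ha hb => rw [ha, hb, add_zero]
    | tmul x y => rw [Subsingleton.elim x 0, TensorProduct.zero_tmul]

lemma subsingleton_tensorProduct_right (M N : Type*) [AddCommGroup M] [Module A M]
    [AddCommGroup N] [Module A N] [Subsingleton N] : Subsingleton (M ⊗[A] N) :=
  (TensorProduct.comm A M N).toEquiv.subsingleton_congr.2 (subsingleton_tensorProduct_left N M)

lemma subsingleton_tor_of_subsingleton (X Y : ModuleCat.{u} A) [Subsingleton Y] (i : ℕ) :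
    Subsingleton (((Tor' (ModuleCat.{u} A) i).obj X).obj Y) := by
  cases i with
  | zero =>
    exact (torZeroEquiv X Y).toEquiv.subsingleton
  | succ i =>
    refine ModuleCat.subsingleton_of_isZero (isZero_tor_of_subsingleton_ext X Y i ?_)
    have h : HasFlatDimensionLT A Y 0 := HasFlatDimensionLT.of_subsingleton
    unfold HasFlatDimensionLT at h
    exact HasInjectiveDimensionLT.subsingleton _ 0 (i + 1) (Nat.zero_le _) _

lemma subsingleton_exteriorPower (M : Type u) [AddCommGroup M] [Module A M] [Subsingleton M]
    {j : ℕ} (hj : j ≠ 0) : Subsingleton (⋀[A]^j M) := by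
  have h : (⊤ : Submodule A (⋀[A]^j M)) = ⊥ := by
    rw [← exteriorPower.ιMulti_span, Submodule.span_eq_bot]
    rintro _ ⟨f, rfl⟩
    exact (exteriorPower.ιMulti A j).map_coord_zero ⟨0, Nat.pos_of_ne_zero hj⟩
      (Subsingleton.elim _ _)
  exact (Submodule.subsingleton_iff A).1 (subsingleton_of_bot_eq_top h.symm)

lemma nonempty_directSum_equiv {ι : Type*} [DecidableEq ι] (M : ι → Type*)
    [∀ i, AddCommGroup (M i)] [∀ i, Module A (M i)] (i₀ : ι)
    (h : ∀ i, i ≠ i₀ → Subsingleton (M i)) : Nonempty ((⨁ i, M i) ≃ₗ[A] M i₀) := by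
  refine ⟨LinearEquiv.ofBijective (DirectSum.component A ι M i₀) ⟨?_, ?_⟩⟩
  · intro x y hxy
    refine DFinsupp.ext fun i => ?_
    by_cases hi : i = i₀
    · subst hi
      exact hxy
    · have := h i hi
      exact Subsingleton.elim _ _
  · exact fun x => ⟨DirectSum.lof A ι M i₀ x, DirectSum.component.lof_self A i₀ x⟩

end TorZero

namespace BraidGraph

open MvPolynomial

/-- The conclusion of the comparison theorem: `B(G)` and `A(G)` are isomorphic, both vanish if `G`
is disconnected, and `B(G)` is concentrated in degree zero, where it is `A(G)`. -/
def Comparison (𝕜 : Type u) [Field 𝕜] {m n : ℕ} (c : Fin n → Fin m) : Prop :=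
  Nonempty (graphHomology 𝕜 (closedBraidGraph c) {cutComponent c}
    ≃ₗ[EdgeRing 𝕜 (closedBraidGraph c)] altGraphHomology 𝕜 c) ∧
  (¬ (closedBraidGraph c).adjacency.Connected →
    Subsingleton (graphHomology 𝕜 (closedBraidGraph c) {cutComponent c}) ∧
    Subsingleton (altGraphHomology 𝕜 c)) ∧
  (∀ i j : ℕ, (i, j) ≠ (0, 0) →
    Subsingleton (graphHomologyPart 𝕜 (closedBraidGraph c) {cutComponent c} i j)) ∧
  Nonempty (graphHomologyPart 𝕜 (closedBraidGraph c) {cutComponent c} 0 0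
    ≃ₗ[EdgeRing 𝕜 (closedBraidGraph c)] altGraphHomology 𝕜 c)

/-! ### Assembling the comparison -/

section Assembly

variable (𝕜 : Type u) [Field 𝕜] {m n : ℕ} {c : Fin n → Fin m}

lemma nonempty_graphHomology_equiv (G : FramedGraph) (special : Set G.Component)
    (h : ∀ i j : ℕ, (i, j) ≠ (0, 0) → Subsingleton (graphHomologyPart 𝕜 G special i j)) :
    Nonempty (graphHomology 𝕜 G special ≃ₗ[EdgeRing 𝕜 G] graphHomologyPart 𝕜 G special 0 0) :=
  nonempty_directSum_equiv (A := EdgeRing 𝕜 G)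
    (fun d : ℕ × ℕ => graphHomologyPart 𝕜 G special d.1 d.2) (0, 0) fun d hd => h d.1 d.2 hd

/-- There are no non-special components, so the positive exterior powers vanish and the zeroth one
is the ring. What remains is `Tor_0`, the quotient by the sum of the two ideals. -/
lemma comparison_of_connected (hconn : (closedBraidGraph c).adjacency.Connected)
    (htor : ∀ i, Subsingleton (torGroup 𝕜 (closedBraidGraph c) (i + 1)))
    (hker : RingHom.ker (edgeRingToAlt 𝕜 c) =
      edgeLinearIdeal 𝕜 (closedBraidGraph c) ⊔ edgeNonlocalIdeal 𝕜 (closedBraidGraph c))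
    (hsurj : Function.Surjective (edgeRingToAlt 𝕜 c)) : Comparison 𝕜 c := by
  have hV : Subsingleton (componentModule 𝕜 (closedBraidGraph c) {cutComponent c}) := by
    have : IsEmpty {K : (closedBraidGraph c).Component // K ∉ ({cutComponent c} : Set _)} := by
      refine ⟨fun K => K.2 ?_⟩
      have := hconn.preconnected.subsingleton_connectedComponent
      exact Subsingleton.elim _ _
    infer_instance
  have hpart : ∀ i j : ℕ, (i, j) ≠ (0, 0) →
      Subsingleton (graphHomologyPart 𝕜 (closedBraidGraph c) {cutComponent c} i j) := by
    intro i j hij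
    by_cases hj : j = 0
    · obtain ⟨i, rfl⟩ : ∃ k, i = k + 1 := by
        refine ⟨i - 1, ?_⟩
        have : i ≠ 0 := fun hi => hij (by rw [hi, hj])
        omega
      have := htor i
      exact subsingleton_tensorProduct_left _ _
    · have := subsingleton_exteriorPower (A := EdgeRing 𝕜 (closedBraidGraph c))
        (componentModule 𝕜 (closedBraidGraph c) {cutComponent c}) hj
      exact subsingleton_tensorProduct_right _ _
  let φ : EdgeRing 𝕜 (closedBraidGraph c) →ₗ[EdgeRing 𝕜 (closedBraidGraph c)]
      altGraphHomology 𝕜 c := LinearMap.toSpanSingleton _ _ 1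
  have hφ : ∀ f, φ f = edgeRingToAlt 𝕜 c f := fun f => mul_one (edgeRingToAlt 𝕜 c f)
  have hφker : LinearMap.ker φ = edgeLinearIdeal 𝕜 (closedBraidGraph c) ⊔
      edgeNonlocalIdeal 𝕜 (closedBraidGraph c) := by
    rw [← hker]
    ext f
    rw [LinearMap.mem_ker, hφ, RingHom.mem_ker]
  have hφsurj : Function.Surjective φ := fun a => by
    obtain ⟨f, hf⟩ := hsurj a
    exact ⟨f, (hφ f).trans hf⟩
  have hzero : Nonempty (graphHomologyPart 𝕜 (closedBraidGraph c) {cutComponent c} 0 0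
      ≃ₗ[EdgeRing 𝕜 (closedBraidGraph c)] altGraphHomology 𝕜 c) :=
    ⟨(TensorProduct.congr (LinearEquiv.refl _ _) (exteriorPower.zeroEquiv _ _)).trans
      ((TensorProduct.rid _ _).trans ((torZeroEquiv _ _).trans
        ((quotTensorQuotEquivQuotSup _ _).trans
          ((Submodule.quotEquivOfEq _ _ hφker.symm).trans
            (φ.quotKerEquivOfSurjective hφsurj)))))⟩
  obtain ⟨e⟩ := hzero
  obtain ⟨e'⟩ := nonempty_graphHomology_equiv 𝕜 _ _ hpart
  exact ⟨⟨e'.trans e⟩, fun h => absurd hconn h, hpart, ⟨e⟩⟩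

/-- Every Tor with the zero module vanishes, so all isomorphisms are between zero modules. -/
lemma comparison_of_subsingleton (hN : edgeNonlocalIdeal 𝕜 (closedBraidGraph c) = ⊤)
    (hA : Subsingleton (altGraphHomology 𝕜 c)) : Comparison 𝕜 c := by
  have : Subsingleton (EdgeRing 𝕜 (closedBraidGraph c) ⧸
      edgeNonlocalIdeal 𝕜 (closedBraidGraph c)) := Ideal.Quotient.subsingleton_iff.2 hN
  have hpart : ∀ i j : ℕ,
      Subsingleton (graphHomologyPart 𝕜 (closedBraidGraph c) {cutComponent c} i j) := by
    intro i j
    have : Subsingleton (torGroup 𝕜 (closedBraidGraph c) i) :=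
      subsingleton_tor_of_subsingleton _ _ i
    exact subsingleton_tensorProduct_left _ _
  obtain ⟨e⟩ := nonempty_graphHomology_equiv 𝕜 (closedBraidGraph c) {cutComponent c}
    fun i j _ => hpart i j
  have h0 := hpart 0 0
  have hB := e.toEquiv.subsingleton
  exact ⟨⟨0⟩, fun _ => ⟨hB, hA⟩, fun i j _ => hpart i j, ⟨0⟩⟩

end Assembly

/-! ### Connected graphs with crossings -/

section Surjective

variable (𝕜 : Type u) [Field 𝕜] {m n : ℕ} {c : Fin n → Fin m}

/-- The count on which the argument rests: besides the `n` linear relations and the cut edge there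
are `n` coordinates, as many as the flat dimension of the quotient by `N` allows. -/
lemma card_closedEdge [IsEmpty (Crossingless c)] : Fintype.card (ClosedEdge c) = n + 1 + n := by
  let e : ClosedEdge c ≃ (Fin n ⊕ Unit) ⊕ Fin n :=
    { toFun := fun x => match x with
        | .bottom => Sum.inl (Sum.inr ())
        | .left j => Sum.inl (Sum.inl j)
        | .right j => Sum.inr j
        | .bivalentOut p => isEmptyElim p
      invFun := Sum.elim (Sum.elim .left fun _ => .bottom) .right
      left_inv := fun x => by
        cases x with
        | bivalentOut p => exact isEmptyElim p
        | _ => rfl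
      right_inv := by rintro ((j | u) | j) <;> rfl }
  rw [Fintype.card_congr e]
  simp

lemma comparison_of_surjective (hm : 0 < m) (hc : Function.Surjective c) : Comparison 𝕜 c := by
  have ht := exists_touches c hm hc
  have hn : 0 < n := (hc ⟨0, hm⟩).choose.pos
  have hempty := isEmpty_crossingless ht
  refine comparison_of_connected 𝕜 (connected_closedBraidGraph hm hc) (fun i => ?_)
    (ker_edgeRingToAlt 𝕜 ht) (edgeRingToAlt_surjective 𝕜 ht)
  refine ModuleCat.subsingleton_of_isZero ?_
  refine isZero_tor_of_linearIndependent (σ := (closedBraidGraph c).Edge)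
    (τ := (closedBraidGraph c).Thick) n ?_ (linearRelation 𝕜 (closedBraidGraph c))
    (ClosedEdge.bottom : ClosedEdge c) ?_ _ _ (edgeLinearIdeal_eq_span_linearForm 𝕜 _)
    (isIntegralElem_edge 𝕜 hm hn ht) ?_ i
  · have h1 : Fintype.card (closedBraidGraph c).Thick = n := Fintype.card_fin n
    rw [h1]
    exact card_closedEdge
  · exact linearIndependent_linearRelation 𝕜 src_eq_none_iff (fun _ => cutIn_nonempty hm hc)
      (exists_eq_inl ht) (card_outEdges_eq_card_inEdges ht)
  · rw [edgeNonlocalIdeal_eq]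
    -- The hypothesis on sets that no edge enters is vacuous, since every nonempty set is entered.
    have h := CutIdeal.hasFlatDimensionLT_quotient (src := (closedBraidGraph c).src)
      (tgt := (closedBraidGraph c).tgt) Finset.univ Finset.univ
      (vertexParameter 𝕜 (closedBraidGraph c)) fun γ _ hγ h0 =>
        absurd h0 (ThinGraph.into_ne_zero (cutIn_nonempty hm hc hγ))
    have hcard : (Finset.univ : Finset (closedBraidGraph c).Node).card = n := by
      have h1 : Fintype.card (Fin n ⊕ Crossingless c) = n := by simp
      exact h1
    rwa [hcard] at h

end Surjective

end BraidGraph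

namespace BraidGraph

open MvPolynomial

/-! ### Graphs separated by a column without crossings -/

section Separated

variable (𝕜 : Type u) [Field 𝕜] {m n : ℕ} {c : Fin n → Fin m}

/-- The two strands of a crossing lie on the same side of a column without crossings. -/
lemma touches_lt_iff {p : Fin m} (hp : ∀ j, c j ≠ p) {q : Fin (m + 1)} {j : Fin n}
    (h : Touches c q j) : (p : ℕ) < q ↔ p < c j := by
  have h1 : (c j : ℕ) ≠ p := fun h => hp j (Fin.ext h)
  rw [Fin.lt_def]
  rcases h with rfl | rfl
  · rfl
  · rw [Fin.val_succ]
    omega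

/-- The vertices of the closed braid graph on the strands to the right of column `p`. -/
def closedRight (c : Fin n → Fin m) (p : Fin m) : Finset (closedBraidGraph c).Node :=
  Finset.disjSum (Finset.univ.filter fun j : Fin n => p < c j)
    (Finset.univ.filter fun q : Crossingless c => (p : ℕ) < q.1)

lemma inl_mem_closedRight (p : Fin m) (j : Fin n) :
    (Sum.inl j : (closedBraidGraph c).Node) ∈ closedRight c p ↔ p < c j := by
  refine Finset.inl_mem_disjSum.trans (Finset.mem_filter.trans ?_)
  exact and_iff_right (Finset.mem_univ _)

lemma inr_mem_closedRight (p : Fin m) (q : Crossingless c) :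
    (Sum.inr q : (closedBraidGraph c).Node) ∈ closedRight c p ↔ (p : ℕ) < q.1 := by
  refine Finset.inr_mem_disjSum.trans (Finset.mem_filter.trans ?_)
  exact and_iff_right (Finset.mem_univ _)

/-- A closed strand without crossings is framed `n`, so the positivity of its framing relies on `0 <
n`. -/
lemma climb_cases (q : Fin (m + 1)) {h : ℕ} (hh : h ≤ n) (hn : 0 < n) :
    (∃ j k, climb c q h = (some (Sum.inl j), k) ∧ Touches c q j ∧ 0 < k) ∨
      (∃ r k, climb c q h = (some (Sum.inr r), k) ∧ r.1 = q ∧ 0 < k) ∨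
      ((climb c q h).1 = none ∧ q = 0) := by
  unfold climb
  split_ifs with h1 h2 h3
  · have := Finset.min'_mem _ h1
    obtain ⟨h4, h5⟩ := (Finset.mem_filter.1 this).2
    exact Or.inl ⟨_, _, rfl, h4, by omega⟩
  · exact Or.inr (Or.inr ⟨rfl, h2⟩)
  · have := Finset.min'_mem _ h3
    obtain ⟨h4, h5⟩ := (Finset.mem_filter.1 this).2
    exact Or.inl ⟨_, _, rfl, h4, by omega⟩
  · exact Or.inr (Or.inl ⟨_, _, rfl, rfl, by omega⟩)

lemma tgtAndFraming_cases (e : ClosedEdge c) (hn : 0 < n) :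
    (∃ j k, e.tgtAndFraming c = (some (Sum.inl j), k) ∧ Touches c e.strand j ∧ 0 < k) ∨
      (∃ r k, e.tgtAndFraming c = (some (Sum.inr r), k) ∧ r.1 = e.strand ∧ 0 < k) ∨
      ((e.tgtAndFraming c).1 = none ∧ e.strand = 0) := by
  cases e with
  | bottom =>
    rw [ClosedEdge.tgtAndFraming]
    split_ifs with h
    · exact Or.inr (Or.inl ⟨_, _, rfl, rfl, by omega⟩)
    · exact climb_cases 0 (Nat.zero_le _) hn
  | left j => exact climb_cases _ j.isLt hn
  | right j => exact climb_cases _ j.isLt hn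
  | bivalentOut q => exact climb_cases _ le_rfl hn

lemma ends_closedRight {p : Fin m} (hp : ∀ j, c j ≠ p) (hn : 0 < n) (e : ClosedEdge c) :
    ((closedBraidGraph c).Ends (closedRight c p) e ↔ (p : ℕ) < e.strand) ∧
      ((closedBraidGraph c).Ends (closedRight c p) e → 0 < (closedBraidGraph c).framing e) := by
  have htgt : (closedBraidGraph c).tgt e = (e.tgtAndFraming c).1 := rfl
  have hframing : (closedBraidGraph c).framing e = (e.tgtAndFraming c).2 := rfl
  rw [hframing]
  rcases tgtAndFraming_cases e hn with ⟨j, k, h1, h2, h3⟩ | ⟨r, k, h1, h2, h3⟩ | ⟨h1, h2⟩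
  · rw [h1] at htgt ⊢
    refine ⟨(ThinGraph.ends_of_tgt_eq_some htgt).trans ?_, fun _ => h3⟩
    exact (inl_mem_closedRight p j).trans (touches_lt_iff hp h2).symm
  · rw [h1] at htgt ⊢
    refine ⟨(ThinGraph.ends_of_tgt_eq_some htgt).trans ?_, fun _ => h3⟩
    rw [← h2]
    exact inr_mem_closedRight p r
  · rw [h1] at htgt
    have := ThinGraph.not_ends_of_tgt_eq_none (γ := closedRight c p) htgt
    refine ⟨iff_of_false this ?_, fun h => absurd h this⟩
    rw [h2]
    exact Nat.not_lt_zero _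

lemma starts_closedRight {p : Fin m} (hp : ∀ j, c j ≠ p) (e : ClosedEdge c) :
    (closedBraidGraph c).Starts (closedRight c p) e ↔ (p : ℕ) < e.strand := by
  cases e with
  | bottom =>
    exact iff_of_false (ThinGraph.not_starts_of_src_eq_none ((src_eq_none_iff _).2 rfl))
      (Nat.not_lt_zero _)
  | left j =>
    refine (ThinGraph.starts_of_src_eq_some (v := Sum.inl j) rfl).trans ?_
    exact (inl_mem_closedRight p j).trans (touches_lt_iff hp (touches_castSucc j)).symm
  | right j =>
    refine (ThinGraph.starts_of_src_eq_some (v := Sum.inl j) rfl).trans ?_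
    exact (inl_mem_closedRight p j).trans (touches_lt_iff hp (touches_succ j)).symm
  | bivalentOut q =>
    refine (ThinGraph.starts_of_src_eq_some (v := Sum.inr q) rfl).trans ?_
    exact inr_mem_closedRight p q

lemma exists_strand_eq_succ {p : Fin m} (hp : ∀ j, c j ≠ p) :
    ∃ e : ClosedEdge c, e.strand = p.succ := by
  by_cases h : ∃ j, Touches c p.succ j
  · obtain ⟨j, hj⟩ := h
    refine ⟨.left j, ?_⟩
    rcases hj with hj | hj
    · exact hj.symm
    · exact absurd (Fin.succ_injective _ hj).symm (hp j)
  · push Not at h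
    exact ⟨.bivalentOut ⟨p.succ, h⟩, rfl⟩

/-- No edge joins the two sides of the empty column and the cut strand lies on the left. The
generator of the right-hand side is thus `t^w - 1`, with `w` a nonempty sum of positive framings,
and this is a unit. -/
lemma edgeNonlocalIdeal_eq_top {p : Fin m} (hp : ∀ j, c j ≠ p) (hn : 0 < n) :
    edgeNonlocalIdeal 𝕜 (closedBraidGraph c) = ⊤ := by
  have hiff : ∀ e, (closedBraidGraph c).Starts (closedRight c p) e ↔
      (closedBraidGraph c).Ends (closedRight c p) e := fun e =>
    (starts_closedRight hp e).trans (ends_closedRight hp hn e).1.symm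
  have hout : (closedBraidGraph c).cutOut (closedRight c p) = ∅ := by
    rw [Finset.eq_empty_iff_forall_notMem]
    intro e he
    obtain ⟨h1, h2⟩ := (ThinGraph.mem_cutOut _).1 he
    exact h2 ((hiff e).1 h1)
  have hin : (closedBraidGraph c).cutIn (closedRight c p) = ∅ := by
    rw [Finset.eq_empty_iff_forall_notMem]
    intro e he
    obtain ⟨h1, h2⟩ := (ThinGraph.mem_cutIn _).1 he
    exact h1 ((hiff e).2 h2)
  have hweight : 0 < weight (closedBraidGraph c) (closedRight c p) := by
    refine Finset.sum_pos (fun e he => ?_) ?_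
    · exact (ends_closedRight hp hn e).2 (Finset.mem_filter.1 he).2.2
    · obtain ⟨e, he⟩ := exists_strand_eq_succ hp
      have h : (p : ℕ) < e.strand := by
        rw [he, Fin.val_succ]
        exact Nat.lt_succ_self _
      exact ⟨e, Finset.mem_filter.2 ⟨Finset.mem_univ _, (starts_closedRight hp e).2 h,
        (ends_closedRight hp hn e).1.2 h⟩⟩
  have hmem : toEdgeRing 𝕜 (closedBraidGraph c)
      (C (tPow 𝕜 (weight (closedBraidGraph c) (closedRight c p))) *
        ∏ e ∈ (closedBraidGraph c).cutOut (closedRight c p), xVar 𝕜 e -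
          ∏ e ∈ (closedBraidGraph c).cutIn (closedRight c p), yVar 𝕜 e) ∈
      edgeNonlocalIdeal 𝕜 (closedBraidGraph c) :=
    Ideal.mem_map_of_mem _ (Ideal.subset_span ⟨_, rfl⟩)
  rw [hout, hin, Finset.prod_empty, Finset.prod_empty, mul_one, map_sub, map_one, algHom_C,
    algebraMap_eq, ← C_1, ← C_sub] at hmem
  exact Ideal.eq_top_of_isUnit_mem _ hmem
    ((isUnit_iff_ne_zero.2 (tPow_sub_one_ne_zero 𝕜 hweight.ne')).map C)

/-- The vertices of the layered diagram on the strands to the right of column `p`. -/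
def layeredRight (c : Fin n → Fin m) (p : Fin m) : Finset (layeredGraph c).Node :=
  Finset.disjSum (Finset.univ.filter fun j : Fin n => p < c j)
    (Finset.univ.filter fun q : {q : Fin n × Fin (m + 1) // ¬ Touches c q.2 q.1} =>
      (p : ℕ) < q.1.2)

lemma layeredNode_mem_layeredRight {p : Fin m} (hp : ∀ j, c j ≠ p) (q : Fin (m + 1))
    (j : Fin n) : layeredNode c j q ∈ layeredRight c p ↔ (p : ℕ) < q := by
  by_cases hj : Touches c q j
  · rw [layeredNode_of_touches c hj]
    refine Finset.inl_mem_disjSum.trans (Finset.mem_filter.trans ?_)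
    exact (and_iff_right (Finset.mem_univ _)).trans (touches_lt_iff hp hj).symm
  · rw [layeredNode_of_not_touches c hj]
    refine Finset.inr_mem_disjSum.trans (Finset.mem_filter.trans ?_)
    exact and_iff_right (Finset.mem_univ _)

lemma starts_iff_ends_layeredRight {p : Fin m} (hp : ∀ j, c j ≠ p) (hn : 0 < n)
    (s : (layeredGraph c).Edge) : (layeredGraph c).Starts (layeredRight c p) s ↔
      (layeredGraph c).Ends (layeredRight c p) s := by
  have hends : ∀ q (j : Fin n), (layeredGraph c).Ends (layeredRight c p) (layeredEdge c q j) ↔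
      (p : ℕ) < q := fun q j => (ThinGraph.ends_of_tgt_eq_some (tgt_layeredEdge c q j)).trans
    (layeredNode_mem_layeredRight hp q j)
  have hstarts : ∀ q (j : Fin n), (layeredGraph c).Starts (layeredRight c p)
      (layeredEdge c q (j + 1)) ↔ (p : ℕ) < q := fun q j =>
    (ThinGraph.starts_of_src_eq_some (src_layeredEdge c q j)).trans
      (layeredNode_mem_layeredRight hp q j)
  have hstarts0 : ∀ q, (layeredGraph c).Starts (layeredRight c p) (layeredEdge c q 0) ↔
      (p : ℕ) < q := fun q => by
    by_cases hq : q = 0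
    · subst hq
      exact iff_of_false (ThinGraph.not_starts_of_src_eq_none (src_layeredEdge_zero_zero c))
        (Nat.not_lt_zero _)
    · rw [← layeredEdge_last c hq]
      obtain ⟨k, rfl⟩ : ∃ k, n = k + 1 := ⟨n - 1, by omega⟩
      exact hstarts q (Fin.last k)
  obtain ⟨q, h, hh, rfl⟩ := exists_eq_layeredEdge c s
  have h1 : (layeredGraph c).Starts (layeredRight c p) (layeredEdge c q h) ↔ (p : ℕ) < q := by
    cases h with
    | zero => exact hstarts0 q
    | succ h => exact hstarts q ⟨h, hh⟩
  refine h1.trans (Iff.symm ?_)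
  rcases hh.lt_or_eq with hh | rfl
  · exact hends q ⟨h, hh⟩
  · by_cases hq : q = 0
    · subst hq
      exact iff_of_false (ThinGraph.not_ends_of_tgt_eq_none (tgt_layeredEdge_last c))
        (Nat.not_lt_zero _)
    · rw [layeredEdge_last c hq]
      exact hends q ⟨0, hn⟩

/-- The same unit `t^w - 1` arises from the vertices to the right of the column; here `w` counts
them with their weights. -/
lemma subsingleton_altGraphHomology {p : Fin m} (hp : ∀ j, c j ≠ p) (hn : 0 < n) :
    Subsingleton (altGraphHomology 𝕜 c) := by
  have hout : (layeredGraph c).cutOut (layeredRight c p) = ∅ := by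
    rw [Finset.eq_empty_iff_forall_notMem]
    intro e he
    obtain ⟨h1, h2⟩ := (ThinGraph.mem_cutOut _).1 he
    exact h2 ((starts_iff_ends_layeredRight hp hn e).1 h1)
  have hin : (layeredGraph c).cutIn (layeredRight c p) = ∅ := by
    rw [Finset.eq_empty_iff_forall_notMem]
    intro e he
    obtain ⟨h1, h2⟩ := (ThinGraph.mem_cutIn _).1 he
    exact h1 ((starts_iff_ends_layeredRight hp hn e).2 h2)
  have hweight : 0 < vertexWeight (layeredGraph c) (layeredRight c p) := by
    refine Finset.sum_pos (fun v _ => ?_) ?_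
    · cases v with
      | inl j => exact two_pos
      | inr q => exact one_pos
    · refine ⟨_, (layeredNode_mem_layeredRight hp p.succ ⟨0, hn⟩).2 ?_⟩
      rw [Fin.val_succ]
      exact Nat.lt_succ_self _
  have hmem := nonlocal_mem_altIdeal 𝕜 (layeredRight c p)
  rw [hout, hin, Finset.prod_empty, mul_one, ← C_1, ← C_sub] at hmem
  exact Ideal.Quotient.subsingleton_iff.2 (Ideal.eq_top_of_isUnit_mem _ hmem
    ((isUnit_iff_ne_zero.2 (tPow_sub_one_ne_zero 𝕜 hweight.ne')).map C))

lemma comparison_of_not_surjective (hn : 0 < n) (hc : ¬ Function.Surjective c) :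
    Comparison 𝕜 c := by
  unfold Function.Surjective at hc
  push Not at hc
  obtain ⟨p, hp⟩ := hc
  exact comparison_of_subsingleton 𝕜 (edgeNonlocalIdeal_eq_top 𝕜 hp hn)
    (subsingleton_altGraphHomology 𝕜 hp hn)

end Separated

/-! ### The trivial braid on one strand -/

section Trivial

variable (𝕜 : Type u) [Field 𝕜] (c : Fin 0 → Fin 0)

/-- The only vertex of the closed braid graph of the trivial braid on one strand. -/
def trivialNode : (closedBraidGraph c).Node := Sum.inr ⟨0, fun j => j.elim0⟩

/-- The cut edge as an edge of the closed braid graph. -/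
def bottomEdge : (closedBraidGraph c).Edge := ClosedEdge.bottom

lemma eq_trivialNode (v : (closedBraidGraph c).Node) : v = trivialNode c := by
  cases v with
  | inl j => exact Fin.elim0 j
  | inr q => exact congrArg Sum.inr (Subtype.ext (Subsingleton.elim (α := Fin 1) _ _))

lemma tgtAndFraming_trivial_bottom : (ClosedEdge.bottom : ClosedEdge c).tgtAndFraming c =
    (some (Sum.inr ⟨0, fun j => j.elim0⟩), 0) := by
  rw [ClosedEdge.tgtAndFraming, dif_pos fun j => j.elim0]
  rfl

lemma trivial_edge_cases (e : (closedBraidGraph c).Edge) :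
    (e = bottomEdge c ∧ (closedBraidGraph c).src e = none ∧
      (closedBraidGraph c).tgt e = some (trivialNode c)) ∨
    (e = (ClosedEdge.bivalentOut ⟨0, fun j => j.elim0⟩ : ClosedEdge c) ∧
      (closedBraidGraph c).src e = some (trivialNode c) ∧ (closedBraidGraph c).tgt e = none) := by
  cases e with
  | bottom => exact Or.inl ⟨rfl, rfl, congrArg Prod.fst (tgtAndFraming_trivial_bottom c)⟩
  | left j => exact j.elim0
  | right j => exact j.elim0
  | bivalentOut q =>
    obtain rfl : q = ⟨0, fun j => j.elim0⟩ :=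
      Subtype.ext (Subsingleton.elim (α := Fin 1) _ _)
    exact Or.inr ⟨rfl, rfl, congrArg Prod.fst (climb_zero_last c)⟩

lemma trivial_framing (e : (closedBraidGraph c).Edge) : (closedBraidGraph c).framing e = 0 := by
  rcases trivial_edge_cases c e with ⟨rfl, -⟩ | ⟨rfl, -⟩
  · exact congrArg Prod.snd (tgtAndFraming_trivial_bottom c)
  · exact congrArg Prod.snd (climb_zero_last c)

lemma connected_trivial : (closedBraidGraph c).adjacency.Connected := by
  refine ThinGraph.connected_of_cutIn_nonempty src_eq_none_iff fun γ hγ => ?_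
  obtain ⟨v, hv⟩ := hγ
  rcases trivial_edge_cases c (bottomEdge c) with ⟨-, h1, h2⟩ | ⟨h, -⟩
  · refine ⟨_, (ThinGraph.mem_cutIn _).2 ⟨ThinGraph.not_starts_of_src_eq_none h1, ?_⟩⟩
    exact (ThinGraph.ends_of_tgt_eq_some h2).2 (eq_trivialNode c v ▸ hv)
  · cases h

lemma edgeLinearIdeal_trivial : edgeLinearIdeal 𝕜 (closedBraidGraph c) = ⊥ := by
  have : IsEmpty (closedBraidGraph c).Thick := inferInstanceAs (IsEmpty (Fin 0))
  rw [edgeLinearIdeal_eq, Set.range_eq_empty, Ideal.span_empty]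

/-- Without thick edges `L` is zero, so the first argument of Tor is free. -/
lemma subsingleton_tor_trivial (i : ℕ) :
    Subsingleton (torGroup 𝕜 (closedBraidGraph c) (i + 1)) := by
  have h : Module.Projective (EdgeRing 𝕜 (closedBraidGraph c))
      (EdgeRing 𝕜 (closedBraidGraph c) ⧸ edgeLinearIdeal 𝕜 (closedBraidGraph c)) :=
    Module.Projective.of_equiv
      (Submodule.quotEquivOfEqBot _ (edgeLinearIdeal_trivial 𝕜 c)).symm
  have := ModuleCat.projective_of_categoryTheory_projective (ModuleCat.of
    (EdgeRing 𝕜 (closedBraidGraph c))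
      (EdgeRing 𝕜 (closedBraidGraph c) ⧸ edgeLinearIdeal 𝕜 (closedBraidGraph c)))
  exact ModuleCat.subsingleton_of_isZero (CategoryTheory.isZero_Tor'_succ_of_projective _ _ _ i)

lemma altIdeal_trivial : altIdeal 𝕜 c = ⊥ := by
  have hthick : IsEmpty (layeredGraph c).Thick := inferInstanceAs (IsEmpty (Fin 0))
  have hbiv : IsEmpty (layeredGraph c).Bivalent :=
    ⟨fun q => Fin.elim0 (Subtype.val q).1⟩
  have hnode : ∀ γ : Finset (layeredGraph c).Node, γ = ∅ := fun γ =>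
    Finset.eq_empty_of_isEmpty γ
  rw [altIdeal, twistedLinearIdeal, twistedQuadraticIdeal, Set.range_eq_empty, Set.range_eq_empty,
    Set.range_eq_empty, Ideal.span_empty, bot_sup_eq, bot_sup_eq, bot_sup_eq, eq_bot_iff,
    twistedNonlocalIdeal, Ideal.span_le]
  rintro _ ⟨γ, rfl⟩
  have hout : (layeredGraph c).cutOut γ = ∅ := by
    rw [Finset.eq_empty_iff_forall_notMem]
    intro e he
    obtain ⟨⟨v, -⟩, -⟩ := (ThinGraph.mem_cutOut _).1 he
    exact isEmptyElim v
  have hin : (layeredGraph c).cutIn γ = ∅ := by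
    rw [Finset.eq_empty_iff_forall_notMem]
    intro e he
    obtain ⟨-, ⟨v, -⟩⟩ := (ThinGraph.mem_cutIn _).1 he
    exact isEmptyElim v
  have hw : vertexWeight (layeredGraph c) γ = 0 := by
    rw [hnode γ, vertexWeight, Finset.sum_empty]
  refine Ideal.mem_bot.2 ?_
  beta_reduce
  rw [hout, hin, hw, Finset.prod_empty, tPow_zero, C_1, mul_one, sub_self]

lemma edge_layeredGraph_eq (s s' : (layeredGraph c).Edge) : s = s' := by
  cases s with
  | some x => exact Fin.elim0 x.1
  | none =>
    cases s' with
    | some x => exact Fin.elim0 x.1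
    | none => rfl

lemma edgeToLayeredRing_prod_trivial (s : (layeredGraph c).Edge)
    (A : Finset (closedBraidGraph c).Edge) :
    edgeToLayeredRing 𝕜 c (∏ e ∈ A, X e) = X s ^ A.card := by
  rw [map_prod, ← Finset.prod_const]
  exact Finset.prod_congr rfl fun e _ => by
    rw [edgeToLayeredRing_X, edge_layeredGraph_eq c (first c e) s]

/-- The layered diagram is a single edge without vertices, so the map identifies the two variables
of `G`. With all framings zero, the relation at the bivalent vertex is exactly their difference. -/
lemma ker_edgeRingToAlt_trivial : RingHom.ker (edgeRingToAlt 𝕜 c) =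
    edgeLinearIdeal 𝕜 (closedBraidGraph c) ⊔ edgeNonlocalIdeal 𝕜 (closedBraidGraph c) := by
  have hmem : ∀ f, f ∈ RingHom.ker (edgeRingToAlt 𝕜 c) ↔ edgeToLayeredRing 𝕜 c f = 0 := by
    intro f
    rw [← Ideal.mem_bot, ← altIdeal_trivial 𝕜 c]
    exact Ideal.Quotient.eq_zero_iff_mem
  let s : (layeredGraph c).Edge := layeredEdge c 0 0
  rw [edgeLinearIdeal_trivial, bot_sup_eq, edgeNonlocalIdeal_eq]
  have hpar : ∀ v, vertexParameter 𝕜 (closedBraidGraph c) v = 1 := fun v => by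
    rw [vertexParameter, Finset.sum_eq_zero fun e _ => trivial_framing c e, tPow_zero]
  have hrel : ∀ γ, CutIdeal.relation (closedBraidGraph c).src (closedBraidGraph c).tgt
      (vertexParameter 𝕜 (closedBraidGraph c)) Finset.univ γ =
      ∏ e ∈ (closedBraidGraph c).cutIn γ, X e - ∏ e ∈ (closedBraidGraph c).cutOut γ, X e := by
    intro γ
    rw [ThinGraph.prod_cutIn_X, ThinGraph.prod_cutOut_X, CutIdeal.relation,
      Finset.prod_congr rfl fun v _ => hpar v, Finset.prod_const_one]
  apply le_antisymm
  · intro f hf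
    rw [hmem] at hf
    let g : ThinRing 𝕜 (layeredGraph c) →ₐ[LaurentSeries 𝕜] EdgeRing 𝕜 (closedBraidGraph c) :=
      aeval fun _ => X (bottomEdge c)
    set N := CutIdeal.ideal (closedBraidGraph c).src (closedBraidGraph c).tgt
      (vertexParameter 𝕜 (closedBraidGraph c)) Finset.univ Finset.univ with hN
    have hcomp : (Ideal.Quotient.mkₐ (LaurentSeries 𝕜) N).comp (g.comp (edgeToLayeredRing 𝕜 c)) =
        Ideal.Quotient.mkₐ (LaurentSeries 𝕜) N := by
      apply MvPolynomial.algHom_ext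
      intro e
      rw [AlgHom.comp_apply, AlgHom.comp_apply, edgeToLayeredRing_X]
      have hg : g (X (first c e)) = X (bottomEdge c) := aeval_X _ _
      rw [hg]
      rcases trivial_edge_cases c e with ⟨rfl, -⟩ | ⟨-, h1, h2⟩
      · rfl
      · refine Ideal.Quotient.eq.2 ?_
        have hmemN := CutIdeal.relation_mem_ideal (src := (closedBraidGraph c).src)
          (tgt := (closedBraidGraph c).tgt) (κ := vertexParameter 𝕜 (closedBraidGraph c))
          (D := Finset.univ) (Finset.subset_univ {trivialNode c})
        have hin : (closedBraidGraph c).cutIn {trivialNode c} =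
            {bottomEdge c} := by
          refine Finset.eq_singleton_iff_unique_mem.2 ⟨?_, fun f hf => ?_⟩
          · rcases trivial_edge_cases c (bottomEdge c) with ⟨-, h3, h4⟩ | ⟨h, -⟩
            · exact (ThinGraph.mem_cutIn _).2 ⟨ThinGraph.not_starts_of_src_eq_none h3,
                (ThinGraph.ends_of_tgt_eq_some h4).2 (Finset.mem_singleton_self _)⟩
            · cases h
          · rcases trivial_edge_cases c f with ⟨h, -⟩ | ⟨-, -, h⟩
            · exact h
            · exact absurd ((ThinGraph.mem_cutIn _).1 hf).2 (ThinGraph.not_ends_of_tgt_eq_none h)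
        have hout : (closedBraidGraph c).cutOut {trivialNode c} = {e} := by
          refine Finset.eq_singleton_iff_unique_mem.2 ⟨?_, fun f hf => ?_⟩
          · exact (ThinGraph.mem_cutOut _).2 ⟨(ThinGraph.starts_of_src_eq_some h1).2
              (Finset.mem_singleton_self _), ThinGraph.not_ends_of_tgt_eq_none h2⟩
          · rcases trivial_edge_cases c f with ⟨-, h, -⟩ | ⟨h, -⟩
            · exact absurd ((ThinGraph.mem_cutOut _).1 hf).1
                (ThinGraph.not_starts_of_src_eq_none h)
            · rcases trivial_edge_cases c e with ⟨-, h', -⟩ | ⟨h', -⟩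
              · rw [h1] at h'
                cases h'
              · rw [h, h']
        rw [hrel, hin, hout, Finset.prod_singleton, Finset.prod_singleton] at hmemN
        exact hmemN
    have h1 := DFunLike.congr_fun hcomp f
    rw [AlgHom.comp_apply, AlgHom.comp_apply, hf, map_zero, map_zero] at h1
    exact Ideal.Quotient.eq_zero_iff_mem.1 h1.symm
  · refine CutIdeal.ideal_le fun γ _ => ?_
    rw [hmem, hrel, map_sub, edgeToLayeredRing_prod_trivial 𝕜 c s,
      edgeToLayeredRing_prod_trivial 𝕜 c s, sub_eq_zero]
    -- Both monomials become powers of the one variable. Their exponents agree because the bivalent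
    -- vertex has one edge in and one edge out.
    congr 1
    have habel := (closedBraidGraph c).sum_cutOut_sub_sum_cutIn γ (fun _ => (1 : ℤ))
    have hdeg : ∀ v, ((closedBraidGraph c).outEdges v).card =
        ((closedBraidGraph c).inEdges v).card := by
      intro v
      rw [eq_trivialNode c v]
      let out : (closedBraidGraph c).Edge :=
        (ClosedEdge.bivalentOut ⟨0, fun j => j.elim0⟩ : ClosedEdge c)
      have h1 : (closedBraidGraph c).outEdges (trivialNode c) = {out} := by
        refine Finset.eq_singleton_iff_unique_mem.2
          ⟨(ThinGraph.mem_outEdges _).2 rfl, fun e he => ?_⟩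
        rw [ThinGraph.mem_outEdges] at he
        rcases trivial_edge_cases c e with ⟨-, h, -⟩ | ⟨h, -⟩
        · rw [h] at he
          cases he
        · exact h
      have h2 : (closedBraidGraph c).inEdges (trivialNode c) =
          {bottomEdge c} := by
        refine Finset.eq_singleton_iff_unique_mem.2 ⟨(ThinGraph.mem_inEdges _).2
          (congrArg Prod.fst (tgtAndFraming_trivial_bottom c)), fun e he => ?_⟩
        rw [ThinGraph.mem_inEdges] at he
        rcases trivial_edge_cases c e with ⟨h, -⟩ | ⟨-, -, h⟩
        · exact h
        · rw [h] at he
          cases he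
      rw [h1, h2, Finset.card_singleton, Finset.card_singleton]
    rw [Finset.sum_eq_zero (s := γ) fun v _ => by simp [hdeg v]] at habel
    simp only [Finset.sum_const, nsmul_eq_mul, mul_one] at habel
    omega

lemma edgeRingToAlt_surjective_trivial : Function.Surjective (edgeRingToAlt 𝕜 c) := by
  intro a
  obtain ⟨f, rfl⟩ := Ideal.Quotient.mk_surjective a
  have h : Function.Surjective (first c) := fun s =>
    ⟨ClosedEdge.bottom, edge_layeredGraph_eq c _ _⟩
  obtain ⟨g, rfl⟩ := rename_surjective (R := LaurentSeries 𝕜) (first c) h f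
  exact ⟨g, rfl⟩

lemma comparison_trivial : Comparison 𝕜 c :=
  comparison_of_connected 𝕜 (connected_trivial c) (subsingleton_tor_trivial 𝕜 c)
    (ker_edgeRingToAlt_trivial 𝕜 c) (edgeRingToAlt_surjective_trivial 𝕜 c)

end Trivial

/-- For `m > 0` the cases are whether every column contains a crossing. With several strands and no
crossing all weights are zero, so `t^w - 1` vanishes and the argument for disconnected graphs breaks
down; `hn` excludes this. -/
theorem comparison (𝕜 : Type u) [Field 𝕜] (m n : ℕ) (c : Fin n → Fin m) (hn : m = 0 ∨ 0 < n) :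
    Comparison 𝕜 c := by
  rcases Nat.eq_zero_or_pos m with rfl | hm
  · obtain rfl : n = 0 := by
      by_contra h
      exact (c ⟨0, Nat.pos_of_ne_zero h⟩).elim0
    exact comparison_trivial 𝕜 c
  · by_cases hc : Function.Surjective c
    · exact comparison_of_surjective 𝕜 hm hc
    · exact comparison_of_not_surjective 𝕜 (hn.resolve_left hm.ne') hc

end BraidGraph

end

theorem proposition2p4 {𝕜 : Type*} [Field 𝕜] (m n : ℕ) (c : Fin n → Fin m)
    (hn : m = 0 ∨ 0 < n) :
    -- `B(G^s)` is isomorphic to `A(G)`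
    Nonempty (BraidGraph.graphHomology 𝕜 (BraidGraph.closedBraidGraph c)
        {BraidGraph.cutComponent c}
      ≃ₗ[BraidGraph.EdgeRing 𝕜 (BraidGraph.closedBraidGraph c)]
        BraidGraph.altGraphHomology 𝕜 c) ∧
    -- both vanish if `G` is disconnected
    (¬ (BraidGraph.closedBraidGraph c).adjacency.Connected →
      Subsingleton (BraidGraph.graphHomology 𝕜 (BraidGraph.closedBraidGraph c)
        {BraidGraph.cutComponent c}) ∧
      Subsingleton (BraidGraph.altGraphHomology 𝕜 c)) ∧
    -- `B(G^s)` is concentrated in degree zero, where it is `A(G)`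
    (∀ i j : ℕ, (i, j) ≠ (0, 0) →
      Subsingleton (BraidGraph.graphHomologyPart 𝕜 (BraidGraph.closedBraidGraph c)
        {BraidGraph.cutComponent c} i j)) ∧
    Nonempty (BraidGraph.graphHomologyPart 𝕜 (BraidGraph.closedBraidGraph c)
        {BraidGraph.cutComponent c} 0 0
      ≃ₗ[BraidGraph.EdgeRing 𝕜 (BraidGraph.closedBraidGraph c)]
        BraidGraph.altGraphHomology 𝕜 c) :=
  BraidGraph.comparison 𝕜 m n c hn
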